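/- Let $\mathbb S^1=\mathbb R/2\pi\mathbb Z$ and consider $$\partial_t u-\partial_x\arctan\Big(\frac{\partial_x u}{u}\Big)=0\ \text{ on }\mathbb S^1\times[0,T],\qquad u(\cdot,0)=u_0. \tag{1}$$ By a solution of (1) on $[0,T]$ we mean a continuous function $u>0$ on $\mathbb S^1\times[0,T]$ with $u\in L^2(0,T;H^2(\mathbb S^1))$ and $u(\cdot,0)=u_0$ such that, for all $\varphi\in C^\infty(\mathbb S^1)$ and $t\in[0,T]$, $$\int_{\mathbb S^1}u(t)\varphi\,dx-\int_{\mathbb S^1}u_0\varphi\,dx=-\int_0^t\int_{\mathbb S^1}\arctan\Big(\frac{\partial_xu}{u}\Big)\partial_x\varphi\,dx\,ds .$$ There is an absolute constant $\varepsilon>0$, and for every $m>0$ there is a constant $c=c(m)>0$, such that the following holds. Let $u_0\in H^2(\mathbb S^1)$ (identified with its continuous representative) satisfy $u_0\ge m$ and $\|\arctan(\partial_xu_0/u_0)\|_{L^\infty(\mathbb S^1)}\le\varepsilon$, and let $0<T<\infty$. Then (1) has a solution on $[0,T]$, and every solution $u$ of (1) on $[0,T]$ has the following properties. For every $t\in[0,T]$,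 $u(t)\in H^2(\mathbb S^1)$ and $$\int_{\mathbb S^1}\frac{(u(t)\partial_x^2u(t)-(\partial_xu(t))^2)^2}{u(t)\,(u(t)^2+(\partial_xu(t))^2)}\,dx\le\Big(\int_{\mathbb S^1}\frac{(u_0\partial_x^2u_0-(\partial_xu_0)^2)^2}{u_0\,(u_0^2+(\partial_xu_0)^2)}\,dx\Big)\exp\Big(c\int_0^t\Big(\int_{\mathbb S^1}\frac{(u(s)\partial_x^2u(s)-(\partial_xu(s))^2)^2}{(u(s)^2+(\partial_xu(s))^2)^2}\,dx+1\Big)ds\Big),$$ where the integral over $s$ is finite. In particular, $u\in L^\infty(0,T;H^2(\mathbb S^1))$. -/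

import Mathlib

open MeasureTheory Set
open scoped ContDiff

noncomputable section

namespace ArctanDiffusion

/-- The circle of length `2π`; its measure `volume` has total mass `2π`. -/
abbrev S1 : Type := AddCircle (2 * Real.pi)

instance factTwoPiPos : Fact (0 < 2 * Real.pi) := ⟨Real.two_pi_pos⟩

/-- The classical derivative of a function on the circle. -/
def circleDeriv (φ : S1 → ℝ) (x : S1) : ℝ :=
  deriv (fun y : ℝ => φ (x + (y : S1))) 0

/-- Smooth test functions on the circle: the `2π`-periodic lift to the line is smooth. -/
def IsTest (φ : S1 → ℝ) : Prop :=
  ContDiff ℝ ∞ (fun y : ℝ => φ (y : S1))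

/-- `g` is a weak derivative of `f` on the circle. -/
structure HasWeakDeriv (f g : S1 → ℝ) : Prop where
  integrable_left : Integrable f
  integrable_right : Integrable g
  integral_eq : ∀ φ : S1 → ℝ, IsTest φ →
    ∫ x, f x * circleDeriv φ x = -∫ x, g x * φ x

open Classical in
/-- A representative of the weak derivative (which is unique up to null sets);
zero if there is no weak derivative. -/
def weakDeriv (f : S1 → ℝ) : S1 → ℝ :=
  if h : ∃ g, HasWeakDeriv f g then h.choose else 0

/-- `f` belongs to the Sobolev space `H²` of the circle. -/
def MemH2 (f : S1 → ℝ) : Prop :=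
  MemLp f 2 ∧ ∃ p q : S1 → ℝ,
    HasWeakDeriv f p ∧ MemLp p 2 ∧ HasWeakDeriv p q ∧ MemLp q 2

/-- The Lebesgue measure on `(0,T) × S¹`. -/
def spaceTime (T : ℝ) : Measure (ℝ × S1) :=
  (volume.restrict (Ioo 0 T)).prod volume

/-- `u ∈ L²(0,T;H²)`: the functions `p`, `q` are the first and the second weak derivative of `u`
in the space variable. -/
def MemL2H2 (T : ℝ) (u : ℝ → S1 → ℝ) : Prop :=
  MemLp (Function.uncurry u) 2 (spaceTime T) ∧
  ∃ p q : ℝ → S1 → ℝ,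
    MemLp (Function.uncurry p) 2 (spaceTime T) ∧
    MemLp (Function.uncurry q) 2 (spaceTime T) ∧
    ∀ᵐ t ∂(volume.restrict (Ioo 0 T)), HasWeakDeriv (u t) (p t) ∧ HasWeakDeriv (p t) (q t)

/-- `u ∈ L^∞(0,T;H²)`: as before, and the `H²` norm of `u t` is essentially bounded in time. -/
def MemLinftyH2 (T : ℝ) (u : ℝ → S1 → ℝ) : Prop :=
  AEStronglyMeasurable (Function.uncurry u) (spaceTime T) ∧
  ∃ (p q : ℝ → S1 → ℝ) (K : ℝ),
    AEStronglyMeasurable (Function.uncurry p) (spaceTime T) ∧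
    AEStronglyMeasurable (Function.uncurry q) (spaceTime T) ∧
    ∀ᵐ t ∂(volume.restrict (Ioo 0 T)),
      HasWeakDeriv (u t) (p t) ∧ HasWeakDeriv (p t) (q t) ∧
      MemLp (u t) 2 ∧ MemLp (p t) 2 ∧ MemLp (q t) 2 ∧
      Real.sqrt ((∫ x, u t x ^ 2) + (∫ x, p t x ^ 2) + ∫ x, q t x ^ 2) ≤ K

/-- `u` is a positive solution on `[0,T] × S¹` of
`∂ₜ u - ∂ₓ arctan (∂ₓ u / u) = 0`, `u(·,0) = u₀`,
which is continuous and lies in `L²(0,T;H²)`.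
The equation is tested with smooth functions of `x` and integrated in time. -/
structure IsSolution (T : ℝ) (u₀ : S1 → ℝ) (u : ℝ → S1 → ℝ) : Prop where
  continuousOn : ContinuousOn (Function.uncurry u) (Icc 0 T ×ˢ univ)
  pos : ∀ t ∈ Icc 0 T, ∀ x, 0 < u t x
  initial : u 0 = u₀
  memL2H2 : MemL2H2 T u
  equation : ∀ φ : S1 → ℝ, IsTest φ → ∀ t ∈ Icc 0 T,
    (∫ x, u t x * φ x) - (∫ x, u₀ x * φ x) =
      -∫ s in (0 : ℝ)..t, ∫ x, Real.arctan (weakDeriv (u s) x / u s x) * circleDeriv φ x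

/-- `∫ (f f'' - f'²)² / (f (f² + f'²)) dx`. -/
def weightedEnergy (f : S1 → ℝ) : ℝ :=
  ∫ x, (f x * weakDeriv (weakDeriv f) x - weakDeriv f x ^ 2) ^ 2 /
    (f x * (f x ^ 2 + weakDeriv f x ^ 2))

/-- `∫ (f f'' - f'²)² / (f² + f'²)² dx`. -/
def dissipation (f : S1 → ℝ) : ℝ :=
  ∫ x, (f x * weakDeriv (weakDeriv f) x - weakDeriv f x ^ 2) ^ 2 /
    (f x ^ 2 + weakDeriv f x ^ 2) ^ 2

end ArctanDiffusion

end

/-!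
Write `w = arctan (∂ₓ u / u)` for the flux and `a = ∂ₓ w = ∂ₜ u` for the velocity. Since
`∂ₓ u = u tan w`, the quantity `weightedEnergy u` is `E = ∫ a² u (1 + tan² w)` and `dissipation u`
is `∫ a²`. Put `y = ∂ₓ log u` and `z = a / u = ∂ₜ log u`; then `∂ₜ w = ∂ₓ z / (1 + y²)`, and
differentiating `E` in time produces the good term `-2 ∫ u² (∂ₓ z)²`, the error term
`∫ a³ (1 + y²)`, and error terms which carry a factor `y`. If `|w| ≤ δ`, an integration by parts
gives `∫ a⁴ ≤ 9 δ² ∫ (∂ₓ a)²`; together with the Poincaré inequality for `a`, which has mean zero,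
this absorbs all errors when `|y| ≤ δ = 1 / 10000`. So `E` is nonincreasing, which is more than the
claimed inequality: the exponential factor is at least one.

Solutions are constructed and estimated on the same footing. The semi-discrete flow
`∂ₜ uᵢ = (wᵢ - wᵢ₋₁) / h` on a cyclic grid (`GridFlow`) exists globally, because the maximum
principle preserves `μ ≤ u ≤ 2 μ` and `|y| ≤ δ` (`GridFlow.exists_of_initial`). The energy
computation holds verbatim on the grid (`GridData.energy_le`) and gives a bound for the discrete
energy, hence Hölder bounds in space and time for `u` and `w` which do not depend on the mesh. A
limit along an ultrafilter (`exists_gridLimit`) is a solution, and its energy at every time is at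
most the limit of the discrete initial energies, because `E` is convex in `a` and therefore lower
semicontinuous under weak convergence (`GridLimit.exists_hasPrim_W`). The discrete initial energies
are asymptotically at most `E(u₀)`, because second differences of `log u₀` are averages of its
second derivative (`eventually_gridEnergy_sample_le`).

These properties pass to every solution because solutions are unique (`IsSolution.eq`): the
equation contracts the `L¹` distance, since the flux is an increasing function of `∂ₓ log u` and
the logarithm is increasing.
-/

noncomputable section

namespace ArctanDiffusion

/-! ### Summation on a cyclic grid -/

section Grid

variable {N : ℕ} [NeZero N]

lemma sum_shift (f : ZMod N → ℝ) : ∑ i, f (i + 1) = ∑ i, f i :=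
  Equiv.sum_comp (Equiv.addRight (1 : ZMod N)) f

lemma sum_shift_sub (f : ZMod N → ℝ) : ∑ i, f (i - 1) = ∑ i, f i :=
  Equiv.sum_comp (Equiv.subRight (1 : ZMod N)) f

lemma sum_by_parts (f g : ZMod N → ℝ) :
    ∑ i, f i * (g i - g (i - 1)) = -∑ i, g i * (f (i + 1) - f i) := by
  have h := sum_shift (fun i => f i * g (i - 1))
  simp only [add_sub_cancel_right] at h
  simp only [mul_sub, Finset.sum_sub_distrib, ← h, neg_sub]
  congr 1
  · exact Finset.sum_congr rfl fun i _ => mul_comm _ _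
  · exact Finset.sum_congr rfl fun i _ => mul_comm _ _

/-- The oscillation of a function on the cyclic grid is at most its total variation. -/
lemma sub_le_sum_abs (b : ZMod N → ℝ) (i j : ZMod N) :
    b i - b j ≤ ∑ k, |b (k + 1) - b k| := by
  have key : ∀ n : ℕ, n ≤ N →
      b (j + (n : ZMod N)) - b j ≤ ∑ k ∈ Finset.range n, |b (j + (k : ZMod N) + 1) -
        b (j + (k : ZMod N))| := by
    intro n hn
    induction n with
    | zero => simp
    | succ n ih =>
      rw [Finset.sum_range_succ]
      have h1 := ih (by omega)
      have h2 := le_abs_self (b (j + (n : ZMod N) + 1) - b (j + (n : ZMod N)))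
      have h3 : j + ((n + 1 : ℕ) : ZMod N) = j + (n : ZMod N) + 1 := by push_cast; ring
      rw [h3]; linarith
  have h1 := key (i - j).val (ZMod.val_lt _).le
  have h2 : j + (((i - j).val : ℕ) : ZMod N) = i := by
    rw [ZMod.natCast_zmod_val]; ring
  rw [h2] at h1
  refine h1.trans ?_
  have hinj : Set.InjOn (fun k : ℕ => j + (k : ZMod N)) (Finset.range (i - j).val : Set ℕ) := by
    intro k hk l hl hkl
    have hv := ZMod.val_lt (i - j)
    simp only [Finset.coe_range, Set.mem_Iio] at hk hl
    have h3 : (k : ZMod N) = l := by simpa using hkl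
    have h4 := congrArg ZMod.val h3
    rwa [ZMod.val_natCast_of_lt (by omega), ZMod.val_natCast_of_lt (by omega)] at h4
  have h5 := Finset.sum_image (s := Finset.range (i - j).val)
    (f := fun k : ZMod N => |b (k + 1) - b k|) (g := fun k : ℕ => j + (k : ZMod N)) hinj
  rw [← h5]
  exact Finset.sum_le_sum_of_subset_of_nonneg (Finset.subset_univ _) fun _ _ _ => abs_nonneg _

/-- A function on the grid with zero sum is bounded by its total variation. -/
lemma abs_le_sum_abs_of_sum_eq_zero (b : ZMod N → ℝ) (hb : ∑ i, b i = 0) (i : ZMod N) :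
    |b i| ≤ ∑ k, |b (k + 1) - b k| := by
  obtain ⟨j, -, hj⟩ := Finset.exists_le_of_sum_le (s := Finset.univ) (f := b) (g := fun _ => 0)
    Finset.univ_nonempty (by simp [hb])
  obtain ⟨k, -, hk⟩ := Finset.exists_le_of_sum_le (s := Finset.univ) (f := fun _ => 0) (g := b)
    Finset.univ_nonempty (by simp [hb])
  rw [abs_le]
  constructor
  · linarith [sub_le_sum_abs b k i]
  · linarith [sub_le_sum_abs b i j]

/-- Discrete Poincaré inequality, in the form of a bound for the supremum. -/
lemma sq_le_of_sum_eq_zero (b : ZMod N → ℝ) (hb : ∑ i, b i = 0) (i : ZMod N) :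
    b i ^ 2 ≤ N * ∑ k, (b (k + 1) - b k) ^ 2 := by
  have h1 := abs_le_sum_abs_of_sum_eq_zero b hb i
  have h2 := sq_sum_le_card_mul_sum_sq (s := (Finset.univ : Finset (ZMod N)))
    (f := fun k => |b (k + 1) - b k|)
  simp only [sq_abs, Finset.card_univ, ZMod.card] at h2
  rw [← sq_abs]
  exact (pow_le_pow_left₀ (abs_nonneg _) h1 2).trans h2

/-- Discrete Agmon inequality: the supremum is controlled by the `L²` norms of a function and of
its difference quotient. -/
lemma sq_le_agmon {h : ℝ} (f : ZMod N → ℝ) {A B : ℝ} (hh : 0 < h)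
    (hA : h * ∑ i, f i ^ 2 ≤ A ^ 2) (hB : h * ∑ i, ((f (i + 1) - f i) / h) ^ 2 ≤ B ^ 2)
    (hA0 : 0 ≤ A) (hB0 : 0 ≤ B) (i : ZMod N) :
    f i ^ 2 ≤ A ^ 2 / (N * h) + 2 * A * B := by
  have hN : (0 : ℝ) < N := by exact_mod_cast Nat.pos_of_ne_zero (NeZero.ne N)
  obtain ⟨j, -, hj⟩ := Finset.exists_le_of_sum_le (s := (Finset.univ : Finset (ZMod N)))
    (f := fun i => f i ^ 2)
    (g := fun _ => A ^ 2 / (N * h)) Finset.univ_nonempty (by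
      simp only [Finset.sum_const, Finset.card_univ, ZMod.card, nsmul_eq_mul]
      rw [show (N : ℝ) * (A ^ 2 / (N * h)) = A ^ 2 / h by field_simp, le_div_iff₀ hh]
      linarith)
  have h1 := sub_le_sum_abs (fun i => f i ^ 2) i j
  have h2 : ∑ k, |f (k + 1) ^ 2 - f k ^ 2| ≤ 2 * A * B := by
    have e : ∀ k, |f (k + 1) ^ 2 - f k ^ 2| =
        h * (|f (k + 1) + f k| * |(f (k + 1) - f k) / h|) := by
      intro k
      rw [← abs_mul, show h * |(f (k + 1) + f k) * ((f (k + 1) - f k) / h)| =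
        |h| * |(f (k + 1) + f k) * ((f (k + 1) - f k) / h)| by rw [abs_of_pos hh], ← abs_mul]
      congr 1
      field_simp
      ring
    simp only [e, ← Finset.mul_sum]
    have cs := Finset.sum_mul_sq_le_sq_mul_sq Finset.univ (fun k => |f (k + 1) + f k|)
      (fun k => |(f (k + 1) - f k) / h|)
    simp only [sq_abs] at cs
    have e2 : ∑ k, (f (k + 1) + f k) ^ 2 ≤ 4 * ∑ k, f k ^ 2 := by
      have := Finset.sum_le_sum (s := Finset.univ) fun k (_ : k ∈ Finset.univ) =>
        show (f (k + 1) + f k) ^ 2 ≤ 2 * f (k + 1) ^ 2 + 2 * f k ^ 2 by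
          nlinarith [sq_nonneg (f (k + 1) - f k)]
      rw [Finset.sum_add_distrib, ← Finset.mul_sum, ← Finset.mul_sum,
        sum_shift (fun k => f k ^ 2)] at this
      linarith
    apply le_of_sq_le_sq _ (by positivity)
    set X := ∑ k, |f (k + 1) + f k| * |(f (k + 1) - f k) / h|
    set Y := ∑ k, ((f (k + 1) - f k) / h) ^ 2
    have hY : 0 ≤ Y := Finset.sum_nonneg fun _ _ => sq_nonneg _
    calc (h * X) ^ 2 = h ^ 2 * X ^ 2 := by ring
      _ ≤ h ^ 2 * ((∑ k, (f (k + 1) + f k) ^ 2) * Y) := by gcongr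
      _ ≤ h ^ 2 * ((4 * ∑ k, f k ^ 2) * Y) := by gcongr
      _ = 4 * (h * ∑ k, f k ^ 2) * (h * Y) := by ring
      _ ≤ 4 * A ^ 2 * B ^ 2 := by gcongr
      _ = (2 * A * B) ^ 2 := by ring
  have h3 : f i ^ 2 - f j ^ 2 ≤ 2 * A * B := h1.trans h2
  linarith

end Grid

/-! ### Elementary inequalities for the logarithm and the arctangent -/

lemma abs_sub_le_mul_abs_arctan_sub {δ x y : ℝ} (hx : |x| ≤ δ) (hy : |y| ≤ δ) :
    |x - y| ≤ (1 + δ ^ 2) * |Real.arctan x - Real.arctan y| := by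
  wlog hxy : y < x generalizing x y
  · rcases eq_or_lt_of_le (not_lt.mp hxy) with h | h
    · simp [h]
    · rw [abs_sub_comm, abs_sub_comm (Real.arctan x)]
      exact this hy hx h
  have hd : ∀ z, HasDerivAt Real.arctan (1 / (1 + z ^ 2)) z := Real.hasDerivAt_arctan
  obtain ⟨c, hc, hc'⟩ := exists_hasDerivAt_eq_slope Real.arctan _ hxy
    Real.continuous_arctan.continuousOn fun z _ => hd z
  have hcb : c ^ 2 ≤ δ ^ 2 := by
    apply sq_le_sq' <;> [linarith [hc.1, (abs_le.mp hy).1]; linarith [hc.2, (abs_le.mp hx).2]]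
  rw [eq_div_iff (by linarith)] at hc'
  rw [← hc', abs_mul, abs_of_pos (show 0 < 1 / (1 + c ^ 2) by positivity)]
  have h0 := abs_nonneg (x - y)
  rw [← mul_assoc, mul_one_div]
  exact le_mul_of_one_le_left h0 (by rw [le_div_iff₀ (by positivity)]; linarith)

lemma abs_sub_le_mul_abs_log_sub {M x y : ℝ} (hx : 0 < x) (hy : 0 < y) (hxM : x ≤ M)
    (hyM : y ≤ M) : |x - y| ≤ M * |Real.log x - Real.log y| := by
  wlog hxy : y ≤ x generalizing x y
  · rw [abs_sub_comm, abs_sub_comm (Real.log x)]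
    exact this hy hx hyM hxM (not_le.mp hxy).le
  have h1 := Real.log_le_sub_one_of_pos (div_pos hy hx)
  rw [Real.log_div hy.ne' hx.ne'] at h1
  have h2 := Real.log_le_log hy hxy
  rw [abs_of_nonneg (by linarith), abs_of_nonneg (by linarith)]
  have h3 : x - y ≤ x * (Real.log x - Real.log y) := by
    have : x * (y / x) = y := by field_simp
    nlinarith
  nlinarith

lemma abs_arctan_sub_le (x y : ℝ) : |Real.arctan x - Real.arctan y| ≤ |x - y| := by
  have h := Convex.norm_image_sub_le_of_norm_hasDerivWithin_le (f := Real.arctan) (C := 1)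
    (s := univ) (x := y) (y := x) (fun z _ => (Real.hasDerivAt_arctan z).hasDerivWithinAt)
    (fun z _ => by
      rw [Real.norm_of_nonneg (by positivity), div_le_one (by positivity)]
      nlinarith [sq_nonneg z]) convex_univ (mem_univ _) (mem_univ _)
  simpa using h

lemma abs_arctan_le (y : ℝ) : |Real.arctan y| ≤ |y| := by
  simpa using abs_arctan_sub_le y 0

/-! ### The discrete energy inequality -/

section Energy

variable {N : ℕ} [NeZero N]

/-- The discrete derivative `a` of a function `w` of size `δ` has a fourth moment which is small
compared with the second moment of its own derivative `D`: sum by parts in `∑ a³ (w i - w (i - 1))`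
and absorb. -/
lemma sum_pow_four_le {δ h : ℝ} (hh : 0 < h) (w a D : ZMod N → ℝ) (hw : ∀ i, |w i| ≤ δ)
    (ha : ∀ i, h * a i = w i - w (i - 1)) (hD : ∀ i, h * D i = a (i + 1) - a i) :
    ∑ i, a i ^ 4 ≤ 9 * δ ^ 2 * ∑ i, D i ^ 2 := by
  have hδ : 0 ≤ δ := (abs_nonneg _).trans (hw 0)
  have h1 : h * ∑ i, a i ^ 4 = -∑ i, w i * (a (i + 1) ^ 3 - a i ^ 3) := by
    rw [← sum_by_parts (fun i => a i ^ 3) w, Finset.mul_sum]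
    exact Finset.sum_congr rfl fun i _ => by rw [← ha]; ring
  have h2 : ∀ i, -(w i * (a (i + 1) ^ 3 - a i ^ 3)) ≤
      h * (1 / 4 * a (i + 1) ^ 4 + 1 / 4 * a i ^ 4 + 9 / 2 * δ ^ 2 * D i ^ 2) := by
    intro i
    have e : a (i + 1) ^ 3 - a i ^ 3 =
        h * D i * (a (i + 1) ^ 2 + a (i + 1) * a i + a i ^ 2) := by rw [hD]; ring
    rw [e]
    have hp : 0 ≤ a (i + 1) ^ 2 + a (i + 1) * a i + a i ^ 2 := by
      nlinarith [sq_nonneg (a (i + 1) + a i), sq_nonneg (a (i + 1)), sq_nonneg (a i)]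
    have hp2 : a (i + 1) ^ 2 + a (i + 1) * a i + a i ^ 2 ≤
        3 / 2 * (a (i + 1) ^ 2 + a i ^ 2) := by nlinarith [sq_nonneg (a (i + 1) - a i)]
    have b1 : -(w i * (h * D i * (a (i + 1) ^ 2 + a (i + 1) * a i + a i ^ 2))) ≤
        δ * (h * |D i| * (a (i + 1) ^ 2 + a (i + 1) * a i + a i ^ 2)) := by
      refine (neg_le_abs _).trans ?_
      rw [abs_mul, abs_mul, abs_mul, abs_of_pos hh, abs_of_nonneg hp]
      gcongr
      exact hw i
    refine b1.trans ?_
    have b2 : δ * |D i| * (3 / 2 * (a (i + 1) ^ 2 + a i ^ 2)) ≤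
        1 / 4 * a (i + 1) ^ 4 + 1 / 4 * a i ^ 4 + 9 / 2 * δ ^ 2 * D i ^ 2 := by
      rw [← sq_abs (D i)]
      nlinarith [sq_nonneg (a (i + 1) ^ 2 - 3 * (δ * |D i|)), sq_nonneg (a i ^ 2 - 3 * (δ * |D i|))]
    calc δ * (h * |D i| * (a (i + 1) ^ 2 + a (i + 1) * a i + a i ^ 2))
        ≤ δ * (h * |D i| * (3 / 2 * (a (i + 1) ^ 2 + a i ^ 2))) := by gcongr
      _ = h * (δ * |D i| * (3 / 2 * (a (i + 1) ^ 2 + a i ^ 2))) := by ring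
      _ ≤ _ := by gcongr
  have h3 := Finset.sum_le_sum (s := Finset.univ) fun i _ => h2 i
  rw [Finset.sum_neg_distrib, ← h1, ← Finset.mul_sum] at h3
  have h4 := le_of_mul_le_mul_left h3 hh
  rw [Finset.sum_add_distrib, Finset.sum_add_distrib, ← Finset.mul_sum, ← Finset.mul_sum,
    ← Finset.mul_sum, sum_shift (fun i => a i ^ 4)] at h4
  linarith

/-- The quantities attached to a positive function `u` on the cyclic grid of mesh `h` which lies
between `μ` and `2 * μ` and whose logarithm has small difference quotients `y`:
`a` is the difference quotient of `arctan y` and `z = a / u`; `A` and `Z` are the difference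
quotients of `a` and `z`. The defining relations are multiplied out, so that no quotient occurs.
The bound `63 / 10` for the length `N * h` of the circle is a rational number above `2π`, and
`1 / 10000` is small enough for the error terms in the energy inequality to be absorbed. -/
structure GridData (h μ : ℝ) (u y a z A Z : ZMod N → ℝ) : Prop where
  h_pos : 0 < h
  Nh_le : (N : ℝ) * h ≤ 63 / 10
  μ_pos : 0 < μ
  lower : ∀ i, μ ≤ u i
  upper : ∀ i, u i ≤ 2 * μ
  y_le : ∀ i, |y i| ≤ 1 / 10000
  y_eq : ∀ i, h * y i = Real.log (u (i + 1)) - Real.log (u i)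
  a_eq : ∀ i, h * a i = Real.arctan (y i) - Real.arctan (y (i - 1))
  z_eq : ∀ i, u i * z i = a i
  A_eq : ∀ i, h * A i = a (i + 1) - a i
  Z_eq : ∀ i, h * Z i = z (i + 1) - z i

namespace GridData

variable {h μ : ℝ} {u y a z A Z : ZMod N → ℝ}

lemma sum_a (G : GridData h μ u y a z A Z) : ∑ i, a i = 0 := by
  have h1 : h * ∑ i, a i = 0 := by
    rw [Finset.mul_sum, Finset.sum_congr rfl fun i _ => G.a_eq i, Finset.sum_sub_distrib,
      sum_shift_sub (fun i => Real.arctan (y i)), sub_self]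
  exact (mul_eq_zero.mp h1).resolve_left G.h_pos.ne'

lemma sq_a_le (G : GridData h μ u y a z A Z) (i : ZMod N) :
    a i ^ 2 ≤ 63 / 10 * (h * ∑ i, A i ^ 2) := by
  have h1 := sq_le_of_sum_eq_zero a G.sum_a i
  have h2 : ∑ k, (a (k + 1) - a k) ^ 2 = h ^ 2 * ∑ i, A i ^ 2 := by
    rw [Finset.mul_sum]
    exact Finset.sum_congr rfl fun i _ => by rw [← G.A_eq]; ring
  rw [h2] at h1
  have h3 := G.Nh_le
  have h4 : 0 ≤ h * ∑ i, A i ^ 2 :=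
    mul_nonneg G.h_pos.le (Finset.sum_nonneg fun _ _ => sq_nonneg _)
  nlinarith

lemma sum_sq_a_le (G : GridData h μ u y a z A Z) : ∑ i, a i ^ 2 ≤ 40 * ∑ i, A i ^ 2 := by
  have h1 := Finset.sum_le_sum (s := Finset.univ) fun i _ => G.sq_a_le i
  simp only [Finset.sum_const, Finset.card_univ, ZMod.card, nsmul_eq_mul] at h1
  have h3 := G.Nh_le
  have h4 : 0 ≤ ∑ i, A i ^ 2 := Finset.sum_nonneg fun _ _ => sq_nonneg _
  nlinarith

lemma sum_pow_four_a_le (G : GridData h μ u y a z A Z) :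
    ∑ i, a i ^ 4 ≤ 9 * (1 / 10000) ^ 2 * ∑ i, A i ^ 2 :=
  sum_pow_four_le G.h_pos (fun i => Real.arctan (y i)) a A
    (fun i => (abs_arctan_le _).trans (G.y_le i)) G.a_eq G.A_eq

omit [NeZero N] in
lemma abs_u_sub_le (G : GridData h μ u y a z A Z) (i : ZMod N) :
    |u (i + 1) - u i| ≤ 2 * μ * (h * (1 / 10000)) := by
  have hp := fun i => G.μ_pos.trans_le (G.lower i)
  refine (abs_sub_le_mul_abs_log_sub (hp _) (hp _) (G.upper _) (G.upper _)).trans ?_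
  rw [← G.y_eq, abs_mul, abs_of_pos G.h_pos]
  have := G.μ_pos
  have := G.h_pos
  have := G.y_le i
  gcongr

omit [NeZero N] in
lemma abs_z_le (G : GridData h μ u y a z A Z) (i : ZMod N) : μ * |z i| ≤ |a i| := by
  rw [← G.z_eq, abs_mul, abs_of_pos (G.μ_pos.trans_le (G.lower i))]
  gcongr
  exact G.lower i

omit [NeZero N] in
/-- The product rule for `a = u z`; the derivative of `u` is small. -/
lemma abs_A_le (G : GridData h μ u y a z A Z) (i : ZMod N) :
    |A i| ≤ 2 * (μ * |Z i|) + 2 * (1 / 10000) * |a i| := by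
  have hh := G.h_pos
  have e : h * A i = u (i + 1) * (h * Z i) + z i * (u (i + 1) - u i) := by
    rw [G.A_eq, G.Z_eq, ← G.z_eq, ← G.z_eq]; ring
  have h1 : h * |A i| ≤ h * (2 * (μ * |Z i|) + 2 * (1 / 10000) * |a i|) := by
    rw [← abs_of_pos hh, ← abs_mul, abs_of_pos hh, e]
    refine (abs_add_le _ _).trans ?_
    rw [abs_mul, abs_mul, abs_mul, abs_of_pos hh, abs_of_pos (G.μ_pos.trans_le (G.lower _))]
    have h2 := G.abs_u_sub_le i
    have h3 := G.abs_z_le i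
    have h4 := G.upper (i + 1)
    calc u (i + 1) * (h * |Z i|) + |z i| * |u (i + 1) - u i|
        ≤ 2 * μ * (h * |Z i|) + |z i| * (2 * μ * (h * (1 / 10000))) := by gcongr
      _ = 2 * μ * (h * |Z i|) + 2 * (h * (1 / 10000)) * (μ * |z i|) := by ring
      _ ≤ 2 * μ * (h * |Z i|) + 2 * (h * (1 / 10000)) * |a i| := by gcongr
      _ = _ := by ring
  exact le_of_mul_le_mul_left h1 hh

lemma sum_sq_A_le (G : GridData h μ u y a z A Z) :
    ∑ i, A i ^ 2 ≤ 9 * (μ ^ 2 * ∑ i, Z i ^ 2) := by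
  have h1 := Finset.sum_le_sum (s := Finset.univ) fun i (_ : i ∈ Finset.univ) =>
    show A i ^ 2 ≤ 8 * (μ ^ 2 * Z i ^ 2) + 1 / 1000 * a i ^ 2 by
      have h2 := G.abs_A_le i
      rw [← sq_abs (A i), ← sq_abs (Z i), ← sq_abs (a i), ← mul_pow]
      have h3 := abs_nonneg (A i)
      have h4 := pow_le_pow_left₀ h3 h2 2
      nlinarith [sq_nonneg (μ * |Z i| - (1 / 10000) * |a i|), sq_nonneg (|a i|)]
  rw [Finset.sum_add_distrib, ← Finset.mul_sum, ← Finset.mul_sum, ← Finset.mul_sum] at h1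
  have h2 := G.sum_sq_a_le
  have h3 : 0 ≤ μ ^ 2 * ∑ i, Z i ^ 2 :=
    mul_nonneg (sq_nonneg _) (Finset.sum_nonneg fun _ _ => sq_nonneg _)
  linarith

omit [NeZero N] in
/-- Bound for the increment of `u² (1 + y²)`. -/
lemma abs_kappa_sub_le (G : GridData h μ u y a z A Z) (i : ZMod N) :
    |u (i + 1) ^ 2 * (1 + y (i + 1) ^ 2) - u i ^ 2 * (1 + y i ^ 2)| ≤
      h * (10 * (1 / 10000) * μ ^ 2 * (1 + |a (i + 1)|)) := by
  have hh := G.h_pos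
  have hμ := G.μ_pos
  have e : u (i + 1) ^ 2 * (1 + y (i + 1) ^ 2) - u i ^ 2 * (1 + y i ^ 2) =
    u (i + 1) ^ 2 * ((y (i + 1) + y i) * (y (i + 1) - y i)) +
      (1 + y i ^ 2) * ((u (i + 1) + u i) * (u (i + 1) - u i)) := by ring
  have hy0 := G.y_le i
  have hy1 := G.y_le (i + 1)
  have h1 : |y (i + 1) - y i| ≤ 101 / 100 * (h * |a (i + 1)|) := by
    have h2 := abs_sub_le_mul_abs_arctan_sub hy1 hy0
    have h3 := G.a_eq (i + 1)
    rw [add_sub_cancel_right] at h3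
    rw [← h3, abs_mul, abs_of_pos hh] at h2
    have : 0 ≤ h * |a (i + 1)| := by positivity
    nlinarith
  have h2 : |y (i + 1) + y i| ≤ 2 * (1 / 10000) := (abs_add_le _ _).trans (by linarith)
  have h3 := G.abs_u_sub_le i
  have hu0 := G.μ_pos.trans_le (G.lower i)
  have hu1 := G.μ_pos.trans_le (G.lower (i + 1))
  have h4 : |u (i + 1) + u i| ≤ 4 * μ := by
    rw [abs_of_pos (by positivity)]; linarith [G.upper i, G.upper (i + 1)]
  have h5 : u (i + 1) ^ 2 ≤ (2 * μ) ^ 2 := by gcongr; exact G.upper _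
  have h6 : 1 + y i ^ 2 ≤ 101 / 100 := by
    rw [← sq_abs]
    have := pow_le_pow_left₀ (abs_nonneg _) hy0 2
    norm_num at this ⊢
    linarith
  rw [e]
  refine (abs_add_le _ _).trans ?_
  rw [abs_mul, abs_mul, abs_mul, abs_mul, abs_of_nonneg (sq_nonneg (u (i + 1))),
    abs_of_pos (show 0 < 1 + y i ^ 2 by positivity)]
  calc _ ≤ (2 * μ) ^ 2 * (2 * (1 / 10000) * (101 / 100 * (h * |a (i + 1)|))) +
        101 / 100 * (4 * μ * (2 * μ * (h * (1 / 10000)))) := by gcongr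
    _ = h * (808 / 100 * (1 / 10000) * μ ^ 2 * (1 + |a (i + 1)|)) := by ring
    _ ≤ _ := by
      have : 0 ≤ μ ^ 2 * (1 + |a (i + 1)|) := by positivity
      gcongr
      linarith

/-- The discrete energy inequality. The left side is the time derivative of
`∑ a² u (1 + y²)` along the semi-discrete flow. The cubic term has no sign, but is controlled by
small multiples of the second and large multiples of the fourth moment of `a`; the other terms
without a sign carry a factor `y`. All are absorbed by the dissipation on the right side. -/
lemma energy_le (G : GridData h μ u y a z A Z) (a' : ZMod N → ℝ)
    (ha' : ∀ i, h * a' i = Z i / (1 + y i ^ 2) - Z (i - 1) / (1 + y (i - 1) ^ 2)) :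
    ∑ i, (2 * a i * a' i * (u i * (1 + y i ^ 2)) + a i ^ 3 * (1 + y i ^ 2) +
      2 * a i ^ 2 * u i * (y i * Z i)) ≤ -(μ ^ 2 * ∑ i, Z i ^ 2) := by
  have hh := G.h_pos
  have hμ := G.μ_pos
  have hy2 : ∀ i, y i ^ 2 ≤ 1 / 100 := fun i => by
    rw [← sq_abs]
    have := pow_le_pow_left₀ (abs_nonneg _) (G.y_le i) 2
    norm_num at this ⊢
    linarith
  -- summation by parts moves the difference quotient from `Z / (1 + y²)` to `u² (1 + y²) z`
  have e1 : ∑ i, 2 * a i * a' i * (u i * (1 + y i ^ 2)) =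
      ∑ i, -(2 * (Z i / (1 + y i ^ 2)) * ((u (i + 1) ^ 2 * (1 + y (i + 1) ^ 2)) * Z i +
        z i * ((u (i + 1) ^ 2 * (1 + y (i + 1) ^ 2) - u i ^ 2 * (1 + y i ^ 2)) / h))) := by
    have h1 := sum_by_parts (fun i => 2 / h * (a i * (u i * (1 + y i ^ 2))))
      (fun i => Z i / (1 + y i ^ 2))
    have h2 : ∑ i, 2 * a i * a' i * (u i * (1 + y i ^ 2)) = ∑ i, 2 / h * (a i * (u i *
        (1 + y i ^ 2))) * (Z i / (1 + y i ^ 2) - Z (i - 1) / (1 + y (i - 1) ^ 2)) := by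
      refine Finset.sum_congr rfl fun i _ => ?_
      rw [← ha']; field_simp
    rw [h2, h1, ← Finset.sum_neg_distrib]
    refine Finset.sum_congr rfl fun i _ => ?_
    rw [← G.z_eq, ← G.z_eq]
    have h3 : z (i + 1) = z i + h * Z i := by rw [G.Z_eq]; ring
    rw [h3]
    field_simp
    ring
  have b1 : ∀ i, -(2 * (Z i / (1 + y i ^ 2)) * ((u (i + 1) ^ 2 * (1 + y (i + 1) ^ 2)) * Z i +
        z i * ((u (i + 1) ^ 2 * (1 + y (i + 1) ^ 2) - u i ^ 2 * (1 + y i ^ 2)) / h))) ≤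
      -(9 / 5) * (μ ^ 2 * Z i ^ 2) + 20 * (1 / 10000) * (μ ^ 2 * Z i ^ 2 + a i ^ 2 / 2 +
        (a i ^ 4 + a (i + 1) ^ 4) / 4) := by
    intro i
    have hp : (0 : ℝ) < 1 + y i ^ 2 := by positivity
    -- the dissipation
    have t1 : 9 / 5 * (μ ^ 2 * Z i ^ 2) ≤
        2 * (Z i / (1 + y i ^ 2)) * ((u (i + 1) ^ 2 * (1 + y (i + 1) ^ 2)) * Z i) := by
      have : 2 * (Z i / (1 + y i ^ 2)) * ((u (i + 1) ^ 2 * (1 + y (i + 1) ^ 2)) * Z i) =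
        2 * (u (i + 1) ^ 2 * Z i ^ 2) * ((1 + y (i + 1) ^ 2) / (1 + y i ^ 2)) := by
          field_simp
      rw [this]
      have q1 : 9 / 10 ≤ (1 + y (i + 1) ^ 2) / (1 + y i ^ 2) := by
        rw [le_div_iff₀ hp]; nlinarith [hy2 i, sq_nonneg (y (i + 1))]
      have q2 : μ ^ 2 ≤ u (i + 1) ^ 2 := by gcongr; exact G.lower _
      calc 9 / 5 * (μ ^ 2 * Z i ^ 2) = 2 * (μ ^ 2 * Z i ^ 2) * (9 / 10) := by ring
        _ ≤ _ := by gcongr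
    -- the term in which the difference quotient falls on `u² (1 + y²)`
    have t2 : -(2 * (Z i / (1 + y i ^ 2)) *
        (z i * ((u (i + 1) ^ 2 * (1 + y (i + 1) ^ 2) - u i ^ 2 * (1 + y i ^ 2)) / h))) ≤
        20 * (1 / 10000) * (μ * |Z i| * |a i| * (1 + |a (i + 1)|)) := by
      refine (neg_le_abs _).trans ?_
      rw [abs_mul, abs_mul, abs_mul, abs_div, abs_div, abs_of_pos hp, abs_of_pos hh,
        abs_of_pos (show (0 : ℝ) < 2 by norm_num)]
      have q1 := G.abs_kappa_sub_le i
      have q2 := G.abs_z_le i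
      have q3 : |Z i| / (1 + y i ^ 2) ≤ |Z i| :=
        div_le_self (abs_nonneg _) (by nlinarith [sq_nonneg (y i)])
      have q4 : |u (i + 1) ^ 2 * (1 + y (i + 1) ^ 2) - u i ^ 2 * (1 + y i ^ 2)| / h ≤
          10 * (1 / 10000) * μ ^ 2 * (1 + |a (i + 1)|) := by
        rw [div_le_iff₀ hh]; linarith
      calc _ ≤ 2 * |Z i| * (|z i| * (10 * (1 / 10000) * μ ^ 2 * (1 + |a (i + 1)|))) := by gcongr
        _ = 20 * (1 / 10000) * (μ * |Z i| * (μ * |z i|) * (1 + |a (i + 1)|)) := by ring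
        _ ≤ _ := by gcongr
    have t3 : μ * |Z i| * |a i| * (1 + |a (i + 1)|) ≤
        μ ^ 2 * Z i ^ 2 + a i ^ 2 / 2 + (a i ^ 4 + a (i + 1) ^ 4) / 4 := by
      have e4 : ∀ x : ℝ, x ^ 4 = |x| ^ 4 := fun x =>
        (Even.pow_abs ⟨2, rfl⟩ x).symm
      rw [e4 (a i), e4 (a (i + 1)), ← sq_abs (Z i), ← sq_abs (a i)]
      nlinarith [sq_nonneg (μ * |Z i| - |a i|), sq_nonneg (μ * |Z i| - |a i| * |a (i + 1)|),
        sq_nonneg (|a i| ^ 2 - |a (i + 1)| ^ 2)]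
    linarith [mul_add (2 * (Z i / (1 + y i ^ 2))) ((u (i + 1) ^ 2 * (1 + y (i + 1) ^ 2)) * Z i)
      (z i * ((u (i + 1) ^ 2 * (1 + y (i + 1) ^ 2) - u i ^ 2 * (1 + y i ^ 2)) / h))]
  -- the weight `1 / 10000` makes the two sums absorbable by `sum_sq_a_le` and `sum_pow_four_a_le`
  have b2 : ∀ i, a i ^ 3 * (1 + y i ^ 2) ≤
      1 / 10000 * a i ^ 2 + 10000 * a i ^ 4 := by
    intro i
    have := hy2 i
    have q : a i ^ 3 * (1 + y i ^ 2) ≤ 101 / 100 * (|a i| * a i ^ 2) := by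
      have : a i ^ 3 ≤ |a i| * a i ^ 2 := by
        nlinarith [mul_le_mul_of_nonneg_right (le_abs_self (a i)) (sq_nonneg (a i))]
      have q0 : 0 ≤ |a i| * a i ^ 2 := by positivity
      nlinarith [sq_nonneg (y i)]
    refine q.trans ?_
    rw [show a i ^ 4 = (a i ^ 2) ^ 2 by ring, ← sq_abs (a i)]
    nlinarith [mul_nonneg (sq_nonneg (|a i|)) (sq_nonneg (|a i| - 1 / 10000)), sq_nonneg (|a i|),
      sq_nonneg (|a i| ^ 2)]
  have b3 : ∀ i, 2 * a i ^ 2 * u i * (y i * Z i) ≤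
      2 * (1 / 10000) * (a i ^ 4 + μ ^ 2 * Z i ^ 2) := by
    intro i
    refine (le_abs_self _).trans ?_
    have hu0 := G.μ_pos.trans_le (G.lower i)
    rw [abs_mul, abs_mul, abs_mul, abs_mul, abs_of_pos hu0, abs_of_nonneg (sq_nonneg (a i)),
      abs_of_pos (show (0 : ℝ) < 2 by norm_num)]
    have := G.y_le i
    have := G.upper i
    calc _ ≤ 2 * a i ^ 2 * (2 * μ) * (1 / 10000 * |Z i|) := by gcongr
      _ ≤ _ := by
        rw [← sq_abs (Z i)]
        nlinarith [sq_nonneg (a i ^ 2 - μ * |Z i|)]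
  rw [Finset.sum_add_distrib, Finset.sum_add_distrib, e1]
  have s1 := Finset.sum_le_sum (s := Finset.univ) fun i _ => b1 i
  have s2 := Finset.sum_le_sum (s := Finset.univ) fun i _ => b2 i
  have s3 := Finset.sum_le_sum (s := Finset.univ) fun i _ => b3 i
  simp only [Finset.sum_add_distrib, ← Finset.mul_sum, ← Finset.sum_div,
    sum_shift (fun i => a i ^ 4)] at s1 s2 s3
  have r1 := G.sum_sq_a_le
  have r2 := G.sum_pow_four_a_le
  have r3 := G.sum_sq_A_le
  have r4 : 0 ≤ ∑ i, A i ^ 2 := Finset.sum_nonneg fun _ _ => sq_nonneg _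
  have r5 : 0 ≤ ∑ i, a i ^ 4 := Finset.sum_nonneg fun _ _ => by positivity
  norm_num at *
  linarith

end GridData

end Energy

/-! ### The semi-discrete flow -/

section Flow

variable {N : ℕ} [NeZero N]

/-- Difference quotient of the logarithm on the grid of mesh `h`. -/
def gridSlope (h : ℝ) (f : ZMod N → ℝ) (i : ZMod N) : ℝ :=
  (Real.log (f (i + 1)) - Real.log (f i)) / h

/-- The discrete flux `arctan (∂ₓ log f)`. -/
def gridFlux (h : ℝ) (f : ZMod N → ℝ) (i : ZMod N) : ℝ := Real.arctan (gridSlope h f i)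

/-- The difference quotient of the discrete flux: the velocity of the semi-discrete flow. -/
def gridVel (h : ℝ) (f : ZMod N → ℝ) (i : ZMod N) : ℝ :=
  (gridFlux h f i - gridFlux h f (i - 1)) / h

/-- The discrete counterpart of `weightedEnergy`. -/
def gridEnergy (h : ℝ) (f : ZMod N → ℝ) : ℝ :=
  h * ∑ i, gridVel h f i ^ 2 * (f i * (1 + gridSlope h f i ^ 2))

lemma hasDerivAt_posPart_sq (x : ℝ) :
    HasDerivAt (fun x : ℝ => max x 0 ^ 2) (2 * max x 0) x := by
  rcases lt_trichotomy x 0 with hx | rfl | hx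
  · have h1 : (fun x : ℝ => max x 0 ^ 2) =ᶠ[nhds x] fun _ => 0 := by
      filter_upwards [Iio_mem_nhds hx] with y hy
      rw [max_eq_right (le_of_lt hy)]; ring
    rw [max_eq_right hx.le, mul_zero]
    exact (hasDerivAt_const x (0 : ℝ)).congr_of_eventuallyEq h1
  · rw [hasDerivAt_iff_isLittleO]
    have h2 : (fun x : ℝ => x ^ 2) =o[nhds 0] fun x : ℝ => x := by
      simpa using Asymptotics.isLittleO_pow_pow (𝕜 := ℝ) (m := 1) (n := 2) (by norm_num)
    have h3 : (fun y : ℝ => max y 0 ^ 2) =O[nhds 0] fun x : ℝ => x ^ 2 := by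
      refine Asymptotics.IsBigO.of_bound 1 (Filter.Eventually.of_forall fun y => ?_)
      rw [one_mul, Real.norm_of_nonneg (sq_nonneg _), Real.norm_of_nonneg (sq_nonneg _)]
      rcases le_total y 0 with h | h
      · rw [max_eq_right h]; nlinarith [sq_nonneg y]
      · rw [max_eq_left h]
    simpa using h3.trans_isLittleO h2
  · have h1 : (fun x : ℝ => max x 0 ^ 2) =ᶠ[nhds x] fun x => x ^ 2 := by
      filter_upwards [Ioi_mem_nhds hx] with y hy
      rw [max_eq_left (le_of_lt hy)]
    rw [max_eq_left hx.le]
    simpa using (hasDerivAt_pow 2 x).congr_of_eventuallyEq h1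

lemma antitoneOn_of_hasDerivAt {T : ℝ} {f f' : ℝ → ℝ}
    (hf : ∀ t ∈ Icc 0 T, HasDerivAt f (f' t) t) (hf' : ∀ t ∈ Icc 0 T, f' t ≤ 0) :
    AntitoneOn f (Icc 0 T) := by
  refine antitoneOn_of_deriv_nonpos (convex_Icc 0 T)
    (fun t ht => (hf t ht).continuousAt.continuousWithinAt)
    (fun t ht => (hf t (interior_subset ht)).differentiableAt.differentiableWithinAt)
    fun t ht => ?_
  rw [(hf t (interior_subset ht)).deriv]
  exact hf' t (interior_subset ht)

/-- Maximum principle: if the positive parts of `p - M` decrease on average, then the bound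
`p ≤ M` is preserved. -/
lemma le_of_sum_posPart_mul_deriv_nonpos {T M : ℝ} {p p' : ℝ → ZMod N → ℝ}
    (hp : ∀ t ∈ Icc 0 T, ∀ i, HasDerivAt (fun t => p t i) (p' t i) t)
    (hs : ∀ t ∈ Icc 0 T, ∑ i, max (p t i - M) 0 * p' t i ≤ 0) (h0 : ∀ i, p 0 i ≤ M) :
    ∀ t ∈ Icc 0 T, ∀ i, p t i ≤ M := by
  intro t ht i
  have hd : ∀ t ∈ Icc 0 T, HasDerivAt (fun t => ∑ i, max (p t i - M) 0 ^ 2)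
      (∑ i, 2 * max (p t i - M) 0 * p' t i) t := fun t ht =>
    HasDerivAt.fun_sum fun i _ =>
      HasDerivAt.comp t (h₂ := fun x : ℝ => max x 0 ^ 2) (hasDerivAt_posPart_sq (p t i - M))
        ((hp t ht i).sub_const M)
  have ha := antitoneOn_of_hasDerivAt hd fun t ht => by
    simp only [mul_assoc, ← Finset.mul_sum]
    linarith [hs t ht]
  have h1 := ha ⟨le_rfl, ht.1.trans ht.2⟩ ht ht.1
  have h2 : ∑ i, max (p 0 i - M) 0 ^ 2 = 0 :=
    Finset.sum_eq_zero fun i _ => by rw [max_eq_right (by linarith [h0 i])]; ring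
  simp only [h2] at h1
  have h3 := Finset.single_le_sum (f := fun i => max (p t i - M) 0 ^ 2)
    (fun i _ => sq_nonneg _) (Finset.mem_univ i)
  have h4 : max (p t i - M) 0 = 0 := by
    have := h3.trans h1
    exact pow_eq_zero_iff (two_ne_zero) |>.mp (le_antisymm this (sq_nonneg _))
  have := le_max_left (p t i - M) 0
  linarith

lemma mul_sub_nonneg_of_monotone {φ g : ℝ → ℝ} (hφ : Monotone φ) (hg : Monotone g) {h : ℝ}
    (hh : 0 < h) (x y : ℝ) : 0 ≤ Real.arctan ((g x - g y) / h) * (φ x - φ y) := by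
  rcases le_total x y with hxy | hxy
  · refine mul_nonneg_of_nonpos_of_nonpos ?_ (sub_nonpos.mpr (hφ hxy))
    rw [← Real.arctan_zero]
    exact Real.arctan_strictMono.monotone
      (div_nonpos_of_nonpos_of_nonneg (sub_nonpos.mpr (hg hxy)) hh.le)
  · exact mul_nonneg (Real.arctan_nonneg.mpr (div_nonneg (sub_nonneg.mpr (hg hxy)) hh.le))
      (sub_nonneg.mpr (hφ hxy))

/-- The velocity field of the semi-discrete flow with the logarithm truncated below `μ`. It agrees
with `gridVel h f` where `μ ≤ f`. -/
def truncField (h μ : ℝ) (f : ZMod N → ℝ) (i : ZMod N) : ℝ :=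
  (Real.arctan ((Real.log (max (f (i + 1)) μ) - Real.log (max (f i) μ)) / h) -
    Real.arctan ((Real.log (max (f i) μ) - Real.log (max (f (i - 1)) μ)) / h)) / h

lemma monotone_log_max {μ : ℝ} (hμ : 0 < μ) : Monotone fun x : ℝ => Real.log (max x μ) :=
  fun _ _ hxy => Real.log_le_log (lt_max_of_lt_right hμ) (max_le_max_right _ hxy)

lemma abs_log_max_sub_le {μ : ℝ} (hμ : 0 < μ) (x y : ℝ) :
    |Real.log (max x μ) - Real.log (max y μ)| ≤ |x - y| / μ := by
  wlog hxy : y ≤ x generalizing x y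
  · rw [abs_sub_comm, abs_sub_comm x]; exact this y x (not_le.mp hxy).le
  rw [abs_of_nonneg (sub_nonneg.mpr (monotone_log_max hμ hxy)), abs_of_nonneg (by linarith)]
  have hy : 0 < max y μ := lt_max_of_lt_right hμ
  have hx : 0 < max x μ := lt_max_of_lt_right hμ
  rw [← Real.log_div hx.ne' hy.ne']
  refine (Real.log_le_sub_one_of_pos (div_pos hx hy)).trans ?_
  rw [div_sub_one hy.ne']
  have h1 : max x μ - max y μ ≤ x - y := by
    have := max_sub_max_le_max x μ y μ
    rwa [sub_self, max_eq_left (show (0 : ℝ) ≤ x - y by linarith)] at this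
  have h2 : 0 ≤ max x μ - max y μ := sub_nonneg.mpr (max_le_max_right _ hxy)
  exact div_le_div₀ (by linarith) h1 hμ (le_max_right _ _)

/-- Global existence for the truncated semi-discrete flow, whose velocity field is bounded and
globally Lipschitz. The derivatives at `0` and `T` are two-sided. -/
lemma exists_truncField_flow {h μ T : ℝ} (hh : 0 < h) (hμ : 0 < μ) (hT : 0 < T)
    (f₀ : ZMod N → ℝ) : ∃ u : ℝ → ZMod N → ℝ, u 0 = f₀ ∧
      ∀ t ∈ Icc 0 T, HasDerivAt u (truncField h μ (u t)) t := by
  have hlip : LipschitzWith (Real.toNNReal (4 / (h ^ 2 * μ))) (truncField (N := N) h μ) := by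
    refine LipschitzWith.of_dist_le_mul fun f g => ?_
    rw [Real.coe_toNNReal _ (by positivity), dist_pi_le_iff (by positivity)]
    intro i
    have hc : ∀ j, |f j - g j| ≤ dist f g := fun j => dist_le_pi_dist f g j
    have hl : ∀ j, |Real.log (max (f j) μ) - Real.log (max (g j) μ)| ≤ dist f g / μ := fun j =>
      (abs_log_max_sub_le hμ _ _).trans (by gcongr; exact hc j)
    have ha : ∀ j k, |Real.arctan ((Real.log (max (f j) μ) - Real.log (max (f k) μ)) / h) -
        Real.arctan ((Real.log (max (g j) μ) - Real.log (max (g k) μ)) / h)| ≤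
        2 * (dist f g / μ) / h := by
      intro j k
      refine (abs_arctan_sub_le _ _).trans ?_
      rw [← sub_div, abs_div, abs_of_pos hh]
      gcongr
      have := abs_sub (Real.log (max (f j) μ) - Real.log (max (g j) μ))
        (Real.log (max (f k) μ) - Real.log (max (g k) μ))
      rw [sub_sub_sub_comm]
      linarith [hl j, hl k]
    rw [Real.dist_eq, truncField, truncField, ← sub_div, abs_div, abs_of_pos hh, sub_sub_sub_comm,
      div_le_iff₀ hh]
    refine (abs_sub _ _).trans ((add_le_add (ha _ _) (ha _ _)).trans (le_of_eq ?_))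
    field_simp
    ring
  have hbd : ∀ f : ZMod N → ℝ, ‖truncField h μ f‖ ≤ Real.pi / h := by
    intro f
    rw [pi_norm_le_iff_of_nonneg (by positivity)]
    intro i
    rw [Real.norm_eq_abs, truncField, abs_div, abs_of_pos hh]
    gcongr
    rw [abs_le]
    constructor <;>
    linarith [Real.arctan_lt_pi_div_two
        ((Real.log (max (f (i + 1)) μ) - Real.log (max (f i) μ)) / h),
      Real.neg_pi_div_two_lt_arctan
        ((Real.log (max (f (i + 1)) μ) - Real.log (max (f i) μ)) / h),
      Real.arctan_lt_pi_div_two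
        ((Real.log (max (f i) μ) - Real.log (max (f (i - 1)) μ)) / h),
      Real.neg_pi_div_two_lt_arctan
        ((Real.log (max (f i) μ) - Real.log (max (f (i - 1)) μ)) / h)]
  have hpi := Real.pi_pos
  have hpl : IsPicardLindelof (fun _ => truncField (N := N) h μ) (tmin := -1) (tmax := T + 1)
      ⟨0, by constructor <;> linarith⟩ f₀ (Real.toNNReal (Real.pi / h * (T + 1))) 0
      (Real.toNNReal (Real.pi / h)) (Real.toNNReal (4 / (h ^ 2 * μ))) :=
    { lipschitzOnWith := fun t _ => hlip.lipschitzOnWith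
      continuousOn := fun _ _ => continuousOn_const
      norm_le := fun t _ x _ => by rw [Real.coe_toNNReal _ (by positivity)]; exact hbd x
      mul_max_le := by
        rw [Real.coe_toNNReal _ (by positivity), Real.coe_toNNReal _ (by positivity)]
        simp only [sub_zero, zero_sub, neg_neg, NNReal.coe_zero]
        rw [max_eq_left (by linarith)] }
  obtain ⟨u, hu0, hu⟩ := hpl.exists_eq_forall_mem_Icc_hasDerivWithinAt₀
  exact ⟨u, hu0, fun t ht => (hu t ⟨by linarith [ht.1], by linarith [ht.2]⟩).hasDerivAt
    (Icc_mem_nhds (by linarith [ht.1]) (by linarith [ht.2]))⟩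

/-- A solution of the semi-discrete flow on `[0, T]` which lies between `μ` and `2 * μ` and has
small slopes. The bound `63 / 10` is a rational number above `2π`. -/
structure GridFlow (h μ T : ℝ) (u : ℝ → ZMod N → ℝ) : Prop where
  h_pos : 0 < h
  Nh_le : (N : ℝ) * h ≤ 63 / 10
  μ_pos : 0 < μ
  T_pos : 0 < T
  lower : ∀ t ∈ Icc 0 T, ∀ i, μ ≤ u t i
  upper : ∀ t ∈ Icc 0 T, ∀ i, u t i ≤ 2 * μ
  slope_le : ∀ t ∈ Icc 0 T, ∀ i, |gridSlope h (u t) i| ≤ 1 / 10000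
  hasDerivAt : ∀ t ∈ Icc 0 T, ∀ i, HasDerivAt (fun t => u t i) (gridVel h (u t) i) t

namespace GridFlow

variable {h μ T : ℝ} {u : ℝ → ZMod N → ℝ}

omit [NeZero N] in
lemma hasDerivAt_slope' {t : ℝ} (hpos : ∀ i, 0 < u t i)
    (hu : ∀ i, HasDerivAt (fun t => u t i) (gridVel h (u t) i) t) (i : ZMod N) :
    HasDerivAt (fun t => gridSlope h (u t) i)
      ((gridVel h (u t) (i + 1) / u t (i + 1) - gridVel h (u t) i / u t i) / h) t :=
  (((hu (i + 1)).log (hpos _).ne').sub ((hu i).log (hpos _).ne')).div_const h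

/-- Existence of the semi-discrete flow. The bounds for the values and for the slopes of the initial
datum are preserved by the maximum principle; in particular the truncation is never active. -/
lemma exists_of_initial (hh : 0 < h) (hN : (N : ℝ) * h ≤ 63 / 10) (hμ : 0 < μ) (hT : 0 < T)
    (f₀ : ZMod N → ℝ) (h1 : ∀ i, μ ≤ f₀ i) (h2 : ∀ i, f₀ i ≤ 2 * μ)
    (h3 : ∀ i, |gridSlope h f₀ i| ≤ 1 / 10000) :
    ∃ u : ℝ → ZMod N → ℝ, u 0 = f₀ ∧ GridFlow h μ T u := by
  obtain ⟨u, hu0, hu⟩ := exists_truncField_flow hh hμ hT f₀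
  have hu' : ∀ t ∈ Icc 0 T, ∀ i, HasDerivAt (fun t => u t i) (truncField h μ (u t) i) t :=
    fun t ht i => hasDerivAt_pi.mp (hu t ht) i
  have hsum : ∀ φ : ℝ → ℝ, Monotone φ → ∀ f : ZMod N → ℝ,
      ∑ i, φ (f i) * truncField h μ f i ≤ 0 := by
    intro φ hφ f
    have h4 := sum_by_parts (fun i => φ (f i)) (fun i =>
      Real.arctan ((Real.log (max (f (i + 1)) μ) - Real.log (max (f i) μ)) / h))
    have h5 : ∑ i, φ (f i) * truncField h μ f i = (∑ i, φ (f i) *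
        (Real.arctan ((Real.log (max (f (i + 1)) μ) - Real.log (max (f i) μ)) / h) -
        Real.arctan ((Real.log (max (f (i - 1 + 1)) μ) - Real.log (max (f (i - 1)) μ)) / h))) /
        h := by
      rw [Finset.sum_div]
      refine Finset.sum_congr rfl fun i _ => ?_
      rw [sub_add_cancel, truncField]; ring
    rw [h5, h4]
    refine div_nonpos_of_nonpos_of_nonneg (neg_nonpos.mpr (Finset.sum_nonneg fun i _ => ?_)) hh.le
    exact mul_sub_nonneg_of_monotone hφ (monotone_log_max hμ) hh _ _
  have hup : ∀ t ∈ Icc 0 T, ∀ i, u t i ≤ 2 * μ :=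
    le_of_sum_posPart_mul_deriv_nonpos hu' (fun t ht => hsum (fun x => max (x - 2 * μ) 0)
      (fun x y hxy => max_le_max_right _ (by linarith)) (u t)) (by rw [hu0]; exact h2)
  have hlo : ∀ t ∈ Icc 0 T, ∀ i, μ ≤ u t i := by
    have := le_of_sum_posPart_mul_deriv_nonpos (T := T) (M := -μ) (p := fun t i => -u t i)
      (p' := fun t i => -truncField h μ (u t) i) (fun t ht i => (hu' t ht i).fun_neg)
      (fun t ht => by
        have := hsum (fun x => -max (-x - -μ) 0)
          (fun x y hxy => neg_le_neg (max_le_max_right _ (by linarith))) (u t)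
        simpa using this) (fun i => by rw [hu0]; linarith [h1 i])
    exact fun t ht i => by linarith [this t ht i]
  have hpos : ∀ t ∈ Icc 0 T, ∀ i, 0 < u t i := fun t ht i => hμ.trans_le (hlo t ht i)
  have hder : ∀ t ∈ Icc 0 T, ∀ i, HasDerivAt (fun t => u t i) (gridVel h (u t) i) t := by
    intro t ht i
    have := hu' t ht i
    simp only [truncField, max_eq_left (hlo t ht _)] at this
    simpa only [gridVel, gridFlux, gridSlope, sub_add_cancel] using this
  -- the slopes satisfy a diffusion equation in divergence form as well
  have hsum2 : ∀ φ : ℝ → ℝ, Monotone φ → ∀ t ∈ Icc 0 T,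
      ∑ i, φ (gridSlope h (u t) i) *
        ((gridVel h (u t) (i + 1) / u t (i + 1) - gridVel h (u t) i / u t i) / h) ≤ 0 := by
    intro φ hφ t ht
    have h4 := sum_by_parts (fun i => gridVel h (u t) i / u t i)
      (fun i => φ (gridSlope h (u t) i))
    simp only [← mul_div_assoc, ← Finset.sum_div]
    refine div_nonpos_of_nonpos_of_nonneg ?_ hh.le
    rw [← neg_nonneg, ← h4]
    refine Finset.sum_nonneg fun i _ => ?_
    have h5 := mul_sub_nonneg_of_monotone hφ monotone_id one_pos
      (gridSlope h (u t) i) (gridSlope h (u t) (i - 1))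
    have h6 : 0 ≤ (Real.arctan (gridSlope h (u t) i) - Real.arctan (gridSlope h (u t) (i - 1))) *
        (φ (gridSlope h (u t) i) - φ (gridSlope h (u t) (i - 1))) := by
      rcases le_total (gridSlope h (u t) i) (gridSlope h (u t) (i - 1)) with h7 | h7
      · exact mul_nonneg_of_nonpos_of_nonpos
          (sub_nonpos.mpr (Real.arctan_strictMono.monotone h7)) (sub_nonpos.mpr (hφ h7))
      · exact mul_nonneg (sub_nonneg.mpr (Real.arctan_strictMono.monotone h7))
          (sub_nonneg.mpr (hφ h7))
    rw [gridVel, div_div, div_mul_eq_mul_div]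
    exact div_nonneg h6 (mul_pos hh (hpos t ht i)).le
  have hsl := fun t ht => hasDerivAt_slope' (u := u) (hpos t ht) (hder t ht)
  refine ⟨u, hu0, hh, hN, hμ, hT, hlo, hup, ?_, hder⟩
  have b1 := le_of_sum_posPart_mul_deriv_nonpos (M := 1 / 10000) hsl
    (fun t ht => hsum2 (fun x => max (x - 1 / 10000) 0)
      (fun x y hxy => max_le_max_right _ (by linarith)) t ht)
    (fun i => by rw [hu0]; exact (abs_le.mp (h3 i)).2)
  have b2 := le_of_sum_posPart_mul_deriv_nonpos (T := T) (M := 1 / 10000)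
      (p := fun t i => -gridSlope h (u t) i)
      (p' := fun t i => -((gridVel h (u t) (i + 1) / u t (i + 1) - gridVel h (u t) i / u t i) / h))
      (fun t ht i => (hsl t ht i).fun_neg)
      (fun t ht => by
        have := hsum2 (fun x => -max (-x - 1 / 10000) 0)
          (fun x y hxy => neg_le_neg (max_le_max_right _ (by linarith))) t ht
        simpa using this) (fun i => by rw [hu0]; linarith [(abs_le.mp (h3 i)).1])
  exact fun t ht i => abs_le.mpr ⟨by linarith [b2 t ht i], b1 t ht i⟩

variable (F : GridFlow h μ T u)
include F

omit [NeZero N] in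
lemma pos {t : ℝ} (ht : t ∈ Icc 0 T) (i : ZMod N) : 0 < u t i := F.μ_pos.trans_le (F.lower t ht i)

omit [NeZero N] in
lemma gridData {t : ℝ} (ht : t ∈ Icc 0 T) :
    GridData h μ (u t) (gridSlope h (u t)) (gridVel h (u t))
      (fun i => gridVel h (u t) i / u t i)
      (fun i => (gridVel h (u t) (i + 1) - gridVel h (u t) i) / h)
      (fun i => (gridVel h (u t) (i + 1) / u t (i + 1) - gridVel h (u t) i / u t i) / h) where
  h_pos := F.h_pos
  Nh_le := F.Nh_le
  μ_pos := F.μ_pos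
  lower := F.lower t ht
  upper := F.upper t ht
  y_le := F.slope_le t ht
  y_eq i := by have := F.h_pos; rw [gridSlope]; field_simp
  a_eq i := by have := F.h_pos; rw [gridVel]; field_simp; rfl
  z_eq i := by have := F.pos ht i; field_simp
  A_eq i := by have := F.h_pos; field_simp
  Z_eq i := by have := F.h_pos; field_simp

omit [NeZero N] in
lemma hasDerivAt_slope {t : ℝ} (ht : t ∈ Icc 0 T) (i : ZMod N) :
    HasDerivAt (fun t => gridSlope h (u t) i)
      ((gridVel h (u t) (i + 1) / u t (i + 1) - gridVel h (u t) i / u t i) / h) t :=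
  hasDerivAt_slope' (F.pos ht) (F.hasDerivAt t ht) i

omit [NeZero N] in
lemma hasDerivAt_flux {t : ℝ} (ht : t ∈ Icc 0 T) (i : ZMod N) :
    HasDerivAt (fun t => gridFlux h (u t) i)
      ((gridVel h (u t) (i + 1) / u t (i + 1) - gridVel h (u t) i / u t i) / h /
        (1 + gridSlope h (u t) i ^ 2)) t := by
  have := (F.hasDerivAt_slope ht i).arctan
  rwa [one_div_mul_eq_div] at this

/-- The energy decreases along the flow, with a quantitative dissipation. -/
lemma exists_hasDerivAt_energy {t : ℝ} (ht : t ∈ Icc 0 T) :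
    ∃ E', HasDerivAt (fun t => gridEnergy h (u t)) E' t ∧ E' ≤ -(μ ^ 2 * (h * ∑ i,
      ((gridVel h (u t) (i + 1) / u t (i + 1) - gridVel h (u t) i / u t i) / h) ^ 2)) := by
  have hh := F.h_pos
  set Z : ZMod N → ℝ :=
    fun i => (gridVel h (u t) (i + 1) / u t (i + 1) - gridVel h (u t) i / u t i) / h with hZ
  set a' : ZMod N → ℝ := fun i =>
    (Z i / (1 + gridSlope h (u t) i ^ 2) - Z (i - 1) / (1 + gridSlope h (u t) (i - 1) ^ 2)) / h
    with ha'
  have hv : ∀ i, HasDerivAt (fun t => gridVel h (u t) i) (a' i) t := fun i =>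
    ((F.hasDerivAt_flux ht i).sub (F.hasDerivAt_flux ht (i - 1))).div_const h
  have hE := (HasDerivAt.fun_sum (u := Finset.univ) fun i _ => ((hv i).fun_pow 2).fun_mul
    ((F.hasDerivAt t ht i).fun_mul (((F.hasDerivAt_slope ht i).fun_pow 2).const_add 1))).const_mul h
  refine ⟨_, hE, ?_⟩
  have key := (F.gridData ht).energy_le a' fun i => mul_div_cancel₀ _ hh.ne'
  have key2 := mul_le_mul_of_nonneg_left key hh.le
  refine le_trans (le_of_eq ?_) (key2.trans (le_of_eq ?_))
  · congr 1
    refine Finset.sum_congr rfl fun i _ => ?_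
    push_cast
    ring
  · ring

lemma energy_antitone : AntitoneOn (fun t => gridEnergy h (u t)) (Icc 0 T) := by
  choose! E' hE using fun t (ht : t ∈ Icc 0 T) => F.exists_hasDerivAt_energy ht
  refine antitoneOn_of_hasDerivAt (fun t ht => (hE t ht).1) fun t ht => (hE t ht).2.trans ?_
  have := F.h_pos
  exact neg_nonpos.mpr (by positivity)

lemma energy_le {t : ℝ} (ht : t ∈ Icc 0 T) : gridEnergy h (u t) ≤ gridEnergy h (u 0) :=
  F.energy_antitone ⟨le_rfl, F.T_pos.le⟩ ht ht.1

lemma energy_nonneg {t : ℝ} (ht : t ∈ Icc 0 T) : 0 ≤ gridEnergy h (u t) := by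
  have hh := F.h_pos
  have hp := fun i => F.pos ht i
  rw [gridEnergy]
  have : 0 ≤ ∑ i, gridVel h (u t) i ^ 2 * (u t i * (1 + gridSlope h (u t) i ^ 2)) :=
    Finset.sum_nonneg fun i _ => by have := hp i; positivity
  positivity

lemma sum_sq_vel_le {t : ℝ} (ht : t ∈ Icc 0 T) :
    h * ∑ i, gridVel h (u t) i ^ 2 ≤ gridEnergy h (u 0) / μ := by
  have hh := F.h_pos
  have hμ := F.μ_pos
  rw [le_div_iff₀ hμ]
  refine le_trans ?_ (F.energy_le ht)
  rw [gridEnergy, mul_assoc, Finset.sum_mul]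
  gcongr with i
  nlinarith [F.lower t ht i, mul_nonneg (F.pos ht i).le (sq_nonneg (gridSlope h (u t) i))]

/-- Cauchy-Schwarz in time: if the squared speed of `p` is controlled by the decrease of `e`, then
so are its squared increments. The proof follows the linear functional `∑ c p` with the increment
`c = p t - p s` as weight, which avoids integrals in time. -/
lemma sum_sq_sub_le {p p' : ℝ → ZMod N → ℝ} {e e' : ℝ → ℝ}
    (hp : ∀ t ∈ Icc 0 T, ∀ i, HasDerivAt (fun t => p t i) (p' t i) t)
    (he : ∀ t ∈ Icc 0 T, HasDerivAt e (e' t) t)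
    (hb : ∀ t ∈ Icc 0 T, h * ∑ i, p' t i ^ 2 ≤ -e' t) {s t : ℝ}
    (hs : s ∈ Icc 0 T) (ht : t ∈ Icc 0 T) (hst : s < t) :
    h * ∑ i, (p t i - p s i) ^ 2 ≤ (t - s) * (e s - e t) := by
  have hh := F.h_pos
  set c : ZMod N → ℝ := fun i => p t i - p s i with hc
  set θ := (t - s)⁻¹ with hθ
  have hθp : 0 < θ := inv_pos.mpr (by linarith)
  set C := h * ∑ i, c i ^ 2 with hC
  have hd : ∀ τ ∈ Icc 0 T, HasDerivAt
      (fun τ => h * ∑ i, c i * p τ i - θ / 2 * C * τ + (2 * θ)⁻¹ * e τ)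
      (h * ∑ i, c i * p' τ i - θ / 2 * C * 1 + (2 * θ)⁻¹ * e' τ) τ := fun τ hτ =>
    (((HasDerivAt.fun_sum fun i _ => (hp τ hτ i).const_mul (c i)).const_mul h).sub
      ((hasDerivAt_id τ).const_mul _)).add ((he τ hτ).const_mul _)
  have ha := antitoneOn_of_hasDerivAt hd fun τ hτ => by
    have h1 := Finset.sum_le_sum (s := Finset.univ) fun i (_ : i ∈ Finset.univ) =>
      show c i * p' τ i ≤ θ / 2 * c i ^ 2 + (2 * θ)⁻¹ * p' τ i ^ 2 by
        have : θ / 2 * c i ^ 2 + (2 * θ)⁻¹ * p' τ i ^ 2 - c i * p' τ i =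
          (2 * θ)⁻¹ * (θ * c i - p' τ i) ^ 2 := by field_simp; ring
        have h2 : 0 ≤ (2 * θ)⁻¹ * (θ * c i - p' τ i) ^ 2 := by positivity
        linarith
    rw [Finset.sum_add_distrib, ← Finset.mul_sum, ← Finset.mul_sum] at h1
    have h2 := mul_le_mul_of_nonneg_left h1 hh.le
    have h3 := mul_le_mul_of_nonneg_left (hb τ hτ) (inv_pos.mpr (mul_pos two_pos hθp)).le
    rw [hC]
    linarith
  have h1 := ha hs ht hst.le
  have h2 : h * ∑ i, c i * p t i - h * ∑ i, c i * p s i = C := by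
    rw [hC, ← mul_sub, ← Finset.sum_sub_distrib]
    congr 1
    exact Finset.sum_congr rfl fun i _ => by simp only [hc]; ring
  have h3 : C ≤ θ / 2 * C * (t - s) + (2 * θ)⁻¹ * (e s - e t) := by
    simp only at h1; linarith
  have hts : 0 < t - s := by linarith
  have h4 : θ / 2 * C * (t - s) = C / 2 := by rw [hθ]; field_simp
  have h5 : (2 * θ)⁻¹ * (e s - e t) = (t - s) * (e s - e t) / 2 := by rw [hθ]; field_simp
  linarith

lemma sum_sq_flux_sub_le {s t : ℝ} (hs : s ∈ Icc 0 T) (ht : t ∈ Icc 0 T) (hst : s < t) :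
    h * ∑ i, (gridFlux h (u t) i - gridFlux h (u s) i) ^ 2 ≤
      (t - s) * (gridEnergy h (u 0) / μ ^ 2) := by
  have hμ := F.μ_pos
  have hh := F.h_pos
  choose! E' hE using fun t (ht : t ∈ Icc 0 T) => F.exists_hasDerivAt_energy ht
  refine (F.sum_sq_sub_le (fun t ht i => F.hasDerivAt_flux ht i)
    (fun t ht => (hE t ht).1.div_const (μ ^ 2)) (fun t ht => ?_) hs ht hst).trans ?_
  · rw [← neg_div, le_div_iff₀ (by positivity)]
    refine le_trans ?_ (le_neg_of_le_neg (hE t ht).2)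
    rw [mul_comm (μ ^ 2)]
    refine mul_le_mul_of_nonneg_right (mul_le_mul_of_nonneg_left
      (Finset.sum_le_sum fun i _ => ?_) hh.le) (sq_nonneg μ)
    rw [div_pow _ (1 + _)]
    exact div_le_self (sq_nonneg _) (one_le_pow₀ (by nlinarith [sq_nonneg (gridSlope h (u t) i)]))
  · have : 0 < t - s := by linarith
    rw [← sub_div]
    gcongr
    linarith [F.energy_le hs, F.energy_nonneg ht]

lemma sum_sq_increment_le {s t : ℝ} (hs : s ∈ Icc 0 T) (ht : t ∈ Icc 0 T) (hst : s < t) :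
    h * ∑ i, (u t i - u s i) ^ 2 ≤ (t - s) * (gridEnergy h (u 0) / μ * (t - s)) := by
  refine (F.sum_sq_sub_le (e := fun t => -(gridEnergy h (u 0) / μ) * t)
    (e' := fun _ => -(gridEnergy h (u 0) / μ)) F.hasDerivAt
    (fun t _ => by simpa using (hasDerivAt_id t).const_mul (-(gridEnergy h (u 0) / μ)))
    (fun t ht => by rw [neg_neg]; exact F.sum_sq_vel_le ht) hs ht hst).trans (le_of_eq ?_)
  ring

/-- Hölder continuity in time of the flux, uniformly in the mesh. -/
lemma sq_flux_sub_le {s t K : ℝ} (hN : 1 ≤ (N : ℝ) * h) (hK : gridEnergy h (u 0) ≤ K)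
    (hs : s ∈ Icc 0 T) (ht : t ∈ Icc 0 T) (i : ZMod N) :
    (gridFlux h (u t) i - gridFlux h (u s) i) ^ 2 ≤
      K / μ ^ 2 * |t - s| + 2 * √(K / μ ^ 2 * |t - s|) * √(4 * (K / μ)) := by
  wlog hst : s < t generalizing s t
  · rcases eq_or_lt_of_le (not_lt.mp hst) with h1 | h1
    · subst h1; simp
    · have := this ht hs h1
      rwa [← neg_sub, neg_sq, abs_sub_comm]
  have hμ := F.μ_pos
  have hh := F.h_pos
  have hK0 : 0 ≤ K := (F.energy_nonneg ⟨le_rfl, F.T_pos.le⟩).trans hK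
  have hts : |t - s| = t - s := abs_of_pos (by linarith)
  have hA0 : 0 ≤ K / μ ^ 2 * |t - s| := by positivity
  have hv : ∀ t ∈ Icc 0 T, h * ∑ i, gridVel h (u t) (i + 1) ^ 2 ≤ K / μ := fun t ht => by
    rw [sum_shift (fun i => gridVel h (u t) i ^ 2)]
    exact (F.sum_sq_vel_le ht).trans (by gcongr)
  have key := sq_le_agmon (fun i => gridFlux h (u t) i - gridFlux h (u s) i)
    (A := √(K / μ ^ 2 * |t - s|)) (B := √(4 * (K / μ))) hh (by
      rw [Real.sq_sqrt hA0, hts]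
      refine (F.sum_sq_flux_sub_le hs ht hst).trans ?_
      rw [mul_comm]
      have : 0 < t - s := by linarith
      gcongr) (by
      rw [Real.sq_sqrt (by positivity)]
      have h1 : ∀ i, ((gridFlux h (u t) (i + 1) - gridFlux h (u s) (i + 1) -
          (gridFlux h (u t) i - gridFlux h (u s) i)) / h) ^ 2 ≤
          2 * gridVel h (u t) (i + 1) ^ 2 + 2 * gridVel h (u s) (i + 1) ^ 2 := fun i => by
        have : (gridFlux h (u t) (i + 1) - gridFlux h (u s) (i + 1) -
          (gridFlux h (u t) i - gridFlux h (u s) i)) / h =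
            gridVel h (u t) (i + 1) - gridVel h (u s) (i + 1) := by
          simp only [gridVel, add_sub_cancel_right]; ring
        rw [this]
        nlinarith [sq_nonneg (gridVel h (u t) (i + 1) + gridVel h (u s) (i + 1))]
      have h2 := mul_le_mul_of_nonneg_left (Finset.sum_le_sum (s := Finset.univ)
        fun i _ => h1 i) hh.le
      rw [Finset.sum_add_distrib, ← Finset.mul_sum, ← Finset.mul_sum] at h2
      linarith [hv t ht, hv s hs]) (Real.sqrt_nonneg _) (Real.sqrt_nonneg _) i
  refine key.trans ?_
  rw [Real.sq_sqrt hA0]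
  gcongr
  exact div_le_self hA0 hN

/-- Hölder continuity in time of the solution, uniformly in the mesh. -/
lemma sq_sub_le {s t K : ℝ} (hN : 1 ≤ (N : ℝ) * h) (hK : gridEnergy h (u 0) ≤ K)
    (hs : s ∈ Icc 0 T) (ht : t ∈ Icc 0 T) (i : ZMod N) :
    (u t i - u s i) ^ 2 ≤
      K / μ * |t - s| ^ 2 + 2 * √(K / μ * |t - s| ^ 2) * μ := by
  wlog hst : s < t generalizing s t
  · rcases eq_or_lt_of_le (not_lt.mp hst) with h1 | h1
    · subst h1; simp
    · have := this ht hs h1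
      rwa [← neg_sub, neg_sq, abs_sub_comm]
  have hμ := F.μ_pos
  have hh := F.h_pos
  have hK0 : 0 ≤ K := (F.energy_nonneg ⟨le_rfl, F.T_pos.le⟩).trans hK
  have hts : |t - s| = t - s := abs_of_pos (by linarith)
  have hA0 : 0 ≤ K / μ * |t - s| ^ 2 := by positivity
  have key := sq_le_agmon (fun i => u t i - u s i)
    (A := √(K / μ * |t - s| ^ 2)) (B := μ) hh (by
      rw [Real.sq_sqrt hA0, hts]
      refine (F.sum_sq_increment_le hs ht hst).trans ?_
      rw [mul_comm, sq, mul_assoc]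
      have : 0 < t - s := by linarith
      gcongr) (by
      have h1 : ∀ i, ((u t (i + 1) - u s (i + 1) - (u t i - u s i)) / h) ^ 2 ≤
          (μ / 10) ^ 2 := fun i => by
        have b1 := (F.gridData ht).abs_u_sub_le i
        have b2 := (F.gridData hs).abs_u_sub_le i
        rw [← sq_abs]
        gcongr
        rw [abs_div, abs_of_pos hh, div_le_iff₀ hh]
        have e : u t (i + 1) - u s (i + 1) - (u t i - u s i) =
          (u t (i + 1) - u t i) - (u s (i + 1) - u s i) := by ring
        rw [e]
        refine (abs_sub _ _).trans ?_
        have : 0 < μ * h := by positivity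
        linarith
      have h2 := mul_le_mul_of_nonneg_left (Finset.sum_le_sum (s := Finset.univ)
        fun i _ => h1 i) hh.le
      simp only [Finset.sum_const, Finset.card_univ, ZMod.card, nsmul_eq_mul] at h2
      refine h2.trans ?_
      nlinarith [F.Nh_le, sq_nonneg μ]) (Real.sqrt_nonneg _) hμ.le i
  refine key.trans ?_
  rw [Real.sq_sqrt hA0]
  gcongr
  exact div_le_self hA0 hN

/-- Hölder continuity in space of the flux. -/
lemma sq_flux_shift_sub_le {t K : ℝ} (hK : gridEnergy h (u 0) ≤ K) (ht : t ∈ Icc 0 T)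
    (i : ZMod N) {k : ℕ} (hk : k ≤ N) :
    (gridFlux h (u t) (i + k) - gridFlux h (u t) i) ^ 2 ≤ k * h * (K / μ) := by
  have hμ := F.μ_pos
  have hh := F.h_pos
  have h1 : gridFlux h (u t) (i + k) - gridFlux h (u t) i =
      h * ∑ j ∈ Finset.range k, gridVel h (u t) (i + j + 1) := by
    have := Finset.sum_range_sub (fun j : ℕ => gridFlux h (u t) (i + j)) k
    simp only [Nat.cast_zero, add_zero] at this
    rw [← this, Finset.mul_sum]
    refine Finset.sum_congr rfl fun j _ => ?_
    rw [gridVel, add_sub_cancel_right, mul_div_cancel₀ _ hh.ne']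
    push_cast
    rw [add_assoc]
  have h2 : ∑ j ∈ Finset.range k, gridVel h (u t) (i + j + 1) ^ 2 ≤
      ∑ j, gridVel h (u t) j ^ 2 := by
    have hinj : Set.InjOn (fun j : ℕ => i + (j : ZMod N) + 1) (Finset.range k : Set ℕ) := by
      intro a ha b hb hab
      simp only [Finset.coe_range, Set.mem_Iio] at ha hb
      have h3 : (a : ZMod N) = b := by simpa using hab
      have h4 := congrArg ZMod.val h3
      rwa [ZMod.val_natCast_of_lt (by omega), ZMod.val_natCast_of_lt (by omega)] at h4
    rw [← Finset.sum_image (f := fun j => gridVel h (u t) j ^ 2) hinj]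
    exact Finset.sum_le_sum_of_subset_of_nonneg (Finset.subset_univ _) fun _ _ _ => sq_nonneg _
  have h3 := sq_sum_le_card_mul_sum_sq (s := Finset.range k)
    (f := fun j : ℕ => gridVel h (u t) (i + j + 1))
  rw [Finset.card_range] at h3
  have h4 := F.sum_sq_vel_le ht
  have h5 : gridEnergy h (u 0) / μ ≤ K / μ := by gcongr
  rw [h1, mul_pow]
  calc _ ≤ h ^ 2 * (k * ∑ j, gridVel h (u t) j ^ 2) := by
        gcongr
        exact h3.trans (by gcongr)
    _ = k * h * (h * ∑ j, gridVel h (u t) j ^ 2) := by ring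
    _ ≤ _ := by gcongr; exact h4.trans h5

omit [NeZero N] in
/-- Lipschitz continuity in space of the solution. -/
lemma abs_shift_sub_le {t : ℝ} (ht : t ∈ Icc 0 T) (i : ZMod N) (k : ℕ) :
    |u t (i + k) - u t i| ≤ k * h * μ := by
  have hμ := F.μ_pos
  have hh := F.h_pos
  induction k with
  | zero => simp
  | succ k ih =>
    have h1 := (F.gridData ht).abs_u_sub_le (i + k)
    have h2 := abs_sub_le (u t (i + (k + 1 : ℕ))) (u t (i + k)) (u t i)
    push_cast at h2 ⊢
    rw [← add_assoc] at h2 ⊢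
    have : 0 < μ * h := by positivity
    linarith

end GridFlow

end Flow

/-! ### Primitives of locally integrable functions on the line -/

/-- `f` is locally absolutely continuous on the line with derivative `g` almost everywhere:
`f` is an antiderivative of the locally integrable function `g`. -/
structure HasPrim (f g : ℝ → ℝ) : Prop where
  integrable : ∀ a b, IntervalIntegrable g volume a b
  sub_eq : ∀ a b, f b - f a = ∫ x in a..b, g x

namespace HasPrim

variable {f g f₁ g₁ f₂ g₂ : ℝ → ℝ}

lemma eq_add (H : HasPrim f g) (a x : ℝ) : f x = f a + ∫ t in a..x, g t := by
  rw [← H.sub_eq a x]; ring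

lemma of_eq_add (hg : ∀ a b, IntervalIntegrable g volume a b) (c : ℝ)
    (h : ∀ x, f x = c + ∫ t in (0 : ℝ)..x, g t) : HasPrim f g :=
  ⟨hg, fun a b => by
    rw [h, h, add_sub_add_left_eq_sub,
      intervalIntegral.integral_interval_sub_left (hg 0 b) (hg 0 a)]⟩

lemma locallyIntegrable (H : HasPrim f g) : LocallyIntegrable g := by
  rw [locallyIntegrable_iff]
  intro k hk
  obtain ⟨a, b, hab⟩ : ∃ a b, k ⊆ Ioc a b := by
    obtain ⟨r, hr⟩ := hk.isBounded.subset_closedBall 0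
    refine ⟨-r - 1, r, hr.trans ?_⟩
    rw [Real.closedBall_eq_Icc]
    intro x hx
    constructor <;> linarith [hx.1, hx.2]
  exact (H.integrable a b).1.mono_set hab

lemma ae_hasDerivAt (H : HasPrim f g) : ∀ᵐ x, HasDerivAt f (g x) x := by
  filter_upwards [LocallyIntegrable.ae_hasDerivAt_integral H.locallyIntegrable] with x hx
  have h1 : f = fun x => f 0 + ∫ t in (0 : ℝ)..x, g t := funext fun x => H.eq_add 0 x
  rw [h1]
  exact (hx 0).const_add _

lemma absolutelyContinuousOnInterval (H : HasPrim f g) (a b : ℝ) :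
    AbsolutelyContinuousOnInterval f a b := by
  have h1 : f = fun x => f a + ∫ t in a..x, g t := funext fun x => H.eq_add a x
  rw [h1]
  have h2 : AbsolutelyContinuousOnInterval (fun _ : ℝ => f a) a b :=
    (LipschitzWith.const (f a)).lipschitzOnWith.absolutelyContinuousOnInterval
  exact h2.fun_add ((H.integrable a b).absolutelyContinuousOnInterval_intervalIntegral (by simp))

lemma of_absolutelyContinuousOnInterval (h : ∀ a b, AbsolutelyContinuousOnInterval f a b)
    (hd : ∀ᵐ x, HasDerivAt f (g x) x) : HasPrim f g := by
  have he : ∀ a b, ∀ᵐ x, x ∈ uIoc a b → deriv f x = g x := fun a b => by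
    filter_upwards [hd] with x hx _ using hx.deriv
  refine ⟨fun a b => ?_, fun a b => ?_⟩
  · refine (h a b).intervalIntegrable_deriv.congr_ae ?_
    rw [Filter.EventuallyEq, ae_restrict_iff' measurableSet_uIoc]
    exact he a b
  · rw [← (h a b).integral_deriv_eq_sub]
    exact intervalIntegral.integral_congr_ae (he a b)

lemma continuous (H : HasPrim f g) : Continuous f := by
  rw [continuous_iff_continuousAt]
  intro x
  have h1 := (H.absolutelyContinuousOnInterval (x - 1) (x + 1)).continuousOn
  rw [uIcc_of_le (by linarith)] at h1
  exact h1.continuousAt (Icc_mem_nhds (by linarith) (by linarith))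

lemma congr_ae (H : HasPrim f g₁) (h : g₁ =ᵐ[volume] g₂) : HasPrim f g₂ := by
  refine ⟨fun a b => (H.integrable a b).congr_ae (ae_restrict_of_ae h), fun a b => ?_⟩
  rw [H.sub_eq]
  exact intervalIntegral.integral_congr_ae (h.mono fun x hx _ => hx)

lemma sub (H₁ : HasPrim f₁ g₁) (H₂ : HasPrim f₂ g₂) :
    HasPrim (fun x => f₁ x - f₂ x) (fun x => g₁ x - g₂ x) :=
  ⟨fun a b => (H₁.integrable a b).sub (H₂.integrable a b), fun a b => by
    rw [intervalIntegral.integral_sub (H₁.integrable a b) (H₂.integrable a b), ← H₁.sub_eq,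
      ← H₂.sub_eq]; ring⟩

lemma mul (H₁ : HasPrim f₁ g₁) (H₂ : HasPrim f₂ g₂) :
    HasPrim (fun x => f₁ x * f₂ x) (fun x => g₁ x * f₂ x + f₁ x * g₂ x) := by
  refine of_absolutelyContinuousOnInterval (fun a b =>
    (H₁.absolutelyContinuousOnInterval a b).fun_mul (H₂.absolutelyContinuousOnInterval a b)) ?_
  filter_upwards [H₁.ae_hasDerivAt, H₂.ae_hasDerivAt] with x h1 h2 using h1.mul h2

/-- Chain rule with a continuously differentiable outer function. -/
lemma comp (H : HasPrim f g) {Φ Φ' : ℝ → ℝ} {s : Set ℝ} (hs : ∀ x, f x ∈ s)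
    (hΦ : ∀ y ∈ s, HasDerivAt Φ (Φ' y) y) (hΦ' : ContinuousOn Φ' s) :
    HasPrim (fun x => Φ (f x)) (fun x => Φ' (f x) * g x) := by
  refine of_absolutelyContinuousOnInterval (fun a b => ?_) ?_
  · have hac := H.absolutelyContinuousOnInterval a b
    have him : f '' uIcc a b ⊆ s := by rintro _ ⟨x, -, rfl⟩; exact hs x
    have hconv : Convex ℝ (f '' uIcc a b) :=
      (isPreconnected_uIcc.image f hac.continuousOn).ordConnected.convex
    have hcomp : IsCompact (f '' uIcc a b) := isCompact_uIcc.image_of_continuousOn hac.continuousOn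
    obtain ⟨C, hC⟩ := hcomp.exists_bound_of_continuousOn (hΦ'.mono him)
    have hlip : ∀ x ∈ uIcc a b, ∀ y ∈ uIcc a b,
        dist (Φ (f x)) (Φ (f y)) ≤ C * dist (f x) (f y) := by
      intro x hx y hy
      rw [dist_eq_norm, dist_eq_norm]
      exact hconv.norm_image_sub_le_of_norm_hasDerivWithin_le
        (fun z hz => (hΦ z (him hz)).hasDerivWithinAt) hC (mem_image_of_mem f hy)
        (mem_image_of_mem f hx)
    unfold AbsolutelyContinuousOnInterval at hac ⊢
    refine squeeze_zero' (Filter.Eventually.of_forall fun _ =>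
      Finset.sum_nonneg fun _ _ => dist_nonneg) ?_ (by simpa using hac.const_mul C)
    rw [Filter.eventually_inf_principal]
    refine Filter.Eventually.of_forall fun E hE => ?_
    rw [Finset.mul_sum]
    exact Finset.sum_le_sum fun i hi => hlip _ (hE.1 i hi).1 _ (hE.1 i hi).2
  · filter_upwards [H.ae_hasDerivAt] with x h1
    exact (hΦ (f x) (hs x)).comp x h1

lemma of_hasDerivAt (h : ∀ x, HasDerivAt f (g x) x) (hg : Continuous g) : HasPrim f g :=
  ⟨fun a b => hg.intervalIntegrable a b, fun a b =>
    (intervalIntegral.integral_eq_sub_of_hasDerivAt (fun x _ => h x)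
      (hg.intervalIntegrable a b)).symm⟩

lemma hasDerivAt (H : HasPrim f g) (hg : Continuous g) (x : ℝ) : HasDerivAt f (g x) x := by
  have h1 : f = fun x => f 0 + ∫ t in (0 : ℝ)..x, g t := funext fun x => H.eq_add 0 x
  rw [h1]
  exact (hg.integral_hasStrictDerivAt 0 x).hasDerivAt.const_add _

lemma integral_eq_zero (H : HasPrim f g) (hf : Function.Periodic f (2 * Real.pi)) :
    ∫ x in (0 : ℝ)..(2 * Real.pi), g x = 0 := by
  rw [← H.sub_eq]
  have := hf 0
  rw [zero_add] at this
  rw [this, sub_self]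

end HasPrim

/-! ### Functions on the circle and their periodic lifts -/

/-- The periodic lift to the line of a function on the circle. -/
def lift (F : S1 → ℝ) (x : ℝ) : ℝ := F (x : S1)

lemma lift_periodic (F : S1 → ℝ) : Function.Periodic (lift F) (2 * Real.pi) := fun x => by
  rw [lift, AddCircle.coe_add_period, lift]

/-- The function on the circle with a given periodic lift. -/
def descend (f : ℝ → ℝ) : S1 → ℝ := AddCircle.liftIoc (2 * Real.pi) 0 f

lemma lift_descend {f : ℝ → ℝ} (hf : Function.Periodic f (2 * Real.pi)) :
    lift (descend f) = f := by
  ext x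
  have key : ∃ y ∈ Ioc (0 : ℝ) (0 + 2 * Real.pi), ((x : ℝ) : S1) = y ∧ f x = f y := by
    obtain ⟨n, hn, -⟩ := existsUnique_add_zsmul_mem_Ioc Real.two_pi_pos x 0
    refine ⟨_, hn, ?_, ?_⟩
    · rw [AddCircle.coe_add, AddCircle.coe_zsmul, AddCircle.coe_period, smul_zero, add_zero]
    · exact (hf.zsmul n x).symm
  obtain ⟨y, hy, h1, h2⟩ := key
  rw [lift, h1, h2, descend, AddCircle.liftIoc_coe_apply hy]

/-- The measurable section of the covering map with values in `(0, 2π]`. -/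
def section₀ (x : S1) : ℝ := AddCircle.equivIoc (2 * Real.pi) 0 x

lemma coe_section₀ (x : S1) : ((section₀ x : ℝ) : S1) = x := AddCircle.coe_equivIoc

lemma lift_section₀ (F : S1 → ℝ) (x : S1) : lift F (section₀ x) = F x := by
  rw [lift, coe_section₀]

lemma section₀_mem (x : S1) : section₀ x ∈ Ioc (0 : ℝ) (2 * Real.pi) := by
  have := (AddCircle.equivIoc (2 * Real.pi) 0 x).2
  exact ⟨this.1, this.2.trans (zero_add _).le⟩

/-- Lebesgue measure on one period. -/
abbrev period : Measure ℝ := volume.restrict (Ioc 0 (2 * Real.pi))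

lemma measurePreserving_coe : MeasurePreserving (fun x : ℝ => (x : S1)) period volume := by
  have := AddCircle.measurePreserving_mk (2 * Real.pi) 0
  rwa [zero_add] at this

lemma measurePreserving_section₀ : MeasurePreserving section₀ volume period := by
  have h1 : MeasurePreserving (AddCircle.equivIoc (2 * Real.pi) 0) volume
      (Measure.comap Subtype.val volume) := AddCircle.measurePreserving_equivIoc _
  have h2 : MeasurePreserving (Subtype.val : Ioc (0 : ℝ) (0 + 2 * Real.pi) → ℝ)
      (Measure.comap Subtype.val volume) (volume.restrict (Ioc (0 : ℝ) (0 + 2 * Real.pi))) :=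
    ⟨measurable_subtype_coe, map_comap_subtype_coe measurableSet_Ioc _⟩
  have h3 : MeasurePreserving section₀ volume _ := h2.comp h1
  rwa [zero_add] at h3

lemma integral_circle (F : S1 → ℝ) :
    ∫ x, F x = ∫ x in (0 : ℝ)..(2 * Real.pi), lift F x := by
  have := AddCircle.intervalIntegral_preimage (2 * Real.pi) 0 F
  rw [zero_add] at this
  exact this.symm

lemma integral_circle' (F : S1 → ℝ) : ∫ x, F x = ∫ x, lift F x ∂period := by
  rw [integral_circle, intervalIntegral.integral_of_le Real.two_pi_pos.le]

lemma memLp_lift_iff {F : S1 → ℝ} {p : ENNReal} : MemLp (lift F) p period ↔ MemLp F p := by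
  refine ⟨fun h => ?_, fun h => h.comp_measurePreserving measurePreserving_coe⟩
  have := h.comp_measurePreserving measurePreserving_section₀
  rwa [show lift F ∘ section₀ = F from funext (lift_section₀ F)] at this

lemma integrable_lift_iff {F : S1 → ℝ} : Integrable (lift F) period ↔ Integrable F := by
  rw [← memLp_one_iff_integrable, ← memLp_one_iff_integrable, memLp_lift_iff]

lemma ae_lift_iff {p : S1 → Prop} : (∀ᵐ x : ℝ ∂period, p (x : S1)) ↔ ∀ᵐ x, p x := by
  refine ⟨fun h => ?_, fun h => measurePreserving_coe.quasiMeasurePreserving.ae h⟩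
  filter_upwards [measurePreserving_section₀.quasiMeasurePreserving.ae h] with x hx
  rwa [coe_section₀] at hx

/-- A property of the circle which holds almost everywhere holds almost everywhere on the line. -/
lemma ae_line_of_ae_circle {p : S1 → Prop} (h : ∀ᵐ x, p x) : ∀ᵐ x : ℝ, p (x : S1) := by
  have h0 : ∀ᵐ x : ℝ, x ∈ Ioc 0 (2 * Real.pi) → p (x : S1) :=
    (ae_restrict_iff' measurableSet_Ioc).mp (ae_lift_iff.mpr h)
  have h1 : ∀ n : ℤ, ∀ᵐ x : ℝ, x + n • (2 * Real.pi) ∈ Ioc 0 (2 * Real.pi) → p (x : S1) := by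
    intro n
    have := (measurePreserving_add_right volume (n • (2 * Real.pi))).quasiMeasurePreserving.ae h0
    filter_upwards [this] with x hx hx'
    have h2 := hx hx'
    rwa [AddCircle.coe_add, AddCircle.coe_zsmul, AddCircle.coe_period, smul_zero, add_zero] at h2
  filter_upwards [ae_all_iff.mpr h1] with x hx
  obtain ⟨n, hn, -⟩ := existsUnique_add_zsmul_mem_Ioc Real.two_pi_pos x 0
  rw [zero_add] at hn
  exact hx n hn

lemma intervalIntegrable_lift {F : S1 → ℝ} (h : Integrable F) (a b : ℝ) :
    IntervalIntegrable (lift F) volume a b := by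
  have h1 : IntervalIntegrable (lift F) volume 0 (0 + 2 * Real.pi) := by
    rw [zero_add, intervalIntegrable_iff_integrableOn_Ioc_of_le Real.two_pi_pos.le]
    exact integrable_lift_iff.mpr h
  exact (lift_periodic F).intervalIntegrable Real.two_pi_pos.ne' h1 a b

lemma lift_continuous {F : S1 → ℝ} (h : Continuous F) : Continuous (lift F) :=
  h.comp (AddCircle.continuous_mk' _)

lemma continuous_of_lift {F : S1 → ℝ} (h : Continuous (lift F)) : Continuous F :=
  (QuotientAddGroup.isQuotientMap_mk _).continuous_iff.mpr h

lemma circleDeriv_coe (φ : S1 → ℝ) (x : ℝ) : circleDeriv φ (x : S1) = deriv (lift φ) x := by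
  have h1 : (fun y : ℝ => φ ((x : S1) + (y : S1))) = fun y => lift φ (x + y) := by
    ext y; rw [lift, AddCircle.coe_add]
  rw [circleDeriv, h1, deriv_comp_const_add, add_zero]

lemma IsTest.contDiff {φ : S1 → ℝ} (h : IsTest φ) : ContDiff ℝ ∞ (lift φ) := h

lemma IsTest.continuous {φ : S1 → ℝ} (h : IsTest φ) : Continuous φ :=
  continuous_of_lift h.contDiff.continuous

lemma IsTest.continuous_deriv {φ : S1 → ℝ} (h : IsTest φ) : Continuous (deriv (lift φ)) :=
  h.contDiff.continuous_deriv (by simp)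

lemma IsTest.hasPrim {φ : S1 → ℝ} (h : IsTest φ) : HasPrim (lift φ) (deriv (lift φ)) :=
  HasPrim.of_hasDerivAt (fun x => ((h.contDiff.differentiable (by simp)) x).hasDerivAt)
    h.continuous_deriv

lemma lift_circleDeriv (φ : S1 → ℝ) : lift (circleDeriv φ) = deriv (lift φ) :=
  funext fun x => circleDeriv_coe φ x

lemma IsTest.continuous_circleDeriv {φ : S1 → ℝ} (h : IsTest φ) : Continuous (circleDeriv φ) :=
  continuous_of_lift (by rw [lift_circleDeriv]; exact h.continuous_deriv)

lemma exists_bound_of_continuous {φ : S1 → ℝ} (h : Continuous φ) :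
    ∃ C, 0 < C ∧ ∀ x, |φ x| ≤ C := by
  obtain ⟨C, hC⟩ := isCompact_univ.exists_bound_of_continuousOn h.continuousOn
  exact ⟨max C 1, by positivity, fun x => (hC x (mem_univ x)).trans (le_max_left _ _)⟩

lemma integrable_of_continuous {φ : S1 → ℝ} (h : Continuous φ) : Integrable φ :=
  h.integrable_of_hasCompactSupport (HasCompactSupport.of_compactSpace φ)

lemma integrable_mul_continuous {F φ : S1 → ℝ} (hF : Integrable F) (h : Continuous φ) :
    Integrable fun x => F x * φ x := by
  obtain ⟨C, -, hC⟩ := exists_bound_of_continuous h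
  exact hF.mul_bdd (c := C) h.aestronglyMeasurable (Filter.Eventually.of_forall hC)

/-- An absolutely continuous function on the circle has its derivative as weak derivative. -/
lemma HasPrim.hasWeakDeriv {F G : S1 → ℝ} (H : HasPrim (lift F) (lift G)) : HasWeakDeriv F G := by
  have hF : Continuous F := continuous_of_lift H.continuous
  have hG : Integrable G := by
    rw [← integrable_lift_iff]
    exact (H.integrable 0 (2 * Real.pi)).1
  refine ⟨integrable_of_continuous hF, hG, fun φ hφ => ?_⟩
  have h1 := HasPrim.integral_eq_zero (H.mul hφ.hasPrim)
    ((lift_periodic F).mul (lift_periodic φ))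
  have h2 : ∫ x, (G x * φ x + F x * circleDeriv φ x) = 0 := by
    refine Eq.trans ?_ h1
    rw [integral_circle]
    refine congrArg (fun f : ℝ → ℝ => ∫ x in (0 : ℝ)..(2 * Real.pi), f x) (funext fun x => ?_)
    simp only [lift, circleDeriv_coe]
  rw [integral_add (integrable_mul_continuous hG hφ.continuous)
    (integrable_mul_continuous (integrable_of_continuous hF) hφ.continuous_circleDeriv)] at h2
  linarith

/-- A smooth function with compact support in the open period, viewed on the circle. -/
lemma isTest_descend {ψ : ℝ → ℝ} (h : ContDiff ℝ ∞ ψ)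
    (hs : tsupport ψ ⊆ Ioo 0 (2 * Real.pi)) : IsTest (descend ψ) := by
  change ContDiff ℝ ∞ (lift (descend ψ))
  have hval : ∀ y ∈ Ioc 0 (2 * Real.pi), lift (descend ψ) y = ψ y := fun y hy =>
    AddCircle.liftIoc_coe_apply (by rwa [zero_add])
  -- near a point of the half-open period `[0, 2π)`
  have hmain : ∀ x ∈ Ico 0 (2 * Real.pi), ContDiffAt ℝ ∞ (lift (descend ψ)) x := by
    intro x hx
    rcases eq_or_lt_of_le hx.1 with h0 | h0
    · subst h0
      have e0 : ∀ᶠ y in nhds (0 : ℝ), ψ y = 0 := by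
        have : (0 : ℝ) ∉ tsupport ψ := fun h => (lt_irrefl _ (hs h).1)
        exact notMem_tsupport_iff_eventuallyEq.mp this
      have e1 : ∀ᶠ y in nhds (0 : ℝ), ψ (y + 2 * Real.pi) = 0 := by
        have h2 : (2 * Real.pi : ℝ) ∉ tsupport ψ := fun h => (lt_irrefl _ (hs h).2)
        have h3 := notMem_tsupport_iff_eventuallyEq.mp h2
        have h4 : Filter.Tendsto (fun y : ℝ => y + 2 * Real.pi) (nhds 0) (nhds (2 * Real.pi)) := by
          have : Continuous fun y : ℝ => y + 2 * Real.pi := by fun_prop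
          simpa using this.tendsto 0
        exact h4.eventually h3
      have e2 : lift (descend ψ) =ᶠ[nhds 0] fun _ => 0 := by
        have hlt : ∀ᶠ y in nhds (0 : ℝ), y ∈ Ioo (-(2 * Real.pi)) (2 * Real.pi) :=
          Ioo_mem_nhds (by linarith [Real.pi_pos]) (by linarith [Real.pi_pos])
        filter_upwards [e0, e1, hlt] with y h1 h2 h3
        rcases le_or_gt y 0 with h4 | h4
        · rw [← lift_periodic (descend ψ) y, hval _ ⟨by linarith [h3.1], by linarith⟩, h2]
        · rw [hval _ ⟨h4, h3.2.le⟩, h1]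
      exact contDiffAt_const.congr_of_eventuallyEq e2
    · refine h.contDiffAt.congr_of_eventuallyEq ?_
      filter_upwards [Ioo_mem_nhds h0 hx.2] with y hy using hval y ⟨hy.1, hy.2.le⟩
  rw [contDiff_iff_contDiffAt]
  intro x
  obtain ⟨n, hn, -⟩ := existsUnique_add_zsmul_mem_Ico Real.two_pi_pos x 0
  rw [zero_add] at hn
  have h1 := hmain _ hn
  have h2 : lift (descend ψ) = lift (descend ψ) ∘ fun y => y + n • (2 * Real.pi) :=
    funext fun y => ((lift_periodic (descend ψ)).zsmul n y).symm
  rw [h2]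
  exact ContDiffAt.comp x h1 (contDiffAt_id.add contDiffAt_const)

/-- The fundamental lemma of the calculus of variations on the circle. -/
lemma ae_eq_zero_of_forall_test {G : S1 → ℝ} (hG : Integrable G)
    (h : ∀ φ, IsTest φ → ∫ x, G x * φ x = 0) : G =ᵐ[volume] 0 := by
  have h1 : ∀ᵐ x : ℝ, x ∈ Ioo 0 (2 * Real.pi) → lift G x = 0 := by
    refine isOpen_Ioo.ae_eq_zero_of_integral_contDiff_smul_eq_zero ?_ ?_
    · have : LocallyIntegrable (lift G) := by
        rw [locallyIntegrable_iff]
        intro k hk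
        obtain ⟨r, hr⟩ := hk.isBounded.subset_closedBall 0
        rw [Real.closedBall_eq_Icc] at hr
        refine IntegrableOn.mono_set (intervalIntegrable_lift hG (0 - r - 1) (0 + r)).1
          fun x hx => ?_
        have := hr hx
        exact ⟨by linarith [this.1], this.2⟩
      exact this.locallyIntegrableOn _
    · intro ψ h2 _ h4
      have h5 := h _ (isTest_descend h2 h4)
      rw [integral_circle', setIntegral_congr_fun (g := fun x => ψ x • lift G x)
        measurableSet_Ioc] at h5
      · rw [← h5, setIntegral_eq_integral_of_forall_compl_eq_zero]
        intro x hx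
        have : x ∉ tsupport ψ := fun hx' => hx (Ioo_subset_Ioc_self (h4 hx'))
        rw [image_eq_zero_of_notMem_tsupport this, zero_smul]
      · intro x hx
        have : descend ψ (x : S1) = ψ x := AddCircle.liftIoc_coe_apply (by rwa [zero_add])
        simp only [lift, this, smul_eq_mul]
        ring
  have h2 : ∀ᵐ x : ℝ ∂period, G (x : S1) = 0 := by
    rw [ae_restrict_iff' measurableSet_Ioc]
    have h3 : ∀ᵐ x : ℝ, x ≠ 2 * Real.pi := by simp [ae_iff, measure_singleton]
    filter_upwards [h1, h3] with x hx hx' hx''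
    exact hx ⟨hx''.1, lt_of_le_of_ne hx''.2 hx'⟩
  exact ae_lift_iff.mp h2

lemma ae_eq_of_forall_test {F G : S1 → ℝ} (hF : Integrable F) (hG : Integrable G)
    (h : ∀ φ, IsTest φ → ∫ x, F x * φ x = ∫ x, G x * φ x) : F =ᵐ[volume] G := by
  have := ae_eq_zero_of_forall_test (hF.sub hG) fun φ hφ => by
    simp only [Pi.sub_apply, sub_mul]
    rw [integral_sub (integrable_mul_continuous hF hφ.continuous)
      (integrable_mul_continuous hG hφ.continuous), h φ hφ, sub_self]
  filter_upwards [this] with x hx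
  simpa [sub_eq_zero] using hx

namespace HasWeakDeriv

variable {F F₁ F₂ G G₁ G₂ : S1 → ℝ}

lemma ae_unique (h₁ : HasWeakDeriv F G₁) (h₂ : HasWeakDeriv F G₂) : G₁ =ᵐ[volume] G₂ :=
  ae_eq_of_forall_test h₁.integrable_right h₂.integrable_right fun φ hφ => by
    linarith [h₁.integral_eq φ hφ, h₂.integral_eq φ hφ]

lemma weakDeriv_ae_eq (h : HasWeakDeriv F G) : weakDeriv F =ᵐ[volume] G := by
  have hex : ∃ G, HasWeakDeriv F G := ⟨G, h⟩
  rw [weakDeriv, dif_pos hex]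
  exact hex.choose_spec.ae_unique h

lemma congr (h : HasWeakDeriv F₁ G₁) (hF : F₁ =ᵐ[volume] F₂) (hG : G₁ =ᵐ[volume] G₂) :
    HasWeakDeriv F₂ G₂ := by
  refine ⟨h.integrable_left.congr hF, h.integrable_right.congr hG, fun φ hφ => ?_⟩
  have h1 : ∫ x, F₂ x * circleDeriv φ x = ∫ x, F₁ x * circleDeriv φ x :=
    integral_congr_ae (hF.mono fun x hx => by simp only [hx])
  have h2 : ∫ x, G₂ x * φ x = ∫ x, G₁ x * φ x :=
    integral_congr_ae (hG.mono fun x hx => by simp only [hx])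
  rw [h1, h2, h.integral_eq φ hφ]

lemma isTest_const (c : ℝ) : IsTest fun _ => c := contDiff_const

lemma integral_right_eq_zero (h : HasWeakDeriv F G) : ∫ x, G x = 0 := by
  have := h.integral_eq _ (isTest_const 1)
  simpa [circleDeriv] using this

/-- Every function with a weak derivative has an absolutely continuous representative. -/
lemma exists_hasPrim (h : HasWeakDeriv F G) :
    ∃ F' : S1 → ℝ, F =ᵐ[volume] F' ∧ HasPrim (lift F') (lift G) := by
  set P : ℝ → ℝ := fun x => ∫ t in (0 : ℝ)..x, lift G t with hP
  have hGi := intervalIntegrable_lift h.integrable_right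
  have hPprim : HasPrim P (lift G) := HasPrim.of_eq_add hGi 0 fun x => by simp [hP]
  have hper : Function.Periodic P (2 * Real.pi) := by
    intro x
    have h1 := hPprim.sub_eq x (x + 2 * Real.pi)
    rw [(lift_periodic G).intervalIntegral_add_eq x 0, zero_add, ← integral_circle,
      h.integral_right_eq_zero] at h1
    linarith
  have hPw : HasWeakDeriv (descend P) G :=
    HasPrim.hasWeakDeriv (by rw [lift_descend hper]; exact hPprim)
  set H : S1 → ℝ := fun x => F x - descend P x with hH
  have hHi : Integrable H := h.integrable_left.sub hPw.integrable_left
  set c : ℝ := (∫ x, H x) / (2 * Real.pi) with hc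
  have hHw : ∀ φ, IsTest φ → ∫ x, H x * circleDeriv φ x = 0 := fun φ hφ => by
    simp only [hH, sub_mul]
    rw [integral_sub (integrable_mul_continuous h.integrable_left hφ.continuous_circleDeriv)
      (integrable_mul_continuous hPw.integrable_left hφ.continuous_circleDeriv),
      h.integral_eq φ hφ, hPw.integral_eq φ hφ, sub_self]
  have hconst : H =ᵐ[volume] fun _ => c := by
    refine ae_eq_of_forall_test hHi (integrable_of_continuous continuous_const) fun ψ hψ => ?_
    set m : ℝ := (∫ x, ψ x) / (2 * Real.pi) with hm
    set Ψ : ℝ → ℝ := fun x => ∫ t in (0 : ℝ)..x, (lift ψ t - m) with hΨ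
    have hcont : Continuous fun t => lift ψ t - m :=
      (lift_continuous hψ.continuous).sub continuous_const
    have hd : ∀ x, HasDerivAt Ψ (lift ψ x - m) x := fun x =>
      (hcont.integral_hasStrictDerivAt 0 x).hasDerivAt
    have hpΨ : Function.Periodic Ψ (2 * Real.pi) := by
      intro x
      have h1 := (HasPrim.of_hasDerivAt hd hcont).sub_eq x (x + 2 * Real.pi)
      have h2 : Function.Periodic (fun t => lift ψ t - m) (2 * Real.pi) := fun t => by
        simp only [lift_periodic ψ t]
      rw [h2.intervalIntegral_add_eq x 0, zero_add, intervalIntegral.integral_sub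
        ((lift_continuous hψ.continuous).intervalIntegrable _ _) (by simp), ← integral_circle,
        intervalIntegral.integral_const, hm, sub_zero, smul_eq_mul] at h1
      have h3 : 2 * Real.pi * ((∫ x, ψ x) / (2 * Real.pi)) = ∫ x, ψ x := by
        field_simp
      rw [h3] at h1
      linarith
    have htest : IsTest (descend Ψ) := by
      change ContDiff ℝ ∞ (lift (descend Ψ))
      rw [lift_descend hpΨ, contDiff_infty_iff_deriv]
      refine ⟨fun x => (hd x).differentiableAt, ?_⟩
      have : deriv Ψ = fun x => lift ψ x - m := funext fun x => (hd x).deriv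
      rw [this]
      exact hψ.contDiff.sub contDiff_const
    have h4 := hHw _ htest
    have h5 : circleDeriv (descend Ψ) = fun x => ψ x - m := by
      ext x
      rw [← coe_section₀ x, circleDeriv_coe, lift_descend hpΨ, (hd _).deriv, lift]
    rw [h5] at h4
    simp only [mul_sub] at h4
    rw [integral_sub (integrable_mul_continuous hHi hψ.continuous) (hHi.mul_const m),
      integral_mul_const] at h4
    rw [integral_const_mul, hc]
    have h6 : (∫ x, H x) * m = (∫ x, H x) / (2 * Real.pi) * ∫ x, ψ x := by rw [hm]; ring
    linarith
  refine ⟨fun x => c + descend P x, ?_, ?_⟩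
  · filter_upwards [hconst] with x hx
    simp only [hH] at hx
    linarith
  · refine HasPrim.of_eq_add hGi c fun x => ?_
    have : descend P (x : S1) = P x := congrFun (lift_descend hper) x
    simp only [lift, this]
    rfl

lemma hasPrim_of_continuous (h : HasWeakDeriv F G) (hF : Continuous F) :
    HasPrim (lift F) (lift G) := by
  obtain ⟨F', h1, h2⟩ := h.exists_hasPrim
  have h3 : F = F' := Continuous.ae_eq_iff_eq volume hF (continuous_of_lift h2.continuous) |>.mp h1
  rwa [h3]

end HasWeakDeriv

/-! ### The flux of a function in `H²` -/

/-- The spatial derivative of the flux `arctan (p / f)` in terms of `f`, `p = f'` and `q = f''`. -/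
def fluxDeriv (f p q : S1 → ℝ) (x : S1) : ℝ := (f x * q x - p x ^ 2) / (f x ^ 2 + p x ^ 2)

lemma hasPrim_div {f p q : S1 → ℝ} (hpos : ∀ x, 0 < f x) (h1 : HasPrim (lift f) (lift p))
    (h2 : HasPrim (lift p) (lift q)) :
    HasPrim (lift fun x => p x / f x) (lift fun x => (f x * q x - p x ^ 2) / f x ^ 2) := by
  have hinv := h1.comp (s := Ioi 0) (fun x => hpos (x : S1)) (Φ := fun y => y⁻¹)
    (Φ' := fun y => -(y ^ 2)⁻¹) (fun y hy => hasDerivAt_inv (ne_of_gt hy))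
    (fun y (hy : 0 < y) => ContinuousAt.continuousWithinAt
      (((continuousAt_id.pow 2).inv₀ (pow_ne_zero 2 hy.ne')).neg))
  have h3 := h2.mul hinv
  have e1 : (lift fun x => p x / f x) = fun x => lift p x * (lift f x)⁻¹ :=
    funext fun x => div_eq_mul_inv _ _
  have e2 : (lift fun x => (f x * q x - p x ^ 2) / f x ^ 2) = fun x => lift q x * (lift f x)⁻¹ +
      lift p x * (-(lift f x ^ 2)⁻¹ * lift p x) := by
    ext x
    have := hpos (x : S1)
    simp only [lift]
    field_simp
    ring
  rwa [e1, e2]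

lemma hasPrim_flux {f p q : S1 → ℝ} (hpos : ∀ x, 0 < f x) (h1 : HasPrim (lift f) (lift p))
    (h2 : HasPrim (lift p) (lift q)) :
    HasPrim (lift fun x => Real.arctan (p x / f x)) (lift (fluxDeriv f p q)) := by
  have h3 := (hasPrim_div hpos h1 h2).comp (s := univ) (fun _ => mem_univ _) (Φ := Real.arctan)
    (Φ' := fun y => 1 / (1 + y ^ 2)) (fun y _ => Real.hasDerivAt_arctan y)
    (by
      refine Continuous.continuousOn (continuous_const.div (by fun_prop) fun y => ?_)
      positivity)
  refine (show _ = lift (fluxDeriv f p q) from ?_) ▸ h3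
  ext x
  have := hpos (x : S1)
  simp only [lift, fluxDeriv]
  field_simp

/-- A positive continuous function in `H²` has a continuously differentiable lift, and its flux is
absolutely continuous. -/
lemma exists_hasPrim_flux {f p q : S1 → ℝ} (hf : Continuous f) (hpos : ∀ x, 0 < f x)
    (h1 : HasWeakDeriv f p) (h2 : HasWeakDeriv p q) :
    ∃ p' : S1 → ℝ, p =ᵐ[volume] p' ∧ HasPrim (lift f) (lift p') ∧ HasPrim (lift p') (lift q) ∧
      HasPrim (lift fun x => Real.arctan (p' x / f x)) (lift (fluxDeriv f p q)) := by
  obtain ⟨p', h3, h4⟩ := h2.exists_hasPrim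
  have h5 : HasPrim (lift f) (lift p') :=
    (h1.congr (by rfl) h3).hasPrim_of_continuous hf
  refine ⟨p', h3, h5, h4, (hasPrim_flux hpos h5 h4).congr_ae ?_⟩
  have : ∀ᵐ x, fluxDeriv f p' q x = fluxDeriv f p q x := by
    filter_upwards [h3] with x hx
    rw [fluxDeriv, fluxDeriv, hx]
  exact ae_line_of_ae_circle this

/-! ### Solutions as integrals in time -/

lemma spaceTime_eq (T : ℝ) :
    spaceTime T = (volume.restrict (Ioc 0 T)).prod volume := by
  rw [spaceTime, Measure.restrict_congr_set Ioo_ae_eq_Ioc]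

instance (T : ℝ) : IsFiniteMeasure (spaceTime T) := by unfold spaceTime; infer_instance

lemma restrict_Ioc_prod_le {t T : ℝ} (ht : t ≤ T) :
    (volume.restrict (Ioc 0 t)).prod (volume : Measure S1) ≤ spaceTime T := by
  rw [spaceTime_eq]
  nth_rewrite 1 [← Measure.restrict_univ (μ := (volume : Measure S1))]
  nth_rewrite 2 [← Measure.restrict_univ (μ := (volume : Measure S1))]
  rw [Measure.prod_restrict, Measure.prod_restrict]
  exact Measure.restrict_mono (prod_mono (Ioc_subset_Ioc_right ht) subset_rfl) le_rfl

lemma Icc_subset_closure_rat {T : ℝ} (hT : 0 < T) :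
    Icc 0 T ⊆ closure (Icc 0 T ∩ range ((↑) : ℚ → ℝ)) := by
  rw [← closure_Ioo hT.ne]
  refine closure_minimal ?_ isClosed_closure
  refine (Dense.open_subset_closure_inter Rat.isDenseEmbedding_coe_real.dense isOpen_Ioo).trans
    (closure_mono ?_)
  rw [closure_Ioo hT.ne]
  exact inter_subset_inter_left _ Ioo_subset_Icc_self

namespace IsSolution

variable {T : ℝ} {u₀ : S1 → ℝ} {u : ℝ → S1 → ℝ}

lemma continuous_slice (h : IsSolution T u₀ u) {t : ℝ} (ht : t ∈ Icc 0 T) : Continuous (u t) := by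
  have h1 := h.continuousOn.comp_continuous (f := fun x : S1 => (t, x)) (by fun_prop)
    fun x => ⟨ht, mem_univ x⟩
  exact h1

lemma continuousOn_time (h : IsSolution T u₀ u) (x : S1) :
    ContinuousOn (fun t => u t x) (Icc 0 T) :=
  h.continuousOn.comp (f := fun t : ℝ => (t, x)) (by fun_prop) fun t ht => ⟨ht, mem_univ x⟩

lemma exists_lower_bound (h : IsSolution T u₀ u) (hT : 0 < T) :
    ∃ m, 0 < m ∧ ∀ t ∈ Icc 0 T, ∀ x, m ≤ u t x := by
  have hc : IsCompact (Icc 0 T ×ˢ (univ : Set S1)) := isCompact_Icc.prod isCompact_univ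
  obtain ⟨z, hz, hmin⟩ := hc.exists_isMinOn ⟨(0, 0), ⟨⟨le_rfl, hT.le⟩, mem_univ _⟩⟩ h.continuousOn
  exact ⟨_, h.pos z.1 hz.1 z.2, fun t ht x => hmin (show (t, x) ∈ _ from ⟨ht, mem_univ x⟩)⟩

/-- A solution is almost everywhere in space the integral in time of the spatial derivative `ν` of
its flux. The equation gives this for each fixed time up to a null set of points; rational times and
continuity make the null set independent of the time. -/
lemma exists_velocity (h : IsSolution T u₀ u) (hT : 0 < T) :
    ∃ ν : ℝ → S1 → ℝ, Integrable (Function.uncurry ν) (spaceTime T) ∧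
      (∀ᵐ t ∂(volume.restrict (Ioc 0 T)), ∃ p : S1 → ℝ, HasPrim (lift (u t)) (lift p) ∧
        HasPrim (lift fun x => Real.arctan (p x / u t x)) (lift (ν t))) ∧
      ∀ᵐ x, ∀ t ∈ Icc 0 T, u t x = u₀ x + ∫ s in (0 : ℝ)..t, ν s x := by
  obtain ⟨hu2, p, q, hp2, hq2, hpq⟩ := h.memL2H2
  rw [Measure.restrict_congr_set Ioo_ae_eq_Ioc] at hpq
  have hpq' : ∀ᵐ t ∂(volume.restrict (Ioc 0 T)), t ∈ Icc 0 T ∧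
      HasWeakDeriv (u t) (p t) ∧ HasWeakDeriv (p t) (q t) := by
    filter_upwards [hpq, ae_restrict_mem measurableSet_Ioc] with t h1 h2
    exact ⟨⟨h2.1.le, h2.2⟩, h1⟩
  obtain ⟨m, hm, hmu⟩ := h.exists_lower_bound hT
  set ν : ℝ → S1 → ℝ := fun t => fluxDeriv (u t) (p t) (q t) with hν
  have hmem : ∀ᵐ z ∂(spaceTime T), z.1 ∈ Icc 0 T := by
    rw [spaceTime_eq]
    have : ∀ᵐ t ∂(volume.restrict (Ioc 0 T)), t ∈ Icc 0 T :=
      (ae_restrict_mem measurableSet_Ioc).mono fun t ht => ⟨ht.1.le, ht.2⟩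
    exact Measure.quasiMeasurePreserving_fst.ae this
  have hνi : Integrable (Function.uncurry ν) (spaceTime T) := by
    have hq1 : Integrable (Function.uncurry q) (spaceTime T) := hq2.integrable (by norm_num)
    refine Integrable.mono' ((hq1.abs.const_mul m⁻¹).add (integrable_const 1)) ?_ ?_
    · have a1 := hu2.1.aemeasurable
      have a2 := hp2.1.aemeasurable
      have a3 := hq2.1.aemeasurable
      exact (((a1.mul a3).sub (a2.pow_const 2)).div
        ((a1.pow_const 2).add (a2.pow_const 2))).aestronglyMeasurable
    · filter_upwards [hmem] with z hz
      have h1 := hmu z.1 hz z.2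
      have hu0 : 0 < u z.1 z.2 := hm.trans_le h1
      simp only [Function.uncurry, hν, fluxDeriv, Real.norm_eq_abs, Pi.add_apply]
      set a := u z.1 z.2
      set b := p z.1 z.2
      set c := q z.1 z.2
      have hab : 0 < a ^ 2 + b ^ 2 := by positivity
      rw [abs_div, abs_of_pos hab, div_le_iff₀ hab]
      calc |a * c - b ^ 2| ≤ |a * c| + |b ^ 2| := abs_sub _ _
        _ = a * |c| + b ^ 2 := by rw [abs_mul, abs_of_pos hu0, abs_of_nonneg (sq_nonneg b)]
        _ ≤ m⁻¹ * |c| * a ^ 2 + (a ^ 2 + b ^ 2) := by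
            have : m⁻¹ * |c| * a ^ 2 = a * |c| * (a / m) := by field_simp
            rw [this]
            have h2 : 1 ≤ a / m := by rwa [le_div_iff₀ hm, one_mul]
            have h3 : 0 ≤ a * |c| := by positivity
            nlinarith
        _ ≤ (m⁻¹ * |c| + 1) * (a ^ 2 + b ^ 2) := by
            have : 0 ≤ m⁻¹ * |c| * b ^ 2 := by positivity
            nlinarith
  have hflux : ∀ᵐ t ∂(volume.restrict (Ioc 0 T)), ∃ p' : S1 → ℝ, p t =ᵐ[volume] p' ∧
      weakDeriv (u t) =ᵐ[volume] p' ∧ HasPrim (lift (u t)) (lift p') ∧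
        HasPrim (lift fun x => Real.arctan (p' x / u t x)) (lift (ν t)) := by
    filter_upwards [hpq'] with t ht
    obtain ⟨p', h1, h2, h3, h4⟩ := exists_hasPrim_flux (h.continuous_slice ht.1) (h.pos t ht.1)
      ht.2.1 ht.2.2
    exact ⟨p', h1, ht.2.1.weakDeriv_ae_eq.trans h1, h2, h4⟩
  refine ⟨ν, hνi, hflux.mono fun t ⟨p', _, _, h1, h2⟩ => ⟨p', h1, h2⟩, ?_⟩
  have hνt : ∀ t ∈ Icc 0 T, Integrable (Function.uncurry ν)
      ((volume.restrict (Ioc 0 t)).prod volume) := fun t ht =>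
    hνi.mono_measure (restrict_Ioc_prod_le ht.2)
  have hdt : ∀ t ∈ Icc 0 T, ∀ᵐ x, u t x = u₀ x + ∫ s in (0 : ℝ)..t, ν s x := by
    intro t ht
    have h0 : Continuous u₀ := by
      rw [← h.initial]; exact h.continuous_slice ⟨le_rfl, hT.le⟩
    have hint : Integrable fun x => ∫ s in (0 : ℝ)..t, ν s x := by
      simp only [intervalIntegral.integral_of_le ht.1]
      exact (hνt t ht).integral_prod_right
    refine ae_eq_of_forall_test (F := u t)
      (integrable_of_continuous (h.continuous_slice ht))
      ((integrable_of_continuous h0).add hint) fun φ hφ => ?_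
    have h1 := h.equation φ hφ t ht
    have h2 : ∫ s in (0 : ℝ)..t, ∫ x, Real.arctan (weakDeriv (u s) x / u s x) * circleDeriv φ x =
        ∫ s in (0 : ℝ)..t, -∫ x, ν s x * φ x := by
      refine intervalIntegral.integral_congr_ae ?_
      rw [uIoc_of_le ht.1]
      have h3 := (ae_restrict_iff' measurableSet_Ioc).mp hflux
      filter_upwards [h3] with s hs hst
      obtain ⟨p', -, e, -, h4⟩ := hs ⟨hst.1, hst.2.trans ht.2⟩
      rw [← (HasPrim.hasWeakDeriv h4).integral_eq φ hφ]
      refine integral_congr_ae ?_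
      filter_upwards [e] with x hx
      rw [hx]
    rw [h2, intervalIntegral.integral_neg, neg_neg] at h1
    have hsw : ∫ s in (0 : ℝ)..t, ∫ x, ν s x * φ x = ∫ x, (∫ s in (0 : ℝ)..t, ν s x) * φ x := by
      simp only [intervalIntegral.integral_of_le ht.1, ← integral_mul_const]
      refine integral_integral_swap ?_
      obtain ⟨C, -, hC⟩ := exists_bound_of_continuous hφ.continuous
      exact (hνt t ht).mul_bdd (c := C)
        (hφ.continuous.comp continuous_snd).aestronglyMeasurable
        (Filter.Eventually.of_forall fun z => hC z.2)
    rw [hsw] at h1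
    have h5 : ∫ x, (u₀ x + ∫ s in (0 : ℝ)..t, ν s x) * φ x =
        (∫ x, u₀ x * φ x) + ∫ x, (∫ s in (0 : ℝ)..t, ν s x) * φ x := by
      simp only [add_mul]
      exact integral_add (integrable_mul_continuous (integrable_of_continuous h0) hφ.continuous)
        (integrable_mul_continuous hint hφ.continuous)
    rw [h5]
    linarith
  have hrat : ∀ᵐ x, ∀ r : ℚ, (r : ℝ) ∈ Icc 0 T →
      u r x = u₀ x + ∫ s in (0 : ℝ)..r, ν s x := by
    rw [ae_all_iff]
    intro r
    by_cases hr : (r : ℝ) ∈ Icc 0 T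
    · filter_upwards [hdt r hr] with x hx _ using hx
    · exact Filter.Eventually.of_forall fun x hx => absurd hx hr
  have hint2 : ∀ᵐ x, Integrable (fun s => ν s x) (volume.restrict (Ioc 0 T)) := by
    have := hνi
    rw [spaceTime_eq] at this
    exact this.prod_left_ae
  filter_upwards [hrat, hint2] with x h1 h2
  refine EqOn.of_subset_closure (s := Icc 0 T ∩ range ((↑) : ℚ → ℝ)) ?_ (h.continuousOn_time x)
    (continuousOn_const.add ?_) inter_subset_left (Icc_subset_closure_rat hT)
  · rintro _ ⟨ht, r, rfl⟩
    exact h1 r ht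
  · have h3 : IntervalIntegrable (fun s => ν s x) volume 0 T := by
      rwa [intervalIntegrable_iff_integrableOn_Ioc_of_le hT.le]
    have := intervalIntegral.continuousOn_primitive_interval' h3 left_mem_uIcc
    rwa [uIcc_of_le hT.le] at this

end IsSolution

/-! ### Uniqueness -/

lemma measurable_sign : Measurable Real.sign := by
  unfold Real.sign
  exact Measurable.ite measurableSet_Iio measurable_const
    (Measurable.ite measurableSet_Ioi measurable_const measurable_const)

lemma abs_sign_le (x : ℝ) : |Real.sign x| ≤ 1 := by
  rcases Real.sign_apply_eq x with h | h | h <;> rw [h] <;> norm_num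

/-- The chain rule for the absolute value of an absolutely continuous function. -/
lemma HasPrim.abs {f g : ℝ → ℝ} (H : HasPrim f g) :
    HasPrim (fun x => |f x|) (fun x => Real.sign (f x) * g x) := by
  have hac : ∀ a b, AbsolutelyContinuousOnInterval (fun x => |f x|) a b := by
    intro a b
    have h := H.absolutelyContinuousOnInterval a b
    unfold AbsolutelyContinuousOnInterval at h ⊢
    refine squeeze_zero (fun _ => Finset.sum_nonneg fun _ _ => dist_nonneg) (fun E => ?_) h
    exact Finset.sum_le_sum fun i _ => abs_abs_sub_abs_le _ _
  have hdiff : ∀ᵐ x, DifferentiableAt ℝ (fun x => |f x|) x := by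
    have h1 : ∀ᵐ x, ∀ n : ℕ, x ∈ uIcc (-(n : ℝ)) n → DifferentiableAt ℝ (fun x => |f x|) x :=
      ae_all_iff.mpr fun n => (hac _ _).ae_differentiableAt
    filter_upwards [h1] with x hx
    obtain ⟨n, hn⟩ := exists_nat_ge |x|
    refine hx n ?_
    rw [uIcc_of_le (by linarith [(Nat.cast_nonneg n : (0 : ℝ) ≤ n)])]
    exact ⟨by linarith [neg_abs_le x], by linarith [le_abs_self x]⟩
  refine HasPrim.of_absolutelyContinuousOnInterval hac ?_
  filter_upwards [hdiff, H.ae_hasDerivAt] with x h1 h2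
  rcases lt_trichotomy (f x) 0 with h3 | h3 | h3
  · rw [Real.sign_of_neg h3]
    exact (hasDerivAt_abs_neg h3).comp x h2
  · -- at a zero of `f` where `|f|` is differentiable, `|f|` has a minimum
    rw [h3, Real.sign_zero, zero_mul]
    have hmin : IsLocalMin (fun x => |f x|) x :=
      Filter.Eventually.of_forall fun y => by simp only [h3, abs_zero]; exact abs_nonneg _
    have := h1.hasDerivAt
    rwa [hmin.deriv_eq_zero] at this
  · rw [Real.sign_of_pos h3]
    exact (hasDerivAt_abs_pos h3).comp x h2

lemma tendsto_arctan_mul_sign (y : ℝ) :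
    Filter.Tendsto (fun n : ℕ => Real.arctan (n * y)) Filter.atTop
      (nhds (Real.pi / 2 * Real.sign y)) := by
  rcases lt_trichotomy y 0 with h | h | h
  · rw [Real.sign_of_neg h, mul_neg_one, ← neg_div]
    have h1 : Filter.Tendsto (fun n : ℕ => (n : ℝ) * y) Filter.atTop Filter.atBot :=
      tendsto_natCast_atTop_atTop.atTop_mul_const_of_neg h
    have := (Real.tendsto_arctan_atBot.mono_right nhdsWithin_le_nhds).comp h1
    rwa [← neg_div] at this
  · simp [h]
  · rw [Real.sign_of_pos h, mul_one]
    have h1 : Filter.Tendsto (fun n : ℕ => (n : ℝ) * y) Filter.atTop Filter.atTop :=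
      tendsto_natCast_atTop_atTop.atTop_mul_const h
    exact (Real.tendsto_arctan_atTop.mono_right nhdsWithin_le_nhds).comp h1

/-- If the flux `k` has the sign of `f'`, then its divergence tested with the sign of `f` is
nonpositive. This is the monotonicity behind the contraction in `L¹`. The sign function is
approximated by the smooth increasing functions `arctan (n * ·)`. -/
lemma integral_sign_mul_nonpos {f f' k κ : S1 → ℝ} (hf : HasPrim (lift f) (lift f'))
    (hk : HasPrim (lift k) (lift κ)) (hsign : ∀ x, 0 ≤ k x * f' x) :
    ∫ x, Real.sign (f x) * κ x ≤ 0 := by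
  have hκ : Integrable κ := (HasPrim.hasWeakDeriv hk).integrable_right
  have hfc : Continuous f := continuous_of_lift hf.continuous
  have hn : ∀ n : ℕ, ∫ x, Real.arctan (n * f x) * κ x ≤ 0 := by
    intro n
    have h1 := hf.comp (s := univ) (fun _ => mem_univ _) (Φ := fun y => Real.arctan (n * y))
      (Φ' := fun y => 1 / (1 + (n * y) ^ 2) * n)
      (fun y _ => by
        simpa using ((hasDerivAt_id y).const_mul (n : ℝ)).arctan)
      (by
        refine Continuous.continuousOn ((continuous_const.div (by fun_prop) fun y => ?_).mul
          continuous_const)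
        positivity)
    have h2 := HasPrim.integral_eq_zero (h1.mul hk) (fun x => by
      simp only [lift_periodic f x, lift_periodic k x])
    have h3 := (h1.mul hk).integrable 0 (2 * Real.pi)
    have h4 : IntervalIntegrable (fun x => Real.arctan (n * lift f x) * lift κ x) volume 0
        (2 * Real.pi) := by
      exact (hk.integrable _ _).continuousOn_mul
        ((Real.continuous_arctan.comp (continuous_const.mul hf.continuous)).continuousOn)
    have h5 : ∫ x in (0 : ℝ)..(2 * Real.pi), Real.arctan (n * lift f x) * lift κ x ≤ 0 := by
      refine le_trans (intervalIntegral.integral_mono_on Real.two_pi_pos.le h4 h3 fun x _ => ?_)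
        h2.le
      have h6 := hsign (x : S1)
      have h7 : 0 ≤ 1 / (1 + (n * lift f x) ^ 2) * n * lift f' x * lift k x := by
        have : 0 ≤ 1 / (1 + (n * lift f x) ^ 2) * n := by positivity
        have h8 : 0 ≤ lift f' x * lift k x := by rw [mul_comm]; exact h6
        calc (0 : ℝ) ≤ 1 / (1 + (n * lift f x) ^ 2) * n * (lift f' x * lift k x) :=
              mul_nonneg this h8
          _ = _ := by ring
      linarith
    rw [integral_circle]
    exact h5
  have hlim : Filter.Tendsto (fun n : ℕ => ∫ x, Real.arctan (n * f x) * κ x) Filter.atTop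
      (nhds (∫ x, Real.pi / 2 * Real.sign (f x) * κ x)) := by
    refine tendsto_integral_of_dominated_convergence (fun x => Real.pi / 2 * |κ x|) ?_
      (hκ.abs.const_mul _) ?_ ?_
    · exact fun n => ((Real.continuous_arctan.comp
        (continuous_const.mul hfc)).aestronglyMeasurable).mul hκ.1
    · refine fun n => Filter.Eventually.of_forall fun x => ?_
      rw [norm_mul, Real.norm_eq_abs, Real.norm_eq_abs]
      gcongr
      rw [abs_le]
      exact ⟨(Real.neg_pi_div_two_lt_arctan _).le, (Real.arctan_lt_pi_div_two _).le⟩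
    · exact Filter.Eventually.of_forall fun x => (tendsto_arctan_mul_sign _).mul_const _
  have h1 := le_of_tendsto' hlim hn
  simp only [mul_assoc] at h1
  rw [integral_const_mul] at h1
  have := Real.pi_pos
  by_contra h2
  have h3 : 0 < Real.pi / 2 * ∫ x, Real.sign (f x) * κ x := mul_pos (by positivity) (not_le.mp h2)
  linarith

lemma sign_log_sub_log {a b : ℝ} (ha : 0 < a) (hb : 0 < b) :
    Real.sign (Real.log a - Real.log b) = Real.sign (a - b) := by
  rcases lt_trichotomy a b with h | h | h
  · rw [Real.sign_of_neg (by linarith [Real.log_lt_log ha h]), Real.sign_of_neg (by linarith)]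
  · rw [h, sub_self, sub_self]
  · rw [Real.sign_of_pos (by linarith [Real.log_lt_log hb h]), Real.sign_of_pos (by linarith)]

lemma hasPrim_log {f p : S1 → ℝ} (hpos : ∀ x, 0 < f x) (h : HasPrim (lift f) (lift p)) :
    HasPrim (lift fun x => Real.log (f x)) (lift fun x => p x / f x) := by
  have h1 := h.comp (s := Ioi 0) (fun x => hpos _) (Φ := Real.log) (Φ' := fun y => y⁻¹)
    (fun y (hy : 0 < y) => Real.hasDerivAt_log hy.ne')
    (fun y (hy : 0 < y) => (continuousAt_inv₀ hy.ne').continuousWithinAt)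
  have e : (fun x => (lift f x)⁻¹ * lift p x) = lift fun x => p x / f x := by
    ext x; simp only [lift]; ring
  rwa [e] at h1

/-- Solutions are unique: the flow is a contraction in `L¹`, because the sign of `u₁ - u₂` is the
sign of `log u₁ - log u₂` and the flux is a monotone function of the derivative of the logarithm. -/
lemma IsSolution.eq {T : ℝ} (hT : 0 < T) {u₀ : S1 → ℝ} {u₁ u₂ : ℝ → S1 → ℝ}
    (h₁ : IsSolution T u₀ u₁) (h₂ : IsSolution T u₀ u₂) {t : ℝ} (ht : t ∈ Icc 0 T) :
    u₁ t = u₂ t := by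
  obtain ⟨ν₁, hi₁, hf₁, hu₁⟩ := h₁.exists_velocity hT
  obtain ⟨ν₂, hi₂, hf₂, hu₂⟩ := h₂.exists_velocity hT
  set θ : ℝ → S1 → ℝ := fun s x => ν₁ s x - ν₂ s x with hθ
  have hθi : Integrable (Function.uncurry θ) (spaceTime T) := hi₁.sub hi₂
  -- the spatial inequality at almost every time
  have hspace : ∀ᵐ s ∂(volume.restrict (Ioc 0 T)),
      ∫ x, Real.sign (u₁ s x - u₂ s x) * θ s x ≤ 0 := by
    filter_upwards [hf₁, hf₂, ae_restrict_mem measurableSet_Ioc] with s ⟨p₁, a₁, b₁⟩ ⟨p₂, a₂, b₂⟩ hs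
    have hs' : s ∈ Icc 0 T := ⟨hs.1.le, hs.2⟩
    have hp₁ := h₁.pos s hs'
    have hp₂ := h₂.pos s hs'
    have key := integral_sign_mul_nonpos
      (f := fun x => Real.log (u₁ s x) - Real.log (u₂ s x))
      (f' := fun x => p₁ x / u₁ s x - p₂ x / u₂ s x)
      (k := fun x => Real.arctan (p₁ x / u₁ s x) - Real.arctan (p₂ x / u₂ s x))
      (κ := θ s) ((hasPrim_log hp₁ a₁).sub (hasPrim_log hp₂ a₂)) (b₁.sub b₂) (fun x => by
        rcases le_total (p₁ x / u₁ s x) (p₂ x / u₂ s x) with h | h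
        · exact mul_nonneg_of_nonpos_of_nonpos
            (sub_nonpos.mpr (Real.arctan_strictMono.monotone h)) (sub_nonpos.mpr h)
        · exact mul_nonneg (sub_nonneg.mpr (Real.arctan_strictMono.monotone h))
            (sub_nonneg.mpr h))
    simpa only [sign_log_sub_log (hp₁ _) (hp₂ _)] using key
  -- the chain rule in time at almost every point
  have htime : ∀ᵐ x, |u₁ t x - u₂ t x| =
      ∫ s in (0 : ℝ)..t, Real.sign (u₁ s x - u₂ s x) * θ s x := by
    have hint : ∀ᵐ x, Integrable (fun s => ν₁ s x) (volume.restrict (Ioc 0 T)) ∧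
        Integrable (fun s => ν₂ s x) (volume.restrict (Ioc 0 T)) := by
      have k1 := hi₁
      have k2 := hi₂
      rw [spaceTime_eq] at k1 k2
      exact k1.prod_left_ae.and k2.prod_left_ae
    filter_upwards [hu₁, hu₂, hint] with x e1 e2 ⟨i1, i2⟩
    set g : ℝ → ℝ := (Ioc 0 T).indicator fun s => θ s x with hg
    have hgi : ∀ a b, IntervalIntegrable g volume a b := fun a b =>
      (((integrable_indicator_iff measurableSet_Ioc).mpr (i1.sub i2)).intervalIntegrable)
    have hP : HasPrim (fun τ => ∫ s in (0 : ℝ)..τ, g s) g :=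
      HasPrim.of_eq_add hgi 0 fun τ => by simp
    have hd : ∀ τ ∈ Icc 0 T, ∫ s in (0 : ℝ)..τ, g s = u₁ τ x - u₂ τ x := by
      intro τ hτ
      rw [e1 τ hτ, e2 τ hτ, add_sub_add_left_eq_sub, ← intervalIntegral.integral_sub]
      · refine intervalIntegral.integral_congr_ae (Filter.Eventually.of_forall fun s hs => ?_)
        rw [uIoc_of_le hτ.1] at hs
        have hs' : s ∈ Ioc 0 T := ⟨hs.1, hs.2.trans hτ.2⟩
        rw [hg, indicator_of_mem hs']
      all_goals
        rw [intervalIntegrable_iff_integrableOn_Ioc_of_le hτ.1]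
      · exact IntegrableOn.mono_set i1 (Ioc_subset_Ioc_right hτ.2)
      · exact IntegrableOn.mono_set i2 (Ioc_subset_Ioc_right hτ.2)
    have h3 := hP.abs.sub_eq 0 t
    simp only [intervalIntegral.integral_same, abs_zero, sub_zero] at h3
    rw [hd t ht] at h3
    rw [h3]
    refine intervalIntegral.integral_congr_ae (Filter.Eventually.of_forall fun s hs => ?_)
    rw [uIoc_of_le ht.1] at hs
    have hs' : s ∈ Ioc 0 T := ⟨hs.1, hs.2.trans ht.2⟩
    rw [hd s ⟨hs'.1.le, hs'.2⟩, hg, indicator_of_mem hs']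
  have hc₁ := h₁.continuous_slice ht
  have hc₂ := h₂.continuous_slice ht
  have hFi : Integrable (Function.uncurry fun s x => Real.sign (u₁ s x - u₂ s x) * θ s x)
      ((volume.restrict (Ioc 0 t)).prod volume) := by
    refine Integrable.mono_measure ?_ (restrict_Ioc_prod_le ht.2)
    refine hθi.bdd_mul (c := 1) ?_ (Filter.Eventually.of_forall fun z => abs_sign_le _)
    have a1 := h₁.memL2H2.1.1.aemeasurable
    have a2 := h₂.memL2H2.1.1.aemeasurable
    exact (measurable_sign.comp_aemeasurable (a1.sub a2)).aestronglyMeasurable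
  have hle : ∫ x, |u₁ t x - u₂ t x| ≤ 0 := by
    rw [integral_congr_ae htime]
    simp only [intervalIntegral.integral_of_le ht.1]
    rw [integral_integral_swap (f := fun x s => Real.sign (u₁ s x - u₂ s x) * θ s x) hFi.swap]
    refine integral_nonpos_of_ae ?_
    exact ae_restrict_of_ae_restrict_of_subset (Ioc_subset_Ioc_right ht.2) hspace
  have hcd : Continuous fun x => |u₁ t x - u₂ t x| := (hc₁.sub hc₂).abs
  have h0 := (integral_eq_zero_iff_of_nonneg (fun x => abs_nonneg (u₁ t x - u₂ t x))
    (integrable_of_continuous hcd)).mp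
    (le_antisymm hle (integral_nonneg fun x => abs_nonneg _))
  have h1 := (Continuous.ae_eq_iff_eq volume hcd continuous_zero).mp h0
  ext x
  have := congrFun h1 x
  simp only [Pi.zero_apply, abs_eq_zero] at this
  linarith

/-! ### Step functions on the grid -/

/-- The mesh of the grid with `n + 1` points on the circle. -/
def mesh (n : ℕ) : ℝ := 2 * Real.pi / (n + 1)

lemma mesh_pos (n : ℕ) : 0 < mesh n := by unfold mesh; positivity

lemma mul_mesh (n : ℕ) : ((n + 1 : ℕ) : ℝ) * mesh n = 2 * Real.pi := by
  unfold mesh; push_cast; field_simp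

lemma tendsto_mesh : Filter.Tendsto mesh Filter.atTop (nhds 0) := by
  have := (tendsto_one_div_add_atTop_nhds_zero_nat (𝕜 := ℝ)).const_mul (2 * Real.pi)
  rw [mul_zero] at this
  exact this.congr fun n => by rw [mesh]; ring

/-- The step function on the line attached to a function on the grid. -/
def step (n : ℕ) (f : ZMod (n + 1) → ℝ) (x : ℝ) : ℝ := f ((⌊x / mesh n⌋ : ℤ) : ZMod (n + 1))

lemma floor_add_period (n : ℕ) (x : ℝ) :
    ⌊(x + 2 * Real.pi) / mesh n⌋ = ⌊x / mesh n⌋ + ((n + 1 : ℕ) : ℤ) := by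
  have h := mesh_pos n
  rw [← mul_mesh n, add_div, mul_div_assoc, div_self h.ne', mul_one]
  exact_mod_cast Int.floor_add_natCast (x / mesh n) (n + 1)

lemma step_periodic (n : ℕ) (f : ZMod (n + 1) → ℝ) :
    Function.Periodic (step n f) (2 * Real.pi) := fun x => by
  rw [step, step, floor_add_period]
  simp only [Int.cast_add, Int.cast_natCast, ZMod.natCast_self, add_zero]

lemma measurable_step (n : ℕ) (f : ZMod (n + 1) → ℝ) : Measurable (step n f) :=
  (measurable_of_countable fun k : ℤ => f (k : ZMod (n + 1))).comp
    (Int.measurable_floor.comp (measurable_id.div_const _))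

lemma intervalIntegrable_step (n : ℕ) (f : ZMod (n + 1) → ℝ) (a b : ℝ) :
    IntervalIntegrable (step n f) volume a b := by
  obtain ⟨C, hC⟩ := (Set.finite_range fun i => |f i|).bddAbove
  have h1 : IntervalIntegrable (fun _ : ℝ => C) volume a b := intervalIntegrable_const
  exact h1.mono_fun' (measurable_step n f).aestronglyMeasurable
    (Filter.Eventually.of_forall fun x => hC ⟨_, rfl⟩)

lemma sum_range_grid (n : ℕ) (f : ZMod (n + 1) → ℝ) :
    ∑ k ∈ Finset.range (n + 1), f (k : ZMod (n + 1)) = ∑ i, f i := by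
  have h1 := Fin.sum_univ_eq_sum_range (fun k => f (k : ZMod (n + 1))) (n + 1)
  rw [← h1]
  exact Finset.sum_congr rfl fun i _ => congrArg f (ZMod.natCast_zmod_val (n := n + 1) i)

lemma integral_step (n : ℕ) (f : ZMod (n + 1) → ℝ) :
    ∫ x in (0 : ℝ)..(2 * Real.pi), step n f x = mesh n * ∑ i, f i := by
  have h := mesh_pos n
  have h1 := intervalIntegral.sum_integral_adjacent_intervals (μ := volume) (f := step n f)
    (a := fun k : ℕ => (k : ℝ) * mesh n) (n := n + 1)
    (fun k _ => intervalIntegrable_step n f _ _)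
  rw [mul_mesh, Nat.cast_zero, zero_mul] at h1
  rw [← h1, ← sum_range_grid, Finset.mul_sum]
  refine Finset.sum_congr rfl fun k _ => ?_
  have h2 : ∫ x in ((k : ℝ) * mesh n)..(((k + 1 : ℕ) : ℝ) * mesh n), step n f x =
      ∫ _ in ((k : ℝ) * mesh n)..(((k + 1 : ℕ) : ℝ) * mesh n), f (k : ZMod (n + 1)) := by
    refine intervalIntegral.integral_congr_ae ?_
    have h3 : ∀ᵐ x : ℝ, x ≠ ((k + 1 : ℕ) : ℝ) * mesh n := by simp [ae_iff, measure_singleton]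
    filter_upwards [h3] with x hx hx'
    rw [uIoc_of_le (by push_cast; nlinarith)] at hx'
    have h4 : ⌊x / mesh n⌋ = (k : ℤ) := by
      rw [Int.floor_eq_iff]
      constructor
      · rw [le_div_iff₀ h]; exact_mod_cast hx'.1.le
      · rw [div_lt_iff₀ h]
        have := lt_of_le_of_ne hx'.2 hx
        push_cast at this ⊢
        exact this
    rw [step, h4, Int.cast_natCast]
  rw [h2, intervalIntegral.integral_const, smul_eq_mul]
  push_cast
  ring

/-- Riemann sums of products are close to the integral of the product of the limits. -/
lemma abs_sum_sub_integral_le (n : ℕ) (f g : ZMod (n + 1) → ℝ) {F G : ℝ → ℝ}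
    (hF : Continuous F) (hG : Continuous G) {a b C D : ℝ} (hf : ∀ x, |step n f x - F x| ≤ a)
    (hg : ∀ x, |step n g x - G x| ≤ b) (hC : ∀ i, |f i| ≤ C) (hD : ∀ x, |G x| ≤ D) :
    |mesh n * ∑ i, f i * g i - ∫ x in (0 : ℝ)..(2 * Real.pi), F x * G x| ≤
      (a * D + C * b) * (2 * Real.pi) := by
  have ha : 0 ≤ a := (abs_nonneg _).trans (hf 0)
  have hC0 : 0 ≤ C := (abs_nonneg _).trans (hC 0)
  rw [← integral_step n (fun i => f i * g i), ← intervalIntegral.integral_sub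
    (intervalIntegrable_step _ _ _ _) ((hF.fun_mul hG).intervalIntegrable _ _)]
  have h1 := intervalIntegral.norm_integral_le_of_norm_le_const (a := 0) (b := 2 * Real.pi)
    (C := a * D + C * b) (f := fun x => step n (fun i => f i * g i) x - F x * G x) fun x _ => by
    have e : step n (fun i => f i * g i) x - F x * G x =
      (step n f x - F x) * G x + step n f x * (step n g x - G x) := by
      simp only [step]; ring
    rw [e]
    refine (abs_add_le _ _).trans ?_
    rw [abs_mul, abs_mul]
    have := hf x
    have := hg x
    have := hD x
    have : |step n f x| ≤ C := hC _
    gcongr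
  rwa [sub_zero, abs_of_pos Real.two_pi_pos] at h1

/-- Convergence of step functions to a function on the line, uniformly in the space variable. -/
def StepTendsto (l : Filter ℕ) (f : (n : ℕ) → ZMod (n + 1) → ℝ) (F : ℝ → ℝ) : Prop :=
  ∀ ε > 0, ∀ᶠ n in l, ∀ x, |step n (f n) x - F x| ≤ ε

lemma exists_bound_of_periodic {F : ℝ → ℝ} (hF : Continuous F)
    (hp : Function.Periodic F (2 * Real.pi)) : ∃ C, 0 < C ∧ ∀ x, |F x| ≤ C := by
  have h1 : Continuous (descend F) := continuous_of_lift (by rwa [lift_descend hp])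
  obtain ⟨C, hC0, hC⟩ := exists_bound_of_continuous h1
  refine ⟨C, hC0, fun x => ?_⟩
  have := hC (x : S1)
  rwa [show descend F (x : S1) = F x from congrFun (lift_descend hp) x] at this

lemma StepTendsto.tendsto_sum {l : Filter ℕ} {f g : (n : ℕ) → ZMod (n + 1) → ℝ} {F G : ℝ → ℝ}
    (hf : StepTendsto l f F) (hg : StepTendsto l g G) (hF : Continuous F) (hG : Continuous G)
    (hGp : Function.Periodic G (2 * Real.pi)) {C : ℝ} (hC : ∀ᶠ n in l, ∀ i, |f n i| ≤ C) :
    Filter.Tendsto (fun n => mesh n * ∑ i, f n i * g n i) l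
      (nhds (∫ x in (0 : ℝ)..(2 * Real.pi), F x * G x)) := by
  obtain ⟨D, hD0, hD⟩ := exists_bound_of_periodic hG hGp
  have hpi := Real.two_pi_pos
  rw [Metric.tendsto_nhds]
  intro ε hε
  set η := ε / (2 * (D + |C| + 1) * (2 * Real.pi)) with hη
  have hden : 0 < D + |C| + 1 := by positivity
  have hη0 : 0 < η := by positivity
  filter_upwards [hf η hη0, hg η hη0, hC] with n h1 h2 h3
  rw [Real.dist_eq]
  refine (abs_sum_sub_integral_le n (f n) (g n) hF hG h1 h2 h3 hD).trans_lt ?_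
  have h4 : C ≤ |C| := le_abs_self C
  have h5 : η * D + C * η ≤ η * (D + |C| + 1) := by nlinarith
  have h6 : η * (D + |C| + 1) * (2 * Real.pi) = ε / 2 := by rw [hη]; field_simp
  have h7 := mul_le_mul_of_nonneg_right h5 hpi.le
  linarith

/-- The grid points next to `x`. -/
lemma floor_mul_mesh (n : ℕ) (x : ℝ) :
    (⌊x / mesh n⌋ : ℝ) * mesh n ≤ x ∧ x < (⌊x / mesh n⌋ : ℝ) * mesh n + mesh n := by
  have h := mesh_pos n
  constructor
  · rw [← le_div_iff₀ h]; exact Int.floor_le _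
  · have := Int.lt_floor_add_one (x / mesh n)
    rw [div_lt_iff₀ h] at this
    linarith

lemma uniformContinuous_of_periodic {F : ℝ → ℝ} (hF : Continuous F)
    (hp : Function.Periodic F (2 * Real.pi)) {ε : ℝ} (hε : 0 < ε) :
    ∃ δ > 0, ∀ x y, |x - y| < δ → |F x - F y| < ε := by
  have hc : IsCompact (Icc (-1 : ℝ) (2 * Real.pi + 1)) := isCompact_Icc
  have hu := hc.uniformContinuousOn_of_continuous hF.continuousOn
  rw [Metric.uniformContinuousOn_iff] at hu
  obtain ⟨δ, hδ, h⟩ := hu ε hε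
  refine ⟨min δ 1, by positivity, fun x y hxy => ?_⟩
  obtain ⟨n, hn, -⟩ := existsUnique_add_zsmul_mem_Ico Real.two_pi_pos x 0
  rw [zero_add] at hn
  have h1 := abs_lt.mp (lt_of_lt_of_le hxy (min_le_right _ _))
  have h2 := h (x + n • (2 * Real.pi)) ⟨by linarith [hn.1], by linarith [hn.2]⟩
    (y + n • (2 * Real.pi)) ⟨by linarith [hn.1], by linarith [hn.2]⟩
    (by rw [Real.dist_eq, add_sub_add_right_eq_sub]; exact lt_of_lt_of_le hxy (min_le_left _ _))
  have e := fun x => hp.zsmul n x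
  rwa [e, e, Real.dist_eq] at h2

/-- Grid functions whose values are values of a continuous function at nearby points converge. -/
lemma stepTendsto_of_near {l : Filter ℕ} (hl : l ≤ Filter.atTop)
    {f : (n : ℕ) → ZMod (n + 1) → ℝ} {F : ℝ → ℝ} (hF : Continuous F)
    (hp : Function.Periodic F (2 * Real.pi))
    (h : ∀ n (k : ℤ), ∃ ξ, |ξ - k * mesh n| ≤ mesh n ∧ f n (k : ZMod (n + 1)) = F ξ) :
    StepTendsto l f F := by
  intro ε hε
  obtain ⟨δ, hδ, hu⟩ := uniformContinuous_of_periodic hF hp hε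
  have h1 : ∀ᶠ n in l, mesh n < δ / 2 :=
    (tendsto_mesh.mono_left hl).eventually (gt_mem_nhds (by positivity))
  filter_upwards [h1] with n hn x
  obtain ⟨ξ, h2, h3⟩ := h n ⌊x / mesh n⌋
  rw [step, h3]
  refine (hu _ _ ?_).le
  have h4 := floor_mul_mesh n x
  have h5 := abs_le.mp h2
  rw [abs_lt]
  constructor <;> linarith

/-- The values of a function on the circle at the grid points. -/
def sample (n : ℕ) (F : S1 → ℝ) (i : ZMod (n + 1)) : ℝ := lift F (i.val * mesh n)

lemma sample_intCast (n : ℕ) (F : S1 → ℝ) (k : ℤ) :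
    sample n F (k : ZMod (n + 1)) = lift F (k * mesh n) := by
  have h1 : (((k : ZMod (n + 1)).val : ℕ) : ℤ) = k % ((n + 1 : ℕ) : ℤ) := ZMod.val_intCast k
  have h2 : ((k : ZMod (n + 1)).val : ℝ) = ((k % ((n + 1 : ℕ) : ℤ) : ℤ) : ℝ) := by
    rw [← h1, Int.cast_natCast]
  have h3 : (k : ℝ) = ((k % ((n + 1 : ℕ) : ℤ) : ℤ) : ℝ) +
      ((k / ((n + 1 : ℕ) : ℤ) : ℤ) : ℝ) * ((n + 1 : ℕ) : ℝ) := by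
    have := Int.emod_add_mul_ediv k ((n + 1 : ℕ) : ℤ)
    have h4 := congrArg (fun z : ℤ => (z : ℝ)) this
    push_cast at h4 ⊢
    linarith
  have h5 := (lift_periodic F).zsmul (k / ((n + 1 : ℕ) : ℤ))
    (((k % ((n + 1 : ℕ) : ℤ) : ℤ) : ℝ) * mesh n)
  rw [zsmul_eq_mul, ← mul_mesh n, ← mul_assoc, ← add_mul, ← h3] at h5
  rw [sample, h2, h5]

lemma stepTendsto_sample {l : Filter ℕ} (hl : l ≤ Filter.atTop) {F : S1 → ℝ} (hF : Continuous F) :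
    StepTendsto l (fun n => sample n F) (lift F) :=
  stepTendsto_of_near hl (lift_continuous hF) (lift_periodic F) fun n k =>
    ⟨k * mesh n, by simp [(mesh_pos n).le], sample_intCast n F k⟩

lemma exists_slope_eq {F F' : ℝ → ℝ} (hF : ∀ x, HasDerivAt F (F' x) x) (x : ℝ) {h : ℝ}
    (hh : 0 < h) : ∃ ξ ∈ Icc x (x + h), (F (x + h) - F x) / h = F' ξ := by
  obtain ⟨ξ, h2, h3⟩ := exists_hasDerivAt_eq_slope F F' (by linarith : x < x + h)
    (fun x _ => (hF x).continuousAt.continuousWithinAt) fun x _ => hF x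
  exact ⟨ξ, Ioo_subset_Icc_self h2, by rw [h3, add_sub_cancel_left]⟩

lemma intCast_add_one_mul (k : ℤ) (h : ℝ) : ((k + 1 : ℤ) : ℝ) * h = k * h + h := by
  push_cast; ring

lemma stepTendsto_diff {l : Filter ℕ} (hl : l ≤ Filter.atTop) {φ : S1 → ℝ} (hφ : IsTest φ) :
    StepTendsto l (fun n i => (sample n φ (i + 1) - sample n φ i) / mesh n) (deriv (lift φ)) := by
  refine stepTendsto_of_near hl hφ.continuous_deriv
    (by rw [← lift_circleDeriv]; exact lift_periodic _) fun n k => ?_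
  obtain ⟨ξ, h1, h2⟩ := exists_slope_eq (fun x => hφ.hasPrim.hasDerivAt hφ.continuous_deriv x)
    (k * mesh n) (mesh_pos n)
  refine ⟨ξ, ?_, ?_⟩
  · rw [abs_le]
    constructor <;> linarith [mesh_pos n, h1.1, h1.2]
  · rw [← h2, ← intCast_add_one_mul, ← sample_intCast, ← sample_intCast]
    push_cast
    rfl

lemma stepTendsto_sample_shift {l : Filter ℕ} (hl : l ≤ Filter.atTop) {F : S1 → ℝ}
    (hF : Continuous F) : StepTendsto l (fun n i => sample n F (i + 1)) (lift F) :=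
  stepTendsto_of_near hl (lift_continuous hF) (lift_periodic F) fun n k =>
    ⟨((k + 1 : ℤ) : ℝ) * mesh n, by
      push_cast; rw [add_mul, one_mul, add_sub_cancel_left, abs_of_pos (mesh_pos n)], by
      rw [← sample_intCast]; push_cast; rfl⟩

/-- Uniform convergence passes through continuous functions. -/
lemma StepTendsto.comp {l : Filter ℕ} {f : (n : ℕ) → ZMod (n + 1) → ℝ} {F : ℝ → ℝ}
    (hf : StepTendsto l f F) {Φ : ℝ → ℝ} {a b : ℝ} (hΦ : ContinuousOn Φ (Icc a b))
    (hfa : ∀ᶠ n in l, ∀ i, f n i ∈ Icc a b) (hFa : ∀ x, F x ∈ Icc a b) :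
    StepTendsto l (fun n i => Φ (f n i)) (fun x => Φ (F x)) := by
  intro ε hε
  have hu := isCompact_Icc.uniformContinuousOn_of_continuous hΦ
  rw [Metric.uniformContinuousOn_iff] at hu
  obtain ⟨δ, hδ, h⟩ := hu ε hε
  filter_upwards [hf (δ / 2) (by positivity), hfa] with n h1 h2 x
  refine (h (step n (f n) x) (h2 _) (F x) (hFa x) ?_).le
  rw [Real.dist_eq]
  linarith [h1 x]

lemma StepTendsto.mul {l : Filter ℕ} {f g : (n : ℕ) → ZMod (n + 1) → ℝ} {F G : ℝ → ℝ}
    (hf : StepTendsto l f F) (hg : StepTendsto l g G) {C D : ℝ} (hC : ∀ᶠ n in l, ∀ i, |f n i| ≤ C)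
    (hD : ∀ x, |G x| ≤ D) : StepTendsto l (fun n i => f n i * g n i) (fun x => F x * G x) := by
  intro ε hε
  have hden : 0 < |D| + |C| + 1 := by positivity
  set η := ε / (|D| + |C| + 1) with hη
  have hη0 : 0 < η := by positivity
  filter_upwards [hf η hη0, hg η hη0, hC] with n h1 h2 h3 x
  have e : step n (fun i => f n i * g n i) x - F x * G x =
      (step n (f n) x - F x) * G x + step n (f n) x * (step n (g n) x - G x) := by
      simp only [step]; ring
  rw [e]
  refine (abs_add_le _ _).trans ?_
  rw [abs_mul, abs_mul]
  have := h1 x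
  have := h2 x
  have : |G x| ≤ |D| := (hD x).trans (le_abs_self _)
  have : |step n (f n) x| ≤ |C| := (h3 _).trans (le_abs_self _)
  calc _ ≤ η * |D| + |C| * η := by gcongr
    _ ≤ η * (|D| + |C| + 1) := by linarith
    _ = ε := by rw [hη]; field_simp

/-! ### Compactness -/

/-- The projection of the line onto `[0, T]`. It extends functions of `t ∈ [0, T]` to the line. -/
def clip (T t : ℝ) : ℝ := max 0 (min T t)

lemma clip_mem {T : ℝ} (hT : 0 ≤ T) (t : ℝ) : clip T t ∈ Icc 0 T :=
  ⟨le_max_left _ _, max_le hT (min_le_left _ _)⟩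

lemma clip_of_mem {T t : ℝ} (ht : t ∈ Icc 0 T) : clip T t = t := by
  rw [clip, min_eq_right ht.2, max_eq_right ht.1]

lemma abs_clip_sub_le (T t s : ℝ) : |clip T t - clip T s| ≤ |t - s| := by
  have h1 : |max 0 (min T t) - max 0 (min T s)| ≤ |min T t - min T s| := by
    rw [max_comm 0, max_comm 0]
    exact abs_max_sub_max_le_abs _ _ _
  have h2 : |min T t - min T s| ≤ |t - s| :=
    (abs_min_sub_min_le_max T t T s).trans (by simp)
  exact h1.trans h2

/-- A version of the Arzelà-Ascoli theorem for functions which need not be continuous, but whose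
oscillation at small scale vanishes in the limit. The limit is taken along an ultrafilter, which
replaces the choice of a subsequence. -/
lemma exists_uniform_limit {T : ℝ} (hT : 0 ≤ T) (l : Ultrafilter ℕ)
    (f : ℕ → ℝ → ℝ → ℝ) {C : ℝ} (hper : ∀ n t, Function.Periodic (f n t) (2 * Real.pi))
    (hC : ∀ᶠ n in (l : Filter ℕ), ∀ t ∈ Icc 0 T, ∀ x, f n t x ∈ Icc (-C) C)
    (heq : ∀ ε > 0, ∃ δ > 0, ∀ᶠ n in (l : Filter ℕ), ∀ t ∈ Icc 0 T, ∀ s ∈ Icc 0 T, ∀ x y,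
      |t - s| < δ → |x - y| < δ → |f n t x - f n s y| ≤ ε) :
    ∃ F : ℝ → ℝ → ℝ, Continuous (Function.uncurry F) ∧
      (∀ t, Function.Periodic (F t) (2 * Real.pi)) ∧
      ∀ ε > 0, ∀ᶠ n in (l : Filter ℕ), ∀ t ∈ Icc 0 T, ∀ x, |f n t x - F t x| ≤ ε := by
  have hlim : ∀ t x, ∃ y, Filter.Tendsto (fun n => f n (clip T t) x) l (nhds y) := by
    intro t x
    obtain ⟨y, -, hy⟩ := isCompact_Icc.ultrafilter_le_nhds' (l.map fun n => f n (clip T t) x)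
      (s := Icc (-C) C) (by
        change ∀ᶠ n in (l : Filter ℕ), f n (clip T t) x ∈ Icc (-C) C
        filter_upwards [hC] with n hn using hn _ (clip_mem hT t) x)
    exact ⟨y, hy⟩
  choose F hF using hlim
  have hFper : ∀ t, Function.Periodic (F t) (2 * Real.pi) := fun t x => by
    have h1 := hF t (x + 2 * Real.pi)
    simp only [hper _ _ x] at h1
    exact tendsto_nhds_unique h1 (hF t x)
  have hmod : ∀ ε > 0, ∃ δ > 0, ∀ t s x y, |t - s| < δ → |x - y| < δ → |F t x - F s y| ≤ ε := by
    intro ε hε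
    obtain ⟨δ, hδ, h⟩ := heq ε hε
    refine ⟨δ, hδ, fun t s x y h1 h2 => ?_⟩
    refine le_of_tendsto ((hF t x).sub (hF s y)).abs ?_
    filter_upwards [h] with n hn
    exact hn _ (clip_mem hT t) _ (clip_mem hT s) x y ((abs_clip_sub_le T t s).trans_lt h1) h2
  refine ⟨F, ?_, hFper, fun ε hε => ?_⟩
  · rw [Metric.continuous_iff]
    intro z ε hε
    obtain ⟨δ, hδ, h⟩ := hmod (ε / 2) (by positivity)
    refine ⟨δ, hδ, fun z' hz' => ?_⟩
    rw [Prod.dist_eq, max_lt_iff, Real.dist_eq, Real.dist_eq] at hz'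
    rw [Real.dist_eq]
    exact (h _ _ _ _ hz'.1 hz'.2).trans_lt (by linarith)
  · obtain ⟨δ₁, hδ₁, h₁⟩ := heq (ε / 3) (by positivity)
    obtain ⟨δ₂, hδ₂, h₂⟩ := hmod (ε / 3) (by positivity)
    set δ := min δ₁ δ₂ with hδ
    have hδ0 : 0 < δ := lt_min hδ₁ hδ₂
    have hK : IsCompact (Icc 0 T ×ˢ Icc (0 : ℝ) (2 * Real.pi)) := isCompact_Icc.prod isCompact_Icc
    obtain ⟨S, hS, hfin, hcov⟩ := hK.finite_cover_balls hδ0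
    have hnet : ∀ᶠ n in (l : Filter ℕ), ∀ z ∈ S, |f n z.1 z.2 - F z.1 z.2| ≤ ε / 3 := by
      rw [Filter.eventually_all_finite hfin]
      intro z hz
      have h3 := hF z.1 z.2
      rw [clip_of_mem (hS hz).1, Metric.tendsto_nhds] at h3
      filter_upwards [h3 (ε / 3) (by positivity)] with n hn
      exact hn.le
    filter_upwards [hnet, h₁] with n hn1 hn2 t ht x
    obtain ⟨k, hk, -⟩ := existsUnique_add_zsmul_mem_Ico Real.two_pi_pos x 0
    rw [zero_add] at hk
    have e1 : f n t (x + k • (2 * Real.pi)) = f n t x := (hper n t).zsmul k x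
    have e2 : F t (x + k • (2 * Real.pi)) = F t x := (hFper t).zsmul k x
    rw [← e1, ← e2]
    set x' := x + k • (2 * Real.pi)
    have hmem : (t, x') ∈ ⋃ z ∈ S, Metric.ball z δ := hcov ⟨ht, hk.1, hk.2.le⟩
    simp only [mem_iUnion] at hmem
    obtain ⟨z, hz, hball⟩ := hmem
    rw [Metric.mem_ball, Prod.dist_eq, max_lt_iff, Real.dist_eq, Real.dist_eq] at hball
    have b1 := hn2 t ht z.1 (hS hz).1 x' z.2 (hball.1.trans_le (min_le_left _ _))
      (hball.2.trans_le (min_le_left _ _))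
    have b2 := hn1 z hz
    have b3 := h₂ t z.1 x' z.2 (hball.1.trans_le (min_le_right _ _))
      (hball.2.trans_le (min_le_right _ _))
    rw [abs_le] at b1 b2 b3 ⊢
    constructor <;> linarith

/-- Bounded sequences in a Hilbert space have weak limits along ultrafilters. -/
lemma exists_weak_limit {H : Type*} [NormedAddCommGroup H] [InnerProductSpace ℝ H]
    [CompleteSpace H] (l : Ultrafilter ℕ) (a : ℕ → H) {C : ℝ}
    (hC : ∀ᶠ n in (l : Filter ℕ), ‖a n‖ ≤ C) :
    ∃ b : H, ∀ φ, Filter.Tendsto (fun n => inner ℝ (a n) φ) l (nhds (inner ℝ b φ)) := by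
  set A : ℕ → WeakDual ℝ H := fun n => StrongDual.toWeakDual (InnerProductSpace.toDual ℝ H (a n))
  obtain ⟨L, -, hL⟩ := (WeakDual.isCompact_closedBall (𝕜 := ℝ) (0 : StrongDual ℝ H) C
    ).ultrafilter_le_nhds' (l.map A) (by
      change ∀ᶠ n in (l : Filter ℕ), _
      filter_upwards [hC] with n hn
      simp only [A, mem_preimage, Metric.mem_closedBall, dist_zero_right]
      simpa using hn)
  refine ⟨(InnerProductSpace.toDual ℝ H).symm (WeakDual.toStrongDual L), fun φ => ?_⟩
  have h1 : Filter.Tendsto (fun n => A n φ) l (nhds (L φ)) :=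
    ((WeakDual.eval_continuous φ).tendsto L).comp hL
  rw [InnerProductSpace.toDual_symm_apply]
  exact h1

/-! ### Passage to the limit -/

/-- The limit object: lifts `U`, `W` of a solution and of its flux, with the bounds inherited from
the semi-discrete flow. `E` bounds the weighted energy. -/
structure LimitFlow (T μ E : ℝ) (u₀ : S1 → ℝ) (U W : ℝ → ℝ → ℝ) : Prop where
  continuous_U : Continuous (Function.uncurry U)
  continuous_W : Continuous (Function.uncurry W)
  periodic_U : ∀ t, Function.Periodic (U t) (2 * Real.pi)
  periodic_W : ∀ t, Function.Periodic (W t) (2 * Real.pi)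
  U_mem : ∀ t ∈ Icc 0 T, ∀ x, U t x ∈ Icc μ (2 * μ)
  W_mem : ∀ t ∈ Icc 0 T, ∀ x, W t x ∈ Icc (-(1 / 10000)) (1 / 10000)
  initial : U 0 = lift u₀
  hasPrim_U : ∀ t ∈ Icc 0 T, HasPrim (U t) (fun x => U t x * Real.tan (W t x))
  hasPrim_W : ∀ t ∈ Icc 0 T, ∃ G : S1 → ℝ, HasPrim (W t) (lift G) ∧ MemLp G 2 ∧
    ∫ x in (0 : ℝ)..(2 * Real.pi), lift G x ^ 2 * (U t x * (1 + Real.tan (W t x) ^ 2)) ≤ E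
  equation : ∀ φ : S1 → ℝ, IsTest φ → ∀ t ∈ Icc 0 T,
    (∫ x in (0 : ℝ)..(2 * Real.pi), U t x * lift φ x) -
      (∫ x in (0 : ℝ)..(2 * Real.pi), lift u₀ x * lift φ x) =
      -∫ s in (0 : ℝ)..t, ∫ x in (0 : ℝ)..(2 * Real.pi), W s x * deriv (lift φ) x

lemma exists_pos_forall_lt {θ : ℝ → ℝ} (hθ : Continuous θ) (h0 : θ 0 = 0) {ε : ℝ} (hε : 0 < ε) :
    ∃ δ > 0, ∀ r, |r| < δ → θ r < ε := by
  have h1 := hθ.tendsto 0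
  rw [h0, Metric.tendsto_nhds_nhds] at h1
  obtain ⟨δ, hδ, h⟩ := h1 ε hε
  refine ⟨δ, hδ, fun r hr => ?_⟩
  have := h (x := r) (by rwa [Real.dist_eq, sub_zero])
  rw [Real.dist_eq, sub_zero] at this
  exact (le_abs_self _).trans_lt this

/-- Moduli of continuity in space (up to the mesh) and in time give asymptotic equicontinuity. -/
lemma equicontinuous_of_sq_le {T : ℝ} {l : Filter ℕ} (hl : l ≤ Filter.atTop) {f : ℕ → ℝ → ℝ → ℝ}
    {θ₁ θ₂ : ℝ → ℝ} (hθ₁ : Continuous θ₁) (hθ₂ : Continuous θ₂) (h₁ : θ₁ 0 = 0) (h₂ : θ₂ 0 = 0)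
    (hx : ∀ᶠ n in l, ∀ t ∈ Icc 0 T, ∀ x y, x ≤ y → y - x < 1 →
      (f n t y - f n t x) ^ 2 ≤ θ₁ (y - x + mesh n))
    (ht : ∀ᶠ n in l, ∀ t ∈ Icc 0 T, ∀ s ∈ Icc 0 T, ∀ x, (f n t x - f n s x) ^ 2 ≤ θ₂ |t - s|) :
    ∀ ε > 0, ∃ δ > 0, ∀ᶠ n in l, ∀ t ∈ Icc 0 T, ∀ s ∈ Icc 0 T, ∀ x y,
      |t - s| < δ → |x - y| < δ → |f n t x - f n s y| ≤ ε := by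
  intro ε hε
  obtain ⟨δ₁, hδ₁, k₁⟩ := exists_pos_forall_lt hθ₁ h₁ (ε := (ε / 2) ^ 2) (by positivity)
  obtain ⟨δ₂, hδ₂, k₂⟩ := exists_pos_forall_lt hθ₂ h₂ (ε := (ε / 2) ^ 2) (by positivity)
  refine ⟨min (min (δ₁ / 2) δ₂) 1, by positivity, ?_⟩
  have hm : ∀ᶠ n in l, mesh n < δ₁ / 2 :=
    (tendsto_mesh.mono_left hl).eventually (gt_mem_nhds (by positivity))
  filter_upwards [hx, ht, hm] with n n1 n2 n3 t htm s hsm x y hts hxy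
  have hxy1 := lt_of_lt_of_le hxy (min_le_right _ _)
  have hxy2 := lt_of_lt_of_le hxy ((min_le_left _ _).trans (min_le_left _ _))
  have hts2 := lt_of_lt_of_le hts ((min_le_left _ _).trans (min_le_right _ _))
  have b2 : |f n t y - f n s y| ≤ ε / 2 := by
    refine abs_le_of_sq_le_sq ((n2 t htm s hsm y).trans (k₂ _ ?_).le) (by positivity)
    rwa [abs_abs]
  have b1 : |f n t x - f n t y| ≤ ε / 2 := by
    refine abs_le_of_sq_le_sq ?_ (by positivity)
    have hmp := mesh_pos n
    rcases le_total x y with h | h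
    · rw [abs_sub_comm, abs_of_nonneg (by linarith)] at hxy1 hxy2
      have := n1 t htm x y h hxy1
      rw [← neg_sub, neg_sq]
      refine this.trans (k₁ _ ?_).le
      rw [abs_of_pos (by linarith)]
      linarith
    · rw [abs_of_nonneg (by linarith)] at hxy1 hxy2
      refine (n1 t htm y x h hxy1).trans (k₁ _ ?_).le
      rw [abs_of_pos (by linarith)]
      linarith
  have := abs_sub_le (f n t x) (f n t y) (f n s y)
  linarith

/-- The index of the grid cell of `y ≥ x` relative to that of `x`. -/
lemma exists_index_shift (n : ℕ) {x y : ℝ} (hxy : x ≤ y) :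
    ∃ k : ℕ, ((⌊y / mesh n⌋ : ℤ) : ZMod (n + 1)) = ((⌊x / mesh n⌋ : ℤ) : ZMod (n + 1)) + k ∧
      (k : ℝ) * mesh n ≤ y - x + mesh n := by
  have h := mesh_pos n
  have h1 : ⌊x / mesh n⌋ ≤ ⌊y / mesh n⌋ := Int.floor_le_floor (by gcongr)
  obtain ⟨k, hk⟩ := Int.eq_ofNat_of_zero_le (sub_nonneg.mpr h1)
  have hk' : ⌊y / mesh n⌋ = ⌊x / mesh n⌋ + k := by linarith
  refine ⟨k, by rw [hk']; push_cast; rfl, ?_⟩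
  have h2 := (floor_mul_mesh n y).1
  have h3 := (floor_mul_mesh n x).2
  rw [hk'] at h2
  push_cast at h2
  linarith

/-- The limit of a discrete derivative is the derivative of the limit. -/
lemma hasPrim_of_grid {l : Filter ℕ} [l.NeBot] (hl : l ≤ Filter.atTop)
    {f g : (n : ℕ) → ZMod (n + 1) → ℝ}
    {F G : ℝ → ℝ} (hfg : ∀ n i, mesh n * g n i = f n (i + 1) - f n i) (hf : StepTendsto l f F)
    (hg : StepTendsto l g G) (hF : Continuous F) (hG : Continuous G)
    (hFp : Function.Periodic F (2 * Real.pi)) (hGp : Function.Periodic G (2 * Real.pi))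
    {C D : ℝ} (hC : ∀ᶠ n in l, ∀ i, |f n i| ≤ C) (hD : ∀ᶠ n in l, ∀ i, |g n i| ≤ D) :
    HasPrim F G := by
  have hFc : Continuous (descend F) := continuous_of_lift (by rwa [lift_descend hFp])
  have hGc : Continuous (descend G) := continuous_of_lift (by rwa [lift_descend hGp])
  have hw : HasWeakDeriv (descend F) (descend G) := by
    refine ⟨integrable_of_continuous hFc, integrable_of_continuous hGc, fun φ hφ => ?_⟩
    have h1 := hf.tendsto_sum (stepTendsto_diff hl hφ) hF hφ.continuous_deriv
      (by rw [← lift_circleDeriv]; exact lift_periodic _) hC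
    have h2 := (hg.tendsto_sum (stepTendsto_sample_shift hl hφ.continuous) hG
      (lift_continuous hφ.continuous) (lift_periodic φ) hD).neg
    have e : ∀ n, mesh n * ∑ i, f n i * ((sample n φ (i + 1) - sample n φ i) / mesh n) =
        -(mesh n * ∑ i, g n i * sample n φ (i + 1)) := by
      intro n
      have hm := (mesh_pos n).ne'
      have s1 := sum_by_parts (fun i => f n i) (fun i => sample n φ (i + 1))
      simp only [sub_add_cancel] at s1
      rw [Finset.mul_sum, Finset.mul_sum]
      have e1 : ∀ i, mesh n * (f n i * ((sample n φ (i + 1) - sample n φ i) / mesh n)) =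
        f n i * (sample n φ (i + 1) - sample n φ i) := fun i => by field_simp
      have e2 : ∀ i, mesh n * (g n i * sample n φ (i + 1)) =
        sample n φ (i + 1) * (f n (i + 1) - f n i) := fun i => by rw [← hfg]; ring
      simp only [e1, e2, s1]
    simp only [e] at h1
    have h3 := tendsto_nhds_unique h1 h2
    rw [integral_circle, integral_circle]
    have e3 : ∀ x, lift (fun x => descend F x * circleDeriv φ x) x = F x * deriv (lift φ) x :=
      fun x => by
        simp only [lift, circleDeriv_coe]
        exact congrArg (· * _) (congrFun (lift_descend hFp) x)
    have e4 : ∀ x, lift (fun x => descend G x * φ x) x = G x * lift φ x :=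
      fun x => congrArg (· * _) (congrFun (lift_descend hGp) x)
    simp only [e3, e4]
    exact h3
  have := hw.hasPrim_of_continuous hFc
  rwa [lift_descend hFp, lift_descend hGp] at this

lemma memLp_step (n : ℕ) (f : ZMod (n + 1) → ℝ) : MemLp (step n f) 2 period := by
  obtain ⟨C, hC⟩ := (Set.finite_range fun i => |f i|).bddAbove
  exact MemLp.of_bound (measurable_step n f).aestronglyMeasurable C
    (Filter.Eventually.of_forall fun x => hC ⟨_, rfl⟩)

lemma integral_step' (n : ℕ) (f : ZMod (n + 1) → ℝ) :
    ∫ x, step n f x ∂period = mesh n * ∑ i, f i := by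
  rw [← integral_step, intervalIntegral.integral_of_le Real.two_pi_pos.le]

/-- Step functions bounded in `L²` have weak limits. -/
lemma exists_weak_limit_step (l : Ultrafilter ℕ) (f : (n : ℕ) → ZMod (n + 1) → ℝ) {C : ℝ}
    (hC : ∀ᶠ n in (l : Filter ℕ), mesh n * ∑ i, f n i ^ 2 ≤ C) :
    ∃ G : S1 → ℝ, MemLp G 2 ∧ ∀ φ : ℝ → ℝ, MemLp φ 2 period →
      Filter.Tendsto (fun n => ∫ x, step n (f n) x * φ x ∂period) l
        (nhds (∫ x, lift G x * φ x ∂period)) := by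
  have hinner : ∀ (a b : ℝ → ℝ) (ha : MemLp a 2 period) (hb : MemLp b 2 period),
      inner ℝ (ha.toLp a) (hb.toLp b) = ∫ x, a x * b x ∂period := by
    intro a b ha hb
    rw [L2.inner_def]
    refine integral_congr_ae ?_
    filter_upwards [ha.coeFn_toLp, hb.coeFn_toLp] with x h1 h2
    rw [h1, h2]
    simp [mul_comm]
  obtain ⟨b, hb⟩ := exists_weak_limit l (fun n => (memLp_step n (f n)).toLp (step n (f n)))
    (C := √C) (by
      filter_upwards [hC] with n hn
      refine (le_abs_self _).trans (Real.abs_le_sqrt ?_)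
      rw [← real_inner_self_eq_norm_sq, hinner]
      refine le_trans (le_of_eq ?_) hn
      rw [← integral_step']
      simp only [step, sq])
  have hbm : MemLp b 2 period := Lp.memLp b
  have hlift : lift (descend b) =ᵐ[period] b := by
    filter_upwards [ae_restrict_mem measurableSet_Ioc] with x hx
    exact AddCircle.liftIoc_coe_apply (by rwa [zero_add])
  refine ⟨descend b, memLp_lift_iff.mp (hbm.ae_eq hlift.symm), fun φ hφ => ?_⟩
  have h1 := hb (hφ.toLp φ)
  have h2 : inner ℝ b (hφ.toLp φ) = ∫ x, lift (descend b) x * φ x ∂period := by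
    have e : b = hbm.toLp b := (Lp.toLp_coeFn b hbm).symm
    rw [e, hinner]
    refine integral_congr_ae ?_
    filter_upwards [hlift, hbm.coeFn_toLp] with x h3 h4
    rw [← e, h3]
  simp only [hinner, h2] at h1
  exact h1

/-- Semi-discrete flows on finer and finer grids, started from the values of `u₀`, which converge
with their fluxes to `U` and `W` along an ultrafilter. -/
structure GridLimit (l : Ultrafilter ℕ) (T μ E : ℝ) (u₀ : S1 → ℝ)
    (v : (n : ℕ) → ℝ → ZMod (n + 1) → ℝ) (U W : ℝ → ℝ → ℝ) : Prop where
  le_atTop : (l : Filter ℕ) ≤ Filter.atTop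
  continuous_initial : Continuous u₀
  flow : ∀ n, GridFlow (mesh n) μ T (v n)
  v_zero : ∀ n, v n 0 = sample n u₀
  energy : ∀ η > 0, ∀ᶠ n in (l : Filter ℕ), gridEnergy (mesh n) (v n 0) ≤ E + η
  continuous_U : Continuous (Function.uncurry U)
  continuous_W : Continuous (Function.uncurry W)
  periodic_U : ∀ t, Function.Periodic (U t) (2 * Real.pi)
  periodic_W : ∀ t, Function.Periodic (W t) (2 * Real.pi)
  lim_U : ∀ ε > 0, ∀ᶠ n in (l : Filter ℕ), ∀ t ∈ Icc 0 T, ∀ x, |step n (v n t) x - U t x| ≤ ε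
  lim_W : ∀ ε > 0, ∀ᶠ n in (l : Filter ℕ), ∀ t ∈ Icc 0 T, ∀ x,
    |step n (gridFlux (mesh n) (v n t)) x - W t x| ≤ ε

lemma GridFlow.flux_mem {N : ℕ} [NeZero N] {h μ T : ℝ} {u : ℝ → ZMod N → ℝ}
    (F : GridFlow h μ T u) {t : ℝ} (ht : t ∈ Icc 0 T) (i : ZMod N) :
    gridFlux h (u t) i ∈ Icc (-(1 / 10000)) (1 / 10000) :=
  abs_le.mp ((abs_arctan_le _).trans (F.slope_le t ht i))

/-- Compactness: the Hölder bounds of the semi-discrete flows depend on the mesh only through the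
initial energy. -/
lemma exists_gridLimit {T μ E : ℝ} {u₀ : S1 → ℝ} (hu₀ : Continuous u₀)
    {v : (n : ℕ) → ℝ → ZMod (n + 1) → ℝ} (hv : ∀ n, GridFlow (mesh n) μ T (v n))
    (hv0 : ∀ n, v n 0 = sample n u₀)
    (hE : ∀ η > 0, ∀ᶠ n in Filter.atTop, gridEnergy (mesh n) (v n 0) ≤ E + η) :
    ∃ (l : Ultrafilter ℕ) (U W : ℝ → ℝ → ℝ), GridLimit l T μ E u₀ v U W := by
  set l : Ultrafilter ℕ := Ultrafilter.of Filter.atTop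
  have hl : (l : Filter ℕ) ≤ Filter.atTop := Ultrafilter.of_le _
  have hT : 0 < T := (hv 0).T_pos
  have hμ : 0 < μ := (hv 0).μ_pos
  have hN : ∀ n : ℕ, 1 ≤ ((n + 1 : ℕ) : ℝ) * mesh n := fun n => by
    rw [mul_mesh]; linarith [Real.pi_gt_three]
  have hK : ∀ᶠ n in (l : Filter ℕ), gridEnergy (mesh n) (v n 0) ≤ E + 1 := hl (hE 1 one_pos)
  have hm : ∀ᶠ n in (l : Filter ℕ), mesh n < 1 :=
    (tendsto_mesh.mono_left hl).eventually (gt_mem_nhds one_pos)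
  obtain ⟨U, hU1, hU2, hU3⟩ := exists_uniform_limit hT.le l (fun n t => step n (v n t))
    (C := 2 * μ) (fun n t => step_periodic _ _)
    (Filter.Eventually.of_forall fun n t ht x =>
      ⟨by linarith [(hv n).lower t ht ((⌊x / mesh n⌋ : ℤ) : ZMod (n + 1)),
          show step n (v n t) x = v n t ((⌊x / mesh n⌋ : ℤ) : ZMod (n + 1)) from rfl],
        (hv n).upper t ht _⟩)
    (equicontinuous_of_sq_le hl (θ₁ := fun r => (r * μ) ^ 2)
      (θ₂ := fun r => (E + 1) / μ * r ^ 2 + 2 * √((E + 1) / μ * r ^ 2) * μ)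
      (by fun_prop) (by fun_prop) (by simp) (by simp)
      (Filter.Eventually.of_forall fun n t ht x y hxy _ => by
        obtain ⟨k, h1, h2⟩ := exists_index_shift n hxy
        rw [step, step, h1, ← sq_abs]
        have h3 := (hv n).abs_shift_sub_le ht ((⌊x / mesh n⌋ : ℤ) : ZMod (n + 1)) k
        have h4 := mul_le_mul_of_nonneg_right h2 hμ.le
        gcongr
        exact h3.trans h4)
      (by
        filter_upwards [hK] with n hn t ht s hs x
        exact (hv n).sq_sub_le (hN n) hn hs ht _))
  obtain ⟨W, hW1, hW2, hW3⟩ := exists_uniform_limit hT.le l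
    (fun n t => step n (gridFlux (mesh n) (v n t)))
    (C := 1 / 10000) (fun n t => step_periodic _ _)
    (Filter.Eventually.of_forall fun n t ht x => (hv n).flux_mem ht _)
    (equicontinuous_of_sq_le hl (θ₁ := fun r => r * ((E + 1) / μ))
      (θ₂ := fun r => (E + 1) / μ ^ 2 * r + 2 * √((E + 1) / μ ^ 2 * r) * √(4 * ((E + 1) / μ)))
      (by fun_prop) (by fun_prop) (by simp) (by simp)
      (by
        filter_upwards [hK, hm] with n hn hmn t ht x y hxy hxy1
        obtain ⟨k, h1, h2⟩ := exists_index_shift n hxy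
        have hE0 : 0 ≤ E + 1 := by
          have := (hv n).energy_nonneg (t := 0) ⟨le_rfl, hT.le⟩
          linarith
        have hk : k ≤ n + 1 := by
          have h3 : (k : ℝ) * mesh n ≤ ((n + 1 : ℕ) : ℝ) * mesh n := by
            rw [mul_mesh]; linarith [Real.pi_gt_three]
          exact_mod_cast le_of_mul_le_mul_right h3 (mesh_pos n)
        rw [step, step, h1]
        refine ((hv n).sq_flux_shift_sub_le hn ht _ hk).trans ?_
        gcongr)
      (by
        filter_upwards [hK] with n hn t ht s hs x
        exact (hv n).sq_flux_sub_le (hN n) hn hs ht _))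
  exact ⟨l, U, W, hl, hu₀, hv, hv0, fun η hη => hl (hE η hη), hU1, hW1, hU2, hW2, hU3, hW3⟩

/-- A product of weakly convergent and uniformly convergent step functions converges weakly. -/
lemma tendsto_sum_of_weak {l : Filter ℕ} {a φ : (n : ℕ) → ZMod (n + 1) → ℝ} {C : ℝ} {A : ℝ}
    {Φ : ℝ → ℝ} (hΦ : Continuous Φ) (hC : ∀ᶠ n in l, mesh n * ∑ i, a n i ^ 2 ≤ C)
    (hlim : Filter.Tendsto (fun n => ∫ x, step n (a n) x * Φ x ∂period) l (nhds A))
    (hφ : StepTendsto l φ Φ) :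
    Filter.Tendsto (fun n => mesh n * ∑ i, a n i * φ n i) l (nhds A) := by
  rw [Metric.tendsto_nhds] at hlim ⊢
  intro ε hε
  have hCpos : 0 < |C| + 2 * Real.pi := by positivity
  set η := ε / (2 * (|C| + 2 * Real.pi)) with hη
  have hη0 : 0 < η := by positivity
  filter_upwards [hlim (ε / 2) (by positivity), hC, hφ η hη0] with n h1 h2 h3
  have h4 : |mesh n * ∑ i, a n i * φ n i - ∫ x, step n (a n) x * Φ x ∂period| ≤
      η * (|C| + 2 * Real.pi) / 2 := by
    have i0 := fun f => (memLp_step n f).integrable (by norm_num)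
    have i1 : Integrable (fun x => step n (a n) x * Φ x) period := by
      have := (intervalIntegrable_step n (a n) 0 (2 * Real.pi)).mul_continuousOn hΦ.continuousOn
      exact this.1
    rw [← integral_step', ← integral_sub (i0 _) i1]
    have h5 : ∫ x, η * ((step n (fun i => a n i ^ 2) x + 1) / 2) ∂period ≤
        η * (|C| + 2 * Real.pi) / 2 := by
      rw [integral_const_mul, integral_div, integral_add (i0 _) (integrable_const _),
        integral_step', integral_const]
      simp only [measureReal_restrict_apply_univ, Real.volume_real_Ioc, sub_zero, smul_eq_mul,
        mul_one, max_eq_left Real.two_pi_pos.le]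
      have := le_abs_self C
      rw [mul_div_assoc]
      gcongr
      linarith
    refine le_trans ?_ h5
    rw [← Real.norm_eq_abs]
    refine norm_integral_le_of_norm_le ((((i0 _).add (integrable_const _)).div_const 2).const_mul η)
      (Filter.Eventually.of_forall fun x => ?_)
    have e : step n (fun i => a n i * φ n i) x - step n (a n) x * Φ x =
        step n (a n) x * (step n (φ n) x - Φ x) := by simp only [step]; ring
    rw [e, Real.norm_eq_abs, abs_mul, mul_comm]
    have h6 : step n (fun i => a n i ^ 2) x = |step n (a n) x| ^ 2 := by simp only [step, sq_abs]
    simp only [h6]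
    gcongr
    · exact h3 x
    · nlinarith [sq_nonneg (|step n (a n) x| - 1)]
  have h7 : η * (|C| + 2 * Real.pi) / 2 = ε / 4 := by rw [hη]; field_simp; norm_num
  rw [h7] at h4
  rw [Real.dist_eq] at h1 ⊢
  have := abs_sub_le (mesh n * ∑ i, a n i * φ n i) (∫ x, step n (a n) x * Φ x ∂period) A
  linarith

namespace GridLimit

variable {l : Ultrafilter ℕ} {T μ E : ℝ} {u₀ : S1 → ℝ} {v : (n : ℕ) → ℝ → ZMod (n + 1) → ℝ}
  {U W : ℝ → ℝ → ℝ} (L : GridLimit l T μ E u₀ v U W)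
include L

lemma stepTendsto_U {t : ℝ} (ht : t ∈ Icc 0 T) : StepTendsto l (fun n => v n t) (U t) :=
  fun ε hε => (L.lim_U ε hε).mono fun _ h => h t ht

lemma stepTendsto_W {t : ℝ} (ht : t ∈ Icc 0 T) :
    StepTendsto l (fun n => gridFlux (mesh n) (v n t)) (W t) :=
  fun ε hε => (L.lim_W ε hε).mono fun _ h => h t ht

omit L in
lemma mem_Icc_of_stepTendsto {f : (n : ℕ) → ZMod (n + 1) → ℝ} {F : ℝ → ℝ}
    (hf : StepTendsto l f F) {a b : ℝ} (h : ∀ n i, f n i ∈ Icc a b) (x : ℝ) : F x ∈ Icc a b := by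
  have h1 : Filter.Tendsto (fun n => step n (f n) x) l (nhds (F x)) := by
    rw [Metric.tendsto_nhds]
    intro ε hε
    filter_upwards [hf (ε / 2) (by positivity)] with n hn
    rw [Real.dist_eq]
    linarith [hn x]
  exact isClosed_Icc.mem_of_tendsto h1 (Filter.Eventually.of_forall fun n => h n _)

lemma U_mem {t : ℝ} (ht : t ∈ Icc 0 T) (x : ℝ) : U t x ∈ Icc μ (2 * μ) :=
  mem_Icc_of_stepTendsto (L.stepTendsto_U ht)
    (fun n i => ⟨(L.flow n).lower t ht i, (L.flow n).upper t ht i⟩) x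

lemma W_mem {t : ℝ} (ht : t ∈ Icc 0 T) (x : ℝ) : W t x ∈ Icc (-(1 / 10000)) (1 / 10000) :=
  mem_Icc_of_stepTendsto (L.stepTendsto_W ht) (fun n i => (L.flow n).flux_mem ht i) x

lemma μ_pos : 0 < μ := (L.flow 0).μ_pos

lemma T_pos : 0 < T := (L.flow 0).T_pos

lemma initial : U 0 = lift u₀ := by
  have h1 := L.stepTendsto_U (t := 0) ⟨le_rfl, L.T_pos.le⟩
  simp only [L.v_zero] at h1
  have h2 := stepTendsto_sample L.le_atTop L.continuous_initial
  ext x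
  refine eq_of_forall_dist_le fun ε hε => ?_
  obtain ⟨n, h3, h4⟩ := ((h1 (ε / 2) (by positivity)).and (h2 (ε / 2) (by positivity))).exists
  have h5 := abs_le.mp (h3 x)
  have h6 := abs_le.mp (h4 x)
  rw [Real.dist_eq, abs_le]
  constructor <;> linarith

omit L in
lemma continuousOn_tan : ContinuousOn Real.tan (Icc (-(1 / 10000)) (1 / 10000)) :=
  Real.continuousOn_tan_Ioo.mono fun x hx =>
    ⟨by linarith [hx.1, Real.pi_gt_three], by linarith [hx.2, Real.pi_gt_three]⟩

lemma continuous_U' (t : ℝ) : Continuous (U t) :=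
  L.continuous_U.comp (by fun_prop : Continuous fun x : ℝ => (t, x))

lemma continuous_W' (t : ℝ) : Continuous (W t) :=
  L.continuous_W.comp (by fun_prop : Continuous fun x : ℝ => (t, x))

lemma continuous_tan_W {t : ℝ} (ht : t ∈ Icc 0 T) : Continuous fun x => Real.tan (W t x) :=
  continuousOn_tan.comp_continuous (L.continuous_W' t) (L.W_mem ht)

lemma stepTendsto_slope {t : ℝ} (ht : t ∈ Icc 0 T) :
    StepTendsto l (fun n => gridSlope (mesh n) (v n t)) (fun x => Real.tan (W t x)) := by
  have := (L.stepTendsto_W ht).comp continuousOn_tan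
    (Filter.Eventually.of_forall fun n i => (L.flow n).flux_mem ht i) (L.W_mem ht)
  simpa only [gridFlux, Real.tan_arctan] using this

lemma abs_tan_W_le {t : ℝ} (ht : t ∈ Icc 0 T) (x : ℝ) : |Real.tan (W t x)| ≤ 1 / 10000 :=
  abs_le.mpr (mem_Icc_of_stepTendsto (L.stepTendsto_slope ht)
    (fun n i => abs_le.mp ((L.flow n).slope_le t ht i)) x)

lemma hasPrim_U {t : ℝ} (ht : t ∈ Icc 0 T) :
    HasPrim (U t) (fun x => U t x * Real.tan (W t x)) := by
  have hμ := L.μ_pos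
  have hpos : ∀ x, 0 < U t x := fun x => hμ.trans_le (L.U_mem ht x).1
  have hlog : ContinuousOn Real.log (Icc μ (2 * μ)) :=
    Real.continuousOn_log.mono fun x hx => (hμ.trans_le hx.1).ne'
  obtain ⟨C, hC⟩ := isCompact_Icc.exists_bound_of_continuousOn hlog
  have hv : ∀ n i, v n t i ∈ Icc μ (2 * μ) := fun n i =>
    ⟨(L.flow n).lower t ht i, (L.flow n).upper t ht i⟩
  have h1 : HasPrim (fun x => Real.log (U t x)) (fun x => Real.tan (W t x)) := by
    refine hasPrim_of_grid L.le_atTop (f := fun n i => Real.log (v n t i))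
      (g := fun n => gridSlope (mesh n) (v n t)) (C := C) (D := 1 / 10000)
      (fun n i => by rw [gridSlope, mul_div_cancel₀ _ (mesh_pos n).ne'])
      ((L.stepTendsto_U ht).comp hlog (Filter.Eventually.of_forall hv) (L.U_mem ht))
      (L.stepTendsto_slope ht)
      ((L.continuous_U' t).log fun x => (hpos x).ne') (L.continuous_tan_W ht)
      (fun x => by simp only [L.periodic_U t x]) (fun x => by simp only [L.periodic_W t x])
      (Filter.Eventually.of_forall fun n i => hC _ (hv n i))
      (Filter.Eventually.of_forall fun n i => (L.flow n).slope_le t ht i)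
  have h2 := h1.comp (s := univ) (fun _ => mem_univ _) (fun y _ => Real.hasDerivAt_exp y)
    Real.continuous_exp.continuousOn
  simpa only [Real.exp_log (hpos _)] using h2

lemma sum_sq_vel_le {t : ℝ} (ht : t ∈ Icc 0 T) : ∀ᶠ n in (l : Filter ℕ),
    mesh n * ∑ i, gridVel (mesh n) (v n t) i ^ 2 ≤ (E + 1) / μ := by
  have hμ := L.μ_pos
  filter_upwards [L.energy 1 one_pos] with n hn
  exact ((L.flow n).sum_sq_vel_le ht).trans (by gcongr)

omit L in
/-- Summation by parts: the velocity of the semi-discrete flow is in divergence form. -/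
lemma sum_flux_mul_diff {n : ℕ} (f φ : ZMod (n + 1) → ℝ) :
    mesh n * ∑ i, gridFlux (mesh n) f i * ((φ (i + 1) - φ i) / mesh n) =
      -(mesh n * ∑ i, gridVel (mesh n) f i * φ i) := by
  have hm := (mesh_pos n).ne'
  have s1 := sum_by_parts φ (gridFlux (mesh n) f)
  rw [Finset.mul_sum, Finset.mul_sum]
  have e1 : ∀ i, mesh n * (gridFlux (mesh n) f i * ((φ (i + 1) - φ i) / mesh n)) =
    gridFlux (mesh n) f i * (φ (i + 1) - φ i) := fun i => by field_simp
  have e2 : ∀ i, mesh n * (gridVel (mesh n) f i * φ i) =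
    φ i * (gridFlux (mesh n) f i - gridFlux (mesh n) f (i - 1)) := fun i => by
      rw [gridVel]; field_simp
  simp only [e1, e2, s1, neg_neg]

/-- The derivative of the limit flux is the weak limit of the velocities. The energy is lower
semicontinuous under weak convergence, because it is convex in the velocity. -/
lemma exists_hasPrim_W {t : ℝ} (ht : t ∈ Icc 0 T) : ∃ G : S1 → ℝ, HasPrim (W t) (lift G) ∧
    MemLp G 2 ∧
    ∫ x in (0 : ℝ)..(2 * Real.pi), lift G x ^ 2 * (U t x * (1 + Real.tan (W t x) ^ 2)) ≤ E := by
  have hμ := L.μ_pos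
  have hC := L.sum_sq_vel_le ht
  obtain ⟨G, hG2, hG⟩ := exists_weak_limit_step l (fun n => gridVel (mesh n) (v n t)) hC
  refine ⟨G, ?_, hG2, ?_⟩
  · have hWc : Continuous (descend (W t)) :=
      continuous_of_lift (by rw [lift_descend (L.periodic_W t)]; exact L.continuous_W' t)
    have hw : HasWeakDeriv (descend (W t)) G := by
      refine ⟨integrable_of_continuous hWc, hG2.integrable (by norm_num), fun φ hφ => ?_⟩
      have h1 := (L.stepTendsto_W ht).tendsto_sum (stepTendsto_diff L.le_atTop hφ)
        (L.continuous_W' t) hφ.continuous_deriv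
        (by rw [← lift_circleDeriv]; exact lift_periodic _) (C := 1 / 10000)
        (Filter.Eventually.of_forall fun n i => abs_le.mpr ((L.flow n).flux_mem ht i))
      have hφ2 : MemLp (lift φ) 2 period := by
        obtain ⟨C, -, hC⟩ := exists_bound_of_continuous hφ.continuous
        exact MemLp.of_bound (lift_continuous hφ.continuous).aestronglyMeasurable C
          (Filter.Eventually.of_forall fun x => hC _)
      have h2 := (tendsto_sum_of_weak (lift_continuous hφ.continuous) hC (hG _ hφ2)
        (stepTendsto_sample L.le_atTop hφ.continuous)).neg
      simp only [sum_flux_mul_diff] at h1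
      have h3 := tendsto_nhds_unique h1 h2
      rw [integral_circle, integral_circle']
      have e3 : ∀ x, lift (fun x => descend (W t) x * circleDeriv φ x) x =
          W t x * deriv (lift φ) x := fun x => by
        simp only [lift, circleDeriv_coe]
        exact congrArg (· * _) (congrFun (lift_descend (L.periodic_W t)) x)
      simp only [e3]
      exact h3
    have := hw.hasPrim_of_continuous hWc
    rwa [lift_descend (L.periodic_W t)] at this
  · -- pass to the limit in `∫ (2 a G g - G² g) ≤ ∫ a² g`, where `a` is the discrete velocity
    set g : ℝ → ℝ := fun x => U t x * (1 + Real.tan (W t x) ^ 2) with hg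
    have hgc : Continuous g :=
      (L.continuous_U' t).mul (continuous_const.add ((L.continuous_tan_W ht).pow 2))
    have hg0 : ∀ x, 0 ≤ g x := fun x => by
      have := hμ.trans_le (L.U_mem ht x).1
      simp only [hg]; positivity
    have hgb : ∀ x, g x ≤ 4 * μ := fun x => by
      have h1 := (L.U_mem ht x).2
      have h2 := hμ.trans_le (L.U_mem ht x).1
      have h3 := L.abs_tan_W_le ht x
      have h4 : Real.tan (W t x) ^ 2 ≤ 1 := by
        rw [← sq_abs]; nlinarith [abs_nonneg (Real.tan (W t x))]
      simp only [hg]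
      calc U t x * (1 + Real.tan (W t x) ^ 2) ≤ (2 * μ) * (1 + 1) := by gcongr
        _ = 4 * μ := by ring
    have hstep : StepTendsto l (fun n i => v n t i * (1 + gridSlope (mesh n) (v n t) i ^ 2)) g := by
      have h1 := (L.stepTendsto_slope ht).comp (Φ := fun y => 1 + y ^ 2) (a := -(1 / 10000))
        (b := 1 / 10000) (by fun_prop)
        (Filter.Eventually.of_forall fun n i => abs_le.mp ((L.flow n).slope_le t ht i))
        (fun x => abs_le.mp (L.abs_tan_W_le ht x))
      refine (L.stepTendsto_U ht).mul h1 (C := 2 * μ) (D := 2)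
        (Filter.Eventually.of_forall fun n i => ?_) fun x => ?_
      · rw [abs_of_pos ((L.flow n).pos ht i)]
        exact (L.flow n).upper t ht i
      · have h3 := L.abs_tan_W_le ht x
        have h4 : Real.tan (W t x) ^ 2 ≤ 1 := by
          rw [← sq_abs]; nlinarith [abs_nonneg (Real.tan (W t x))]
        rw [abs_of_nonneg (by positivity)]
        linarith
    have hGl : MemLp (lift G) 2 period := memLp_lift_iff.mpr hG2
    have hGg : MemLp (fun x => lift G x * g x) 2 period := by
      have h1 : MemLp (fun x => g x * lift G x) 2 period := by
        refine MemLp.of_le_mul (c := 4 * μ) hGl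
          (hgc.aestronglyMeasurable.mul hGl.1) (Filter.Eventually.of_forall fun x => ?_)
        rw [Real.norm_eq_abs, Real.norm_eq_abs, abs_mul, abs_of_nonneg (hg0 x)]
        gcongr
        exact hgb x
      simpa only [mul_comm] using h1
    have hGGg : Integrable (fun x => lift G x ^ 2 * g x) period := by
      have := hGl.integrable_mul hGg
      refine this.congr (Filter.Eventually.of_forall fun x => ?_)
      simp only [Pi.mul_apply]; ring
    have hlim := hG _ hGg
    have e1 : ∫ x, lift G x * (lift G x * g x) ∂period = ∫ x, lift G x ^ 2 * g x ∂period :=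
      integral_congr_ae (Filter.Eventually.of_forall fun x => by simp only []; ring)
    rw [e1] at hlim
    rw [intervalIntegral.integral_of_le Real.two_pi_pos.le]
    change ∫ x, lift G x ^ 2 * g x ∂period ≤ E
    set I := ∫ x, lift G x ^ 2 * g x ∂period with hI
    have hlim2 : Filter.Tendsto (fun n => 2 * (∫ x, step n (gridVel (mesh n) (v n t)) x *
        (lift G x * g x) ∂period) - I) l (nhds (2 * I - I)) := (hlim.const_mul 2).sub_const I
    refine le_of_forall_pos_le_add fun ε hε => ?_
    have hE1 : 0 ≤ (E + 1) / μ := by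
      obtain ⟨n, hn⟩ := hC.exists
      refine le_trans (mul_nonneg (mesh_pos n).le (Finset.sum_nonneg fun i _ => sq_nonneg _)) hn
    set η := ε / 2 / ((E + 1) / μ + 1) with hη
    have hη0 : 0 < η := by positivity
    have hη1 : η * ((E + 1) / μ) ≤ ε / 2 := by
      rw [hη, div_mul_eq_mul_div, div_le_iff₀ (by positivity)]
      nlinarith
    have e2 : 2 * I - I = I := by ring
    rw [e2] at hlim2
    refine le_of_tendsto hlim2 ?_
    filter_upwards [hC, hstep η hη0, L.energy (ε / 2) (by positivity)] with n h1 h2 h3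
    set a := gridVel (mesh n) (v n t) with ha
    have i0 := fun f => (memLp_step n f).integrable (by norm_num)
    have i1 : Integrable (fun x => step n a x * (lift G x * g x)) period :=
      (memLp_step n a).integrable_mul hGg
    rw [hI, ← integral_const_mul, ← integral_sub (i1.const_mul 2) hGGg]
    have h4 : gridEnergy (mesh n) (v n t) ≤ E + ε / 2 := ((L.flow n).energy_le ht).trans h3
    rw [gridEnergy, ← integral_step'] at h4
    rw [← integral_step'] at h1
    calc ∫ x, (2 * (step n a x * (lift G x * g x)) - lift G x ^ 2 * g x) ∂period
        ≤ ∫ x, (step n (fun i => a i ^ 2 *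
            (v n t i * (1 + gridSlope (mesh n) (v n t) i ^ 2))) x +
            η * step n (fun i => a i ^ 2) x) ∂period := by
          refine integral_mono ((i1.const_mul 2).sub hGGg) ((i0 _).add ((i0 _).const_mul η))
            fun x => ?_
          have h5 := (abs_le.mp (h2 x)).1
          simp only [step] at h5 ⊢
          set i : ZMod (n + 1) := ((⌊x / mesh n⌋ : ℤ) : ZMod (n + 1))
          have h6 := mul_nonneg (hg0 x) (sq_nonneg (a i - lift G x))
          nlinarith [sq_nonneg (a i)]
      _ ≤ E + ε := by
          rw [integral_add (i0 _) ((i0 _).const_mul η), integral_const_mul]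
          have := mul_le_mul_of_nonneg_left h1 hη0.le
          linarith

/-- The weak equation: integrate the semi-discrete equation in time and pass to the limit. -/
lemma equation {φ : S1 → ℝ} (hφ : IsTest φ) {t : ℝ} (ht : t ∈ Icc 0 T) :
    (∫ x in (0 : ℝ)..(2 * Real.pi), U t x * lift φ x) -
      (∫ x in (0 : ℝ)..(2 * Real.pi), lift u₀ x * lift φ x) =
      -∫ s in (0 : ℝ)..t, ∫ x in (0 : ℝ)..(2 * Real.pi), W s x * deriv (lift φ) x := by
  have h0 : (0 : ℝ) ∈ Icc 0 T := ⟨le_rfl, L.T_pos.le⟩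
  have hst : Icc 0 t ⊆ Icc 0 T := Icc_subset_Icc_right ht.2
  have hφs := stepTendsto_sample L.le_atTop hφ.continuous
  have hS : ∀ s ∈ Icc 0 T, Filter.Tendsto (fun n => mesh n * ∑ i, v n s i * sample n φ i) l
      (nhds (∫ x in (0 : ℝ)..(2 * Real.pi), U s x * lift φ x)) := fun s hs =>
    (L.stepTendsto_U hs).tendsto_sum hφs (L.continuous_U' s) (lift_continuous hφ.continuous)
      (lift_periodic φ) (C := 2 * μ) (Filter.Eventually.of_forall fun n i => by
        rw [abs_of_pos ((L.flow n).pos hs i)]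
        exact (L.flow n).upper s hs i)
  set R : ℕ → ℝ → ℝ := fun n s => mesh n * ∑ i, gridFlux (mesh n) (v n s) i *
    ((sample n φ (i + 1) - sample n φ i) / mesh n) with hR
  have hRc : ∀ n, ContinuousOn (R n) (uIcc 0 t) := fun n s hs => by
    rw [uIcc_of_le ht.1] at hs
    exact ((HasDerivAt.fun_sum fun i _ => ((L.flow n).hasDerivAt_flux (hst hs) i).mul_const
      ((sample n φ (i + 1) - sample n φ i) / mesh n)).const_mul
        (mesh n)).continuousAt.continuousWithinAt
  have hftc : ∀ n, ∫ s in (0 : ℝ)..t, R n s =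
      -((mesh n * ∑ i, v n t i * sample n φ i) - mesh n * ∑ i, v n 0 i * sample n φ i) := by
    intro n
    have hd : ∀ s ∈ uIcc 0 t, HasDerivAt (fun s => -(mesh n * ∑ i, v n s i * sample n φ i))
        (R n s) s := by
      intro s hs
      rw [uIcc_of_le ht.1] at hs
      simp only [hR, sum_flux_mul_diff]
      exact ((HasDerivAt.fun_sum fun i _ =>
        ((L.flow n).hasDerivAt s (hst hs) i).mul_const (sample n φ i)).const_mul _).fun_neg
    rw [intervalIntegral.integral_eq_sub_of_hasDerivAt hd (hRc n).intervalIntegrable]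
    ring
  have hcW : Continuous fun s => ∫ x in (0 : ℝ)..(2 * Real.pi), W s x * deriv (lift φ) x :=
    intervalIntegral.continuous_parametric_intervalIntegral_of_continuous'
      (L.continuous_W.mul (hφ.continuous_deriv.comp continuous_snd)) _ _
  obtain ⟨D, hD0, hD⟩ := exists_bound_of_periodic hφ.continuous_deriv
    (by rw [← lift_circleDeriv]; exact lift_periodic _)
  have hRlim : Filter.Tendsto (fun n => ∫ s in (0 : ℝ)..t, R n s) l
      (nhds (∫ s in (0 : ℝ)..t, ∫ x in (0 : ℝ)..(2 * Real.pi), W s x * deriv (lift φ) x)) := by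
    rw [Metric.tendsto_nhds]
    intro ε hε
    have hpi := Real.two_pi_pos
    set M := (D + 1 / 10000) * (2 * Real.pi) * (t + 1) with hM
    have ht0 := ht.1
    have hM0 : 0 < M := by positivity
    set η := ε / 2 / M with hη
    have hη0 : 0 < η := by positivity
    filter_upwards [L.lim_W η hη0, stepTendsto_diff L.le_atTop hφ η hη0] with n h1 h2
    rw [Real.dist_eq, ← intervalIntegral.integral_sub (hRc n).intervalIntegrable
      (hcW.intervalIntegrable _ _)]
    have h3 := intervalIntegral.norm_integral_le_of_norm_le_const (a := 0) (b := t)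
      (C := (η * D + 1 / 10000 * η) * (2 * Real.pi))
      (f := fun s => R n s - ∫ x in (0 : ℝ)..(2 * Real.pi), W s x * deriv (lift φ) x) fun s hs => by
        rw [uIoc_of_le ht.1] at hs
        have hs' := hst ⟨hs.1.le, hs.2⟩
        exact abs_sum_sub_integral_le n _ _ (L.continuous_W' s) hφ.continuous_deriv
          (h1 s hs') h2 (fun i => abs_le.mpr ((L.flow n).flux_mem hs' i)) hD
    rw [sub_zero, abs_of_nonneg ht0] at h3
    refine lt_of_le_of_lt h3 ?_
    have h4 : (η * D + 1 / 10000 * η) * (2 * Real.pi) * t ≤ η * M := by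
      rw [hM]
      have : 0 ≤ η * (D + 1 / 10000) * (2 * Real.pi) := by positivity
      nlinarith
    have h5 : η * M = ε / 2 := by rw [hη]; field_simp
    linarith
  simp only [hftc] at hRlim
  have h6 := ((hS t ht).sub (hS 0 h0)).neg
  have h7 := tendsto_nhds_unique hRlim h6
  rw [L.initial] at h7
  rw [h7, neg_neg]

lemma limitFlow : LimitFlow T μ E u₀ U W :=
  ⟨L.continuous_U, L.continuous_W, L.periodic_U, L.periodic_W, fun _ ht => L.U_mem ht,
    fun _ ht => L.W_mem ht, L.initial, fun _ ht => L.hasPrim_U ht,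
    fun _ ht => L.exists_hasPrim_W ht, fun _ hφ _ ht => L.equation hφ ht⟩

end GridLimit

/-! ### The energy of the sampled initial value -/

/-- The Cauchy-Schwarz inequality against a constant. -/
lemma sq_integral_le {f : ℝ → ℝ} {a b : ℝ} (hab : a < b) (hf : IntervalIntegrable f volume a b)
    (hf2 : IntervalIntegrable (fun x => f x ^ 2) volume a b) :
    (∫ x in a..b, f x) ^ 2 ≤ (b - a) * ∫ x in a..b, f x ^ 2 := by
  have hd : 0 < b - a := sub_pos.mpr hab
  set I := ∫ x in a..b, f x
  set c := I / (b - a) with hc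
  have h0 : 0 ≤ ∫ x in a..b, (f x ^ 2 - 2 * c * f x + c ^ 2) :=
    intervalIntegral.integral_nonneg hab.le fun x _ => by nlinarith [sq_nonneg (f x - c)]
  rw [intervalIntegral.integral_add (hf2.sub (hf.const_mul _)) intervalIntegrable_const,
    intervalIntegral.integral_sub hf2 (hf.const_mul _), intervalIntegral.integral_const_mul,
    intervalIntegral.integral_const, smul_eq_mul] at h0
  have e : (b - a) * (2 * c * I - (b - a) * c ^ 2) = I ^ 2 := by rw [hc]; field_simp; ring
  rw [← e]
  gcongr
  linarith

lemma exists_arctan_sub_eq (a b : ℝ) :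
    ∃ z ∈ uIcc a b, Real.arctan b - Real.arctan a = (b - a) / (1 + z ^ 2) := by
  wlog h : a ≤ b generalizing a b
  · obtain ⟨z, hz, h1⟩ := this b a (le_of_not_ge h)
    exact ⟨z, by rwa [uIcc_comm], by rw [← neg_sub, h1, ← neg_div, neg_sub]⟩
  rcases eq_or_lt_of_le h with h | h
  · subst h
    exact ⟨a, left_mem_uIcc, by simp⟩
  · obtain ⟨z, hz, h1⟩ := exists_hasDerivAt_eq_slope Real.arctan (fun x => 1 / (1 + x ^ 2)) h
      Real.continuous_arctan.continuousOn fun x _ => Real.hasDerivAt_arctan x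
    refine ⟨z, Ioo_subset_Icc_self.trans Icc_subset_uIcc hz, ?_⟩
    have : 0 < b - a := sub_pos.mpr h
    have h2 : 0 < 1 + z ^ 2 := by positivity
    field_simp at h1 ⊢
    linarith

/-- The second difference of `V` on two adjacent cells, in terms of the second derivative `r`:
the difference of the two slopes is the average of `Y (s + h) - Y s` over the first cell, and
Cauchy-Schwarz applies to this average and to the integral of `r`. -/
lemma mul_sq_slope_sub_le {V Y r ρ P : ℝ → ℝ} (hV : ∀ x, HasDerivAt V (Y x) x) (hY : HasPrim Y r)
    (hr2 : ∀ a b, IntervalIntegrable (fun x => r x ^ 2) volume a b) (hP : HasPrim P ρ)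
    {x h κ : ℝ} (hh : 0 < h) (hκ0 : 0 ≤ κ) (hκ : ∀ s ∈ Icc x (x + 2 * h), κ * r s ^ 2 ≤ ρ s) :
    κ * ((V (x + h + h) - V (x + h)) / h - (V (x + h) - V x) / h) ^ 2 ≤
      ∫ s in x..(x + h), (P (s + h) - P s) := by
  have hYc := hY.continuous
  have hPc := hP.continuous
  have hD : Continuous fun s => Y (s + h) - Y s := by fun_prop
  have hVp := HasPrim.of_hasDerivAt hV hYc
  have e1 : (V (x + h + h) - V (x + h)) - (V (x + h) - V x) =
      ∫ s in x..(x + h), (Y (s + h) - Y s) := by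
    rw [intervalIntegral.integral_sub
      (Continuous.intervalIntegrable (by fun_prop : Continuous fun s => Y (s + h)) _ _)
      (hYc.intervalIntegrable _ _), intervalIntegral.integral_comp_add_right, ← hVp.sub_eq,
      ← hVp.sub_eq]
  have h1 := sq_integral_le (by linarith : x < x + h) (hD.intervalIntegrable _ _)
    ((hD.pow 2).intervalIntegrable _ _)
  rw [add_sub_cancel_left] at h1
  have h2 : ∫ s in x..(x + h), κ * (Y (s + h) - Y s) ^ 2 ≤
      ∫ s in x..(x + h), h * (P (s + h) - P s) := by
    refine intervalIntegral.integral_mono_on (by linarith)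
      (Continuous.intervalIntegrable (by fun_prop) _ _)
      (Continuous.intervalIntegrable (by fun_prop) _ _) fun s hs => ?_
    have h3 := sq_integral_le (by linarith : s < s + h) (hY.integrable _ _) (hr2 s (s + h))
    rw [← hY.sub_eq, add_sub_cancel_left] at h3
    have h4 : ∫ y in s..(s + h), κ * r y ^ 2 ≤ ∫ y in s..(s + h), ρ y :=
      intervalIntegral.integral_mono_on (by linarith) ((hr2 _ _).const_mul κ)
        (hP.integrable _ _) fun y hy => hκ y ⟨by linarith [hs.1, hy.1], by linarith [hs.2, hy.2]⟩
    rw [intervalIntegral.integral_const_mul, ← hP.sub_eq] at h4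
    have h5 := mul_le_mul_of_nonneg_left h3 hκ0
    have h6 := mul_le_mul_of_nonneg_left h4 hh.le
    linarith
  rw [intervalIntegral.integral_const_mul, intervalIntegral.integral_const_mul] at h2
  rw [← sub_div, e1, div_pow, mul_div_assoc', div_le_iff₀ (by positivity)]
  have h7 := mul_le_mul_of_nonneg_left h1 hκ0
  have h8 := mul_le_mul_of_nonneg_left h2 hh.le
  nlinarith

/-- The contribution of one cell to the discrete energy. The slopes and the intermediate value in
the mean value theorem for the arctangent are values of `Y` at points of the two cells. -/
lemma sq_arctan_slope_sub_le {V Y r ρ P : ℝ → ℝ} (hV : ∀ x, HasDerivAt V (Y x) x)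
    (hY : HasPrim Y r) (hr2 : ∀ a b, IntervalIntegrable (fun x => r x ^ 2) volume a b)
    (hP : HasPrim P ρ) {x h κ : ℝ} (hh : 0 < h) (hκ0 : 0 ≤ κ)
    (hκ : ∀ ξ ∈ Icc x (x + 2 * h), ∀ ζ ∈ Icc x (x + 2 * h), ∀ s ∈ Icc x (x + 2 * h),
      κ * (1 + Y ξ ^ 2) * ((1 + Y ζ ^ 2) ^ 2)⁻¹ * r s ^ 2 ≤ ρ s) :
    (Real.arctan ((V (x + h + h) - V (x + h)) / h) - Real.arctan ((V (x + h) - V x) / h)) ^ 2 *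
      (κ * (1 + ((V (x + h + h) - V (x + h)) / h) ^ 2)) ≤
      ∫ s in x..(x + h), (P (s + h) - P s) := by
  obtain ⟨ξ₁, hξ₁, e1⟩ := exists_slope_eq hV (x + h) hh
  obtain ⟨ξ₀, hξ₀, e0⟩ := exists_slope_eq hV x hh
  obtain ⟨z, hz, ez⟩ := exists_arctan_sub_eq ((V (x + h) - V x) / h)
    ((V (x + h + h) - V (x + h)) / h)
  rw [e0, e1] at hz
  obtain ⟨ζ, hζ, rfl⟩ := intermediate_value_uIcc hY.continuous.continuousOn hz
  have hζ' : ζ ∈ Icc x (x + 2 * h) := by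
    rw [mem_uIcc] at hζ
    rcases hζ with hζ | hζ
    · exact ⟨hξ₀.1.trans hζ.1, hζ.2.trans (by linarith [hξ₁.2])⟩
    · exact ⟨(by linarith [hξ₁.1] : x ≤ ξ₁).trans hζ.1, hζ.2.trans (by linarith [hξ₀.2])⟩
  have hξ' : ξ₁ ∈ Icc x (x + 2 * h) := ⟨by linarith [hξ₁.1], by linarith [hξ₁.2]⟩
  have key := mul_sq_slope_sub_le hV hY hr2 hP hh
    (κ := κ * (1 + Y ξ₁ ^ 2) * ((1 + Y ζ ^ 2) ^ 2)⁻¹) (by positivity) (hκ ξ₁ hξ' ζ hζ')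
  refine le_trans (le_of_eq ?_) key
  rw [ez, e1, div_pow]
  ring

/-- The weight in the discrete energy, evaluated at three nearby points, is almost the weight
`u / (1 + y²)`. -/
lemma exists_uniform_weight {u y : ℝ → ℝ} (hu : Continuous u) (hy : Continuous y)
    (hup : Function.Periodic u (2 * Real.pi)) (hyp : Function.Periodic y (2 * Real.pi)) {η : ℝ}
    (hη : 0 < η) : ∃ δ > 0, ∀ x ξ ζ s, |x - s| < δ → |ξ - s| < δ → |ζ - s| < δ →
      u x * (1 + y ξ ^ 2) * ((1 + y ζ ^ 2) ^ 2)⁻¹ ≤ u s / (1 + y s ^ 2) + η := by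
  have hBc : Continuous fun x => 1 + y x ^ 2 := by fun_prop
  have hBp : Function.Periodic (fun x => 1 + y x ^ 2) (2 * Real.pi) := fun x => by simp only [hyp x]
  have hB0 : ∀ x, 1 ≤ 1 + y x ^ 2 := fun x => by nlinarith [sq_nonneg (y x)]
  have hCc : Continuous fun x => ((1 + y x ^ 2) ^ 2)⁻¹ :=
    (hBc.pow 2).inv₀ fun x => pow_ne_zero 2 (one_pos.trans_le (hB0 x)).ne'
  have hCp : Function.Periodic (fun x => ((1 + y x ^ 2) ^ 2)⁻¹) (2 * Real.pi) :=
    fun x => by simp only [hyp x]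
  obtain ⟨M₁, hM₁, b1⟩ := exists_bound_of_periodic hu hup
  obtain ⟨M₂, hM₂, b2⟩ := exists_bound_of_periodic hBc hBp
  set τ := η / (M₂ + M₁ + M₁ * M₂) with hτ
  have hτ0 : 0 < τ := by positivity
  obtain ⟨δ₁, hδ₁, k1⟩ := uniformContinuous_of_periodic hu hup hτ0
  obtain ⟨δ₂, hδ₂, k2⟩ := uniformContinuous_of_periodic hBc hBp hτ0
  obtain ⟨δ₃, hδ₃, k3⟩ := uniformContinuous_of_periodic hCc hCp hτ0
  refine ⟨min δ₁ (min δ₂ δ₃), by positivity, fun x ξ ζ s h1 h2 h3 => ?_⟩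
  have l1 := (k1 x s (h1.trans_le (min_le_left _ _))).le
  have l2 := (k2 ξ s (h2.trans_le ((min_le_right _ _).trans (min_le_left _ _)))).le
  have l3 := (k3 ζ s (h3.trans_le ((min_le_right _ _).trans (min_le_right _ _)))).le
  have e : u s / (1 + y s ^ 2) = u s * (1 + y s ^ 2) * ((1 + y s ^ 2) ^ 2)⁻¹ := by
    have := (one_pos.trans_le (hB0 s)).ne'
    field_simp
  have hC1 : ∀ x, |((1 + y x ^ 2) ^ 2)⁻¹| ≤ 1 := fun x => by
    rw [abs_of_nonneg (by positivity)]
    exact inv_le_one_of_one_le₀ (one_le_pow₀ (hB0 x))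
  rw [e]
  have e2 : u x * (1 + y ξ ^ 2) * ((1 + y ζ ^ 2) ^ 2)⁻¹ -
      u s * (1 + y s ^ 2) * ((1 + y s ^ 2) ^ 2)⁻¹ =
      (u x - u s) * (1 + y ξ ^ 2) * ((1 + y ζ ^ 2) ^ 2)⁻¹ +
      u s * ((1 + y ξ ^ 2) - (1 + y s ^ 2)) * ((1 + y ζ ^ 2) ^ 2)⁻¹ +
      u s * (1 + y s ^ 2) * (((1 + y ζ ^ 2) ^ 2)⁻¹ - ((1 + y s ^ 2) ^ 2)⁻¹) := by ring
  have e3 : |u x * (1 + y ξ ^ 2) * ((1 + y ζ ^ 2) ^ 2)⁻¹ -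
      u s * (1 + y s ^ 2) * ((1 + y s ^ 2) ^ 2)⁻¹| ≤ τ * M₂ * 1 + M₁ * τ * 1 + M₁ * M₂ * τ := by
    rw [e2]
    refine (abs_add_three _ _ _).trans ?_
    simp only [abs_mul]
    have c1 := b1 s
    have c2 := b2 ξ
    have c3 := b2 s
    have c4 := hC1 ζ
    gcongr
  have e4 : τ * M₂ * 1 + M₁ * τ * 1 + M₁ * M₂ * τ = η := by rw [hτ]; field_simp
  linarith [le_abs_self (u x * (1 + y ξ ^ 2) * ((1 + y ζ ^ 2) ^ 2)⁻¹ -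
      u s * (1 + y s ^ 2) * ((1 + y s ^ 2) ^ 2)⁻¹)]

lemma integral_shift_sub {P ρ : ℝ → ℝ} (hP : HasPrim P ρ)
    (hρ : Function.Periodic ρ (2 * Real.pi)) (h : ℝ) :
    ∫ s in (0 : ℝ)..(2 * Real.pi), (P (s + h) - P s) =
      h * ∫ s in (0 : ℝ)..(2 * Real.pi), ρ s := by
  have hPc := hP.continuous
  have hi := fun a b => hPc.intervalIntegrable (μ := volume) a b
  rw [intervalIntegral.integral_sub
    (Continuous.intervalIntegrable (by fun_prop : Continuous fun s => P (s + h)) _ _) (hi _ _),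
    intervalIntegral.integral_comp_add_right, zero_add]
  have e1 : (∫ s in h..(2 * Real.pi + h), P s) - ∫ s in (0 : ℝ)..(2 * Real.pi), P s =
      (∫ s in (0 : ℝ)..h, P (s + 2 * Real.pi)) - ∫ s in (0 : ℝ)..h, P s := by
    rw [intervalIntegral.integral_comp_add_right, zero_add, add_comm h]
    have a1 := intervalIntegral.integral_add_adjacent_intervals (hi 0 h) (hi h (2 * Real.pi + h))
    have a2 := intervalIntegral.integral_add_adjacent_intervals (hi 0 (2 * Real.pi))
      (hi (2 * Real.pi) (2 * Real.pi + h))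
    linarith
  rw [e1, ← intervalIntegral.integral_sub
    (Continuous.intervalIntegrable (by fun_prop) _ _) (hi _ _)]
  have e2 : ∀ s, P (s + 2 * Real.pi) - P s = ∫ s in (0 : ℝ)..(2 * Real.pi), ρ s := fun s => by
    rw [hP.sub_eq, hρ.intervalIntegral_add_eq s 0, zero_add]
  simp only [e2, intervalIntegral.integral_const, sub_zero, smul_eq_mul]

/-- The discrete energy of the values of `u₀` at the grid points is asymptotically at most the
energy of `u₀`: the second differences of `log u₀` are averages of its second derivative `r`. -/
lemma eventually_gridEnergy_sample_le {u₀ y r : S1 → ℝ} (hu₀ : Continuous u₀)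
    (hpos : ∀ x, 0 < u₀ x)
    (hV : ∀ x, HasDerivAt (fun x => Real.log (lift u₀ x)) (lift y x) x)
    (hY : HasPrim (lift y) (lift r)) (hr : MemLp r 2) {η : ℝ} (hη : 0 < η) :
    ∀ᶠ n in Filter.atTop, gridEnergy (mesh n) (sample n u₀) ≤
      (∫ x in (0 : ℝ)..(2 * Real.pi), lift r x ^ 2 * (lift u₀ x / (1 + lift y x ^ 2))) + η := by
  have hyc : Continuous y := continuous_of_lift hY.continuous
  set V : ℝ → ℝ := fun x => Real.log (lift u₀ x)
  have hr2 : ∀ a b, IntervalIntegrable (fun x => lift r x ^ 2) volume a b :=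
    fun a b => intervalIntegrable_lift hr.integrable_sq a b
  set I := ∫ x in (0 : ℝ)..(2 * Real.pi), lift r x ^ 2 with hI
  have hI0 : 0 ≤ I := intervalIntegral.integral_nonneg Real.two_pi_pos.le fun x _ => sq_nonneg _
  set τ := η / (I + 1) with hτ
  have hτ0 : 0 < τ := by positivity
  have hτI : τ * I ≤ η := by
    rw [hτ, div_mul_eq_mul_div, div_le_iff₀ (by positivity)]; nlinarith
  obtain ⟨δ, hδ, hw⟩ := exists_uniform_weight (lift_continuous hu₀) hY.continuous
    (lift_periodic u₀) (lift_periodic y) hτ0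
  set G : ℝ → ℝ := fun x => lift u₀ x / (1 + lift y x ^ 2) with hG
  have hGc : Continuous G := (lift_continuous hu₀).div
    (continuous_const.add (hY.continuous.pow 2)) fun x => by positivity
  set ρ : ℝ → ℝ := fun x => lift r x ^ 2 * G x + τ * lift r x ^ 2 with hρ
  have hρ1 : ∀ a b, IntervalIntegrable (fun x => lift r x ^ 2 * G x) volume a b :=
    fun a b => (hr2 a b).mul_continuousOn hGc.continuousOn
  have hρi : ∀ a b, IntervalIntegrable ρ volume a b :=
    fun a b => (hρ1 a b).add ((hr2 a b).const_mul τ)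
  have hρp : Function.Periodic ρ (2 * Real.pi) := fun x => by
    simp only [hρ, hG, lift_periodic r x, lift_periodic u₀ x, lift_periodic y x]
  set P : ℝ → ℝ := fun x => ∫ t in (0 : ℝ)..x, ρ t with hPdef
  have hP : HasPrim P ρ := HasPrim.of_eq_add hρi 0 fun x => by simp [hPdef]
  have hPc := hP.continuous
  have hmesh : ∀ᶠ n in Filter.atTop, mesh n < δ / 2 :=
    tendsto_mesh.eventually (gt_mem_nhds (by positivity))
  filter_upwards [hmesh] with n hn
  have hm := mesh_pos n
  set h := mesh n with hh
  set f := sample n u₀ with hf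
  set e : ZMod (n + 1) → ℝ := fun i => gridVel h f i ^ 2 * (f i * (1 + gridSlope h f i ^ 2))
    with he
  have hlog : ∀ k : ℤ, Real.log (f (k : ZMod (n + 1))) = V (k * h) := fun k => by
    rw [hf, sample_intCast]
  -- contribution of one cell
  have hcell : ∀ k : ℕ, h ^ 2 * e ((k : ZMod (n + 1)) + 1) ≤
      ∫ s in ((k : ℝ) * h)..(((k + 1 : ℕ) : ℝ) * h), (P (s + h) - P s) := by
    intro k
    have i0 : ((k : ZMod (n + 1))) = ((k : ℤ) : ZMod (n + 1)) := by push_cast; rfl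
    have i1 : ((k : ZMod (n + 1)) + 1) = ((k + 1 : ℤ) : ZMod (n + 1)) := by push_cast; rfl
    have i2 : ((k : ZMod (n + 1)) + 1 + 1) = ((k + 1 + 1 : ℤ) : ZMod (n + 1)) := by push_cast; rfl
    have j0 : Real.log (f (k : ZMod (n + 1))) = V (k * h) := by rw [i0, hlog]; push_cast; rfl
    have j1 : Real.log (f ((k : ZMod (n + 1)) + 1)) = V (k * h + h) := by
      rw [i1, hlog]; congr 1; push_cast; ring
    have j2 : Real.log (f ((k : ZMod (n + 1)) + 1 + 1)) = V (k * h + h + h) := by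
      rw [i2, hlog]; congr 1; push_cast; ring
    have j3 : f ((k : ZMod (n + 1)) + 1) = lift u₀ (k * h + h) := by
      rw [i1, hf, sample_intCast]; congr 1; push_cast; ring
    have s1 : gridSlope h f ((k : ZMod (n + 1)) + 1) =
      (V (k * h + h + h) - V (k * h + h)) / h := by rw [gridSlope, j1, j2]
    have s0 : gridSlope h f (k : ZMod (n + 1)) = (V (k * h + h) - V (k * h)) / h := by
      rw [gridSlope, j0, j1]
    have key := sq_arctan_slope_sub_le (x := k * h) (κ := lift u₀ (k * h + h)) hV hY hr2 hP hm
      (hpos _).le fun ξ hξ ζ hζ s hs => by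
        have h1 := hw (k * h + h) ξ ζ s
          (by rw [abs_lt]; constructor <;> linarith [hs.1, hs.2])
          (by rw [abs_lt]; constructor <;> linarith [hs.1, hs.2, hξ.1, hξ.2])
          (by rw [abs_lt]; constructor <;> linarith [hs.1, hs.2, hζ.1, hζ.2])
        have h2 := mul_le_mul_of_nonneg_right h1 (sq_nonneg (lift r s))
        simp only [hρ, hG]
        linarith
    have e1 : (((k + 1 : ℕ) : ℝ) * h) = k * h + h := by push_cast; ring
    rw [e1]
    refine le_trans (le_of_eq ?_) key
    simp only [he, gridVel, gridFlux, add_sub_cancel_right, s0, s1, j3]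
    field_simp
  have hsum : ∑ i, e i = ∑ k ∈ Finset.range (n + 1), e ((k : ZMod (n + 1)) + 1) := by
    rw [sum_range_grid n fun i => e (i + 1)]
    exact (Equiv.sum_comp (Equiv.addRight (1 : ZMod (n + 1))) e).symm
  have htotal : h ^ 2 * ∑ i, e i ≤ h * ∫ s in (0 : ℝ)..(2 * Real.pi), ρ s := by
    rw [← integral_shift_sub hP hρp, hsum, Finset.mul_sum]
    refine (Finset.sum_le_sum fun k _ => hcell k).trans (le_of_eq ?_)
    have := intervalIntegral.sum_integral_adjacent_intervals (μ := volume)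
      (f := fun s => P (s + h) - P s) (a := fun k : ℕ => (k : ℝ) * h) (n := n + 1)
      (fun k _ => Continuous.intervalIntegrable (by fun_prop) _ _)
    rw [this, hh, mul_mesh, Nat.cast_zero, zero_mul]
  have hρint : ∫ s in (0 : ℝ)..(2 * Real.pi), ρ s =
      (∫ x in (0 : ℝ)..(2 * Real.pi), lift r x ^ 2 * G x) + τ * I := by
    rw [hI, ← intervalIntegral.integral_const_mul,
      ← intervalIntegral.integral_add (hρ1 _ _) ((hr2 _ _).const_mul τ)]
  have hfin : gridEnergy h f ≤ ∫ s in (0 : ℝ)..(2 * Real.pi), ρ s := by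
    rw [gridEnergy]
    refine le_of_mul_le_mul_left (le_trans (le_of_eq ?_) htotal) hm
    ring
  rw [hρint] at hfin
  linarith

/-! ### The initial value -/

lemma weightedEnergy_eq {f p q : S1 → ℝ} (h1 : HasWeakDeriv f p) (h2 : HasWeakDeriv p q) :
    weightedEnergy f = ∫ x, (f x * q x - p x ^ 2) ^ 2 / (f x * (f x ^ 2 + p x ^ 2)) := by
  have e1 := h1.weakDeriv_ae_eq
  have e2 := (h2.congr e1.symm (by rfl)).weakDeriv_ae_eq
  refine integral_congr_ae ?_
  filter_upwards [e1, e2] with x k1 k2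
  rw [k1, k2]

lemma dissipation_eq {f p q : S1 → ℝ} (h1 : HasWeakDeriv f p) (h2 : HasWeakDeriv p q) :
    dissipation f = ∫ x, (f x * q x - p x ^ 2) ^ 2 / (f x ^ 2 + p x ^ 2) ^ 2 := by
  have e1 := h1.weakDeriv_ae_eq
  have e2 := (h2.congr e1.symm (by rfl)).weakDeriv_ae_eq
  refine integral_congr_ae ?_
  filter_upwards [e1, e2] with x k1 k2
  rw [k1, k2]

/-- A positive function with small logarithmic derivative varies by a factor of at most two. -/
lemma exists_bounds_of_log_deriv_le {f y : S1 → ℝ} (hf : Continuous f) (hpos : ∀ x, 0 < f x)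
    (hV : ∀ x, HasDerivAt (fun x => Real.log (lift f x)) (lift y x) x)
    (hy : ∀ x, |y x| ≤ 1 / 10000) : ∃ μ, 0 < μ ∧ ∀ x, μ ≤ f x ∧ f x ≤ 2 * μ := by
  obtain ⟨x₀, -, hx₀⟩ := isCompact_univ.exists_isMinOn univ_nonempty hf.continuousOn
  refine ⟨f x₀, hpos x₀, fun x => ⟨hx₀ (mem_univ x), ?_⟩⟩
  have h1 := Convex.norm_image_sub_le_of_norm_hasDerivWithin_le (s := univ) (C := 1 / 10000)
    (fun z _ => (hV z).hasDerivWithinAt) (fun z _ => hy _) convex_univ (mem_univ (section₀ x₀))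
    (mem_univ (section₀ x))
  simp only [lift_section₀] at h1
  -- both points of the section lie in one period, and `7 / 10000 ≤ log 2`
  have h2 : |section₀ x - section₀ x₀| ≤ 7 := by
    have a1 := section₀_mem x
    have a2 := section₀_mem x₀
    have := Real.pi_lt_d2
    rw [abs_le]
    constructor <;> linarith [a1.1, a1.2, a2.1, a2.2]
  rw [Real.norm_eq_abs, Real.norm_eq_abs] at h1
  have h3 := (le_abs_self _).trans h1
  have h4 : Real.log (f x) ≤ Real.log (2 * f x₀) := by
    rw [Real.log_mul two_ne_zero (hpos x₀).ne']
    linarith [Real.log_two_gt_d9]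
  exact (Real.log_le_log_iff (hpos x) (by linarith [hpos x₀])).mp h4

/-- An essential bound on the flux of a continuously differentiable function holds everywhere. -/
lemma abs_div_le_of_eLpNorm_le {f p p' : S1 → ℝ} {δ : ℝ} (hδ : 0 ≤ δ) (hf : Continuous f)
    (hpos : ∀ x, 0 < f x) (hp' : Continuous p') (hpp' : p =ᵐ[volume] p')
    (h : eLpNorm (fun x => Real.arctan (p x / f x)) ⊤ volume ≤ ENNReal.ofReal (Real.arctan δ))
    (x : S1) : |p' x / f x| ≤ δ := by
  have hδ' : 0 ≤ Real.arctan δ := Real.arctan_nonneg.mpr hδ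
  have hc : Continuous fun x => |Real.arctan (p' x / f x)| :=
    (Real.continuous_arctan.comp (hp'.div hf fun x => (hpos x).ne')).abs
  have h1 : ∀ᵐ x, |Real.arctan (p' x / f x)| ≤ Real.arctan δ := by
    rw [eLpNorm_exponent_top] at h
    filter_upwards [ae_le_eLpNormEssSup (f := fun x => Real.arctan (p x / f x)) (μ := volume),
      hpp'] with x k1 k2
    have k3 := k1.trans h
    rw [Real.enorm_eq_ofReal_abs, ENNReal.ofReal_le_ofReal_iff hδ', k2] at k3
    exact k3
  -- the bound holds almost everywhere, and both sides are continuous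
  have h2 : (fun x => max |Real.arctan (p' x / f x)| (Real.arctan δ)) = fun _ => Real.arctan δ := by
    refine (Continuous.ae_eq_iff_eq volume (hc.max continuous_const) continuous_const).mp ?_
    filter_upwards [h1] with x hx using max_eq_right hx
  have h3 : |Real.arctan (p' x / f x)| ≤ Real.arctan δ := max_eq_right_iff.mp (congrFun h2 x)
  rw [abs_le, ← Real.arctan_neg] at h3
  exact abs_le.mpr ⟨Real.arctan_strictMono.le_iff_le.mp h3.1,
    Real.arctan_strictMono.le_iff_le.mp h3.2⟩

/-- Initial values with small flux admit a limit of semi-discrete flows. -/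
lemma exists_limitFlow {u₀ : S1 → ℝ} (hu₀ : Continuous u₀) (h2 : MemH2 u₀)
    (hpos : ∀ x, 0 < u₀ x)
    (hsmall : eLpNorm (fun x => Real.arctan (weakDeriv u₀ x / u₀ x)) ⊤ volume ≤
      ENNReal.ofReal (Real.arctan (1 / 10000))) {T : ℝ} (hT : 0 < T) :
    ∃ μ U W, 0 < μ ∧ LimitFlow T μ (weightedEnergy u₀) u₀ U W := by
  obtain ⟨-, p₀, q, hp₀, -, hq, hq2⟩ := h2
  obtain ⟨p, hpp, h1, h2, -⟩ := exists_hasPrim_flux hu₀ hpos hp₀ hq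
  have hpc : Continuous p := continuous_of_lift h2.continuous
  set y : S1 → ℝ := fun x => p x / u₀ x with hy
  set r : S1 → ℝ := fun x => (u₀ x * q x - p x ^ 2) / u₀ x ^ 2 with hr
  have hyc : Continuous y := hpc.div hu₀ fun x => (hpos x).ne'
  have hV : ∀ x, HasDerivAt (fun x => Real.log (lift u₀ x)) (lift y x) x := fun x =>
    (h1.hasDerivAt h2.continuous x).log (hpos _).ne'
  have hY : HasPrim (lift y) (lift r) := hasPrim_div hpos h1 h2
  have hrL : MemLp r 2 := by
    have hic : Continuous fun x => (u₀ x)⁻¹ := hu₀.inv₀ fun x => (hpos x).ne'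
    obtain ⟨C, hC0, hC⟩ := exists_bound_of_continuous hic
    obtain ⟨D, hD0, hD⟩ := exists_bound_of_continuous (hyc.pow 2)
    have a1 : MemLp (fun x => (u₀ x)⁻¹ * q x) 2 :=
      MemLp.of_le_mul (c := C) hq2 (hic.aestronglyMeasurable.mul hq2.1)
        (Filter.Eventually.of_forall fun x => by
          rw [norm_mul]; exact mul_le_mul_of_nonneg_right (hC x) (norm_nonneg _))
    have a2 : MemLp (fun x => y x ^ 2) 2 := MemLp.of_bound (hyc.pow 2).aestronglyMeasurable D
      (Filter.Eventually.of_forall hD)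
    refine (a1.sub a2).ae_eq (Filter.Eventually.of_forall fun x => ?_)
    have := hpos x
    simp only [hr, hy, Pi.sub_apply]
    field_simp
  have hyb : ∀ x, |y x| ≤ 1 / 10000 := fun x =>
    abs_div_le_of_eLpNorm_le (by norm_num) hu₀ hpos hpc (hp₀.weakDeriv_ae_eq.trans hpp) hsmall x
  obtain ⟨μ, hμ, hbd⟩ := exists_bounds_of_log_deriv_le hu₀ hpos hV hyb
  have hflow : ∀ n, ∃ v : ℝ → ZMod (n + 1) → ℝ, v 0 = sample n u₀ ∧ GridFlow (mesh n) μ T v := by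
    intro n
    refine GridFlow.exists_of_initial (mesh_pos n) ?_ hμ hT _ (fun i => (hbd _).1)
      (fun i => (hbd _).2) fun i => ?_
    · rw [mul_mesh]; linarith [Real.pi_lt_d2]
    · obtain ⟨k, rfl⟩ := ZMod.intCast_surjective i
      obtain ⟨ξ, -, hξ⟩ := exists_slope_eq hV (k * mesh n) (mesh_pos n)
      have e : ((k : ZMod (n + 1)) + 1) = ((k + 1 : ℤ) : ZMod (n + 1)) := by push_cast; rfl
      rw [gridSlope, e, sample_intCast, sample_intCast, intCast_add_one_mul, hξ]
      exact hyb _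
  choose v hv0 hv using hflow
  have hE : weightedEnergy u₀ =
      ∫ x in (0 : ℝ)..(2 * Real.pi), lift r x ^ 2 * (lift u₀ x / (1 + lift y x ^ 2)) := by
    rw [weightedEnergy_eq (hp₀.congr (by rfl) hpp) (hq.congr hpp (by rfl)), integral_circle]
    refine congrArg (fun f : ℝ → ℝ => ∫ x in (0 : ℝ)..(2 * Real.pi), f x) (funext fun x => ?_)
    have := hpos (x : S1)
    simp only [hr, hy, lift]
    have h3 : 0 < u₀ (x : S1) ^ 2 + p (x : S1) ^ 2 := by positivity
    field_simp
  obtain ⟨l, U, W, L⟩ := exists_gridLimit (E := weightedEnergy u₀) hu₀ hv hv0 fun η hη => by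
    simp only [hv0, hE]
    exact eventually_gridEnergy_sample_le hu₀ hpos hV hY hrL hη
  exact ⟨μ, U, W, hμ, L.limitFlow⟩

/-! ### The solution obtained from a limit of semi-discrete flows -/

/-- The first spatial derivative of the limit: the slope `∂ₓ log u` is the tangent of the flux. -/
def limitDeriv (U W : ℝ → ℝ → ℝ) (t : ℝ) (x : S1) : ℝ :=
  descend (U t) x * Real.tan (descend (W t) x)

/-- The velocity of the limit: the spatial derivative of the flux, chosen as the pointwise
derivative because this is jointly measurable. -/
def limitVel (W : ℝ → ℝ → ℝ) (t : ℝ) (x : S1) : ℝ := descend (deriv (W t)) x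

/-- The second spatial derivative of the limit. -/
def limitDeriv₂ (U W : ℝ → ℝ → ℝ) (t : ℝ) (x : S1) : ℝ :=
  descend (U t) x * (Real.tan (descend (W t) x) ^ 2 +
    (1 + Real.tan (descend (W t) x) ^ 2) * limitVel W t x)

lemma measurable_tan : Measurable Real.tan := by
  have : Real.tan = fun x => Real.sin x / Real.cos x := funext Real.tan_eq_sin_div_cos
  rw [this]
  exact Real.measurable_sin.div Real.measurable_cos

lemma measurable_section₀ : Measurable section₀ := measurePreserving_section₀.measurable

lemma measurable_descend {f : ℝ → ℝ → ℝ} (hf : Measurable (Function.uncurry f)) :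
    Measurable (Function.uncurry fun t => descend (f t)) :=
  hf.comp (measurable_fst.prodMk (measurable_section₀.comp measurable_snd))

lemma continuous_descend {f : ℝ → ℝ → ℝ} (hf : Continuous (Function.uncurry f))
    (hp : ∀ t, Function.Periodic (f t) (2 * Real.pi)) :
    Continuous (Function.uncurry fun t => descend (f t)) := by
  have hq : IsOpenQuotientMap (Prod.map (id : ℝ → ℝ) (fun x : ℝ => (x : S1))) :=
    IsOpenQuotientMap.id.prodMap QuotientAddGroup.isOpenQuotientMap_mk
  rw [← hq.continuous_comp_iff]
  refine hf.congr fun z => ?_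
  exact (congrFun (lift_descend (hp z.1)) z.2).symm

lemma memLp_of_abs_le {α : Type*} [MeasurableSpace α] {κ : Measure α} [IsFiniteMeasure κ]
    {f g : α → ℝ} {C : ℝ} (hg : MemLp g 2 κ) (hf : AEStronglyMeasurable f κ)
    (h : ∀ᵐ x ∂κ, |f x| ≤ C * (1 + 2 * |g x|)) : MemLp f 2 κ := by
  have h1 : MemLp (fun _ : α => (1 : ℝ)) 2 κ := memLp_const 1
  have h2 := (h1.add (hg.norm.const_mul 2)).const_mul C
  refine h2.mono hf ?_
  filter_upwards [h] with x hx
  exact hx.trans (le_abs_self _)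

namespace LimitFlow

variable {T μ E : ℝ} {u₀ : S1 → ℝ} {U W : ℝ → ℝ → ℝ} (L : LimitFlow T μ E u₀ U W) (hμ : 0 < μ)
include L

lemma descend_U_mem {t : ℝ} (ht : t ∈ Icc 0 T) (x : S1) : descend (U t) x ∈ Icc μ (2 * μ) :=
  L.U_mem t ht (section₀ x)

lemma descend_W_mem {t : ℝ} (ht : t ∈ Icc 0 T) (x : S1) :
    descend (W t) x ∈ Ioo (-(Real.pi / 2)) (Real.pi / 2) := by
  have h1 := L.W_mem t ht (section₀ x)
  have := Real.pi_gt_three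
  exact ⟨(by linarith : _ < -(1 / 10000 : ℝ)).trans_le h1.1, h1.2.trans_lt (by linarith)⟩

lemma tan_sq_le {t : ℝ} (ht : t ∈ Icc 0 T) (x : S1) : Real.tan (descend (W t) x) ^ 2 ≤ 1 := by
  have h1 := L.W_mem t ht (section₀ x)
  have hpi := Real.pi_gt_three
  have h2 : Real.tan (descend (W t) x) ≤ 1 := by
    rw [← Real.tan_pi_div_four]
    refine (Real.strictMonoOn_tan.le_iff_le (L.descend_W_mem ht x) ⟨by linarith, by linarith⟩).mpr
      (h1.2.trans (by linarith))
  have h3 : -1 ≤ Real.tan (descend (W t) x) := by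
    rw [← Real.tan_pi_div_four, ← Real.tan_neg]
    refine (Real.strictMonoOn_tan.le_iff_le ⟨by linarith, by linarith⟩ (L.descend_W_mem ht x)).mpr
      (le_trans (by linarith) h1.1)
  nlinarith

lemma lift_U (t : ℝ) : lift (descend (U t)) = U t := lift_descend (L.periodic_U t)

lemma lift_W (t : ℝ) : lift (descend (W t)) = W t := lift_descend (L.periodic_W t)

lemma lift_limitVel (t : ℝ) : lift (limitVel W t) = deriv (W t) := by
  refine lift_descend fun x => ?_
  have h1 : (fun y => W t (y + 2 * Real.pi)) = W t := funext (L.periodic_W t)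
  rw [← deriv_comp_add_const, h1]

lemma limitVel_ae_eq {t : ℝ} {G : S1 → ℝ} (hG : HasPrim (W t) (lift G)) :
    limitVel W t =ᵐ[volume] G := by
  refine ae_lift_iff.mp (ae_restrict_of_ae ?_)
  filter_upwards [hG.ae_hasDerivAt] with x hx
  exact (congrFun (L.lift_limitVel t) x).trans hx.deriv

lemma hasPrim_W' {t : ℝ} (ht : t ∈ Icc 0 T) : HasPrim (W t) (lift (limitVel W t)) := by
  obtain ⟨G, h1, -, -⟩ := L.hasPrim_W t ht
  exact h1.congr_ae (ae_line_of_ae_circle (p := fun x => G x = limitVel W t x)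
    (L.limitVel_ae_eq h1).symm)

lemma memLp_limitVel {t : ℝ} (ht : t ∈ Icc 0 T) : MemLp (limitVel W t) 2 := by
  obtain ⟨G, h1, h2, -⟩ := L.hasPrim_W t ht
  exact h2.ae_eq (L.limitVel_ae_eq h1).symm

lemma hasPrim_u {t : ℝ} (ht : t ∈ Icc 0 T) :
    HasPrim (lift (descend (U t))) (lift (limitDeriv U W t)) := by
  have h1 := L.hasPrim_U t ht
  have e : lift (limitDeriv U W t) = fun x => U t x * Real.tan (W t x) := by
    ext x
    have a1 := congrFun (L.lift_U t) x
    have a2 := congrFun (L.lift_W t) x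
    simp only [lift] at a1 a2
    simp only [lift, limitDeriv, a1, a2]
  rwa [e, L.lift_U]

lemma hasPrim_limitDeriv {t : ℝ} (ht : t ∈ Icc 0 T) :
    HasPrim (lift (limitDeriv U W t)) (lift (limitDeriv₂ U W t)) := by
  have hW := L.hasPrim_W' ht
  rw [← L.lift_W] at hW
  have hcos : ∀ y ∈ Ioo (-(Real.pi / 2)) (Real.pi / 2), Real.cos y ≠ 0 := fun y hy =>
    (Real.cos_pos_of_mem_Ioo hy).ne'
  have htan := hW.comp (fun x => L.descend_W_mem ht (x : S1))
    (fun y hy => Real.hasDerivAt_tan (hcos y hy))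
    (continuousOn_const.div (Real.continuous_cos.continuousOn.pow 2)
      fun y hy => pow_ne_zero 2 (hcos y hy))
  have h1 := (L.hasPrim_u ht).mul htan
  refine (show _ = lift (limitDeriv₂ U W t) from ?_) ▸ h1
  ext x
  have h2 := Real.inv_one_add_tan_sq (hcos _ (L.descend_W_mem ht (x : S1)))
  simp only [lift, limitDeriv₂, limitDeriv, ← h2, one_div, inv_inv]
  ring

lemma hasWeakDeriv_u {t : ℝ} (ht : t ∈ Icc 0 T) :
    HasWeakDeriv (descend (U t)) (limitDeriv U W t) := HasPrim.hasWeakDeriv (L.hasPrim_u ht)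

lemma hasWeakDeriv_limitDeriv {t : ℝ} (ht : t ∈ Icc 0 T) :
    HasWeakDeriv (limitDeriv U W t) (limitDeriv₂ U W t) :=
  HasPrim.hasWeakDeriv (L.hasPrim_limitDeriv ht)

include hμ

/-- In terms of the flux `w` and the velocity `ν = ∂ₓ w` the weighted energy is
`∫ ν² u (1 + tan² w)`. -/
lemma weightedEnergy_u_eq {t : ℝ} (ht : t ∈ Icc 0 T) : weightedEnergy (descend (U t)) =
    ∫ x, limitVel W t x ^ 2 * (descend (U t) x * (1 + Real.tan (descend (W t) x) ^ 2)) := by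
  rw [weightedEnergy_eq (L.hasWeakDeriv_u ht) (L.hasWeakDeriv_limitDeriv ht)]
  refine congrArg (fun f : S1 → ℝ => ∫ x, f x) (funext fun x => ?_)
  have h1 := hμ.trans_le (L.descend_U_mem ht x).1
  simp only [limitDeriv, limitDeriv₂]
  set a := descend (U t) x
  set b := Real.tan (descend (W t) x)
  have h2 : a ^ 2 + (a * b) ^ 2 = a ^ 2 * (1 + b ^ 2) := by ring
  have h3 : 0 < 1 + b ^ 2 := by positivity
  rw [h2]
  field_simp
  ring

lemma dissipation_u_eq {t : ℝ} (ht : t ∈ Icc 0 T) :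
    dissipation (descend (U t)) = ∫ x, limitVel W t x ^ 2 := by
  rw [dissipation_eq (L.hasWeakDeriv_u ht) (L.hasWeakDeriv_limitDeriv ht)]
  refine congrArg (fun f : S1 → ℝ => ∫ x, f x) (funext fun x => ?_)
  have h1 := hμ.trans_le (L.descend_U_mem ht x).1
  simp only [limitDeriv, limitDeriv₂]
  set a := descend (U t) x
  set b := Real.tan (descend (W t) x)
  have h2 : a ^ 2 + (a * b) ^ 2 = a ^ 2 * (1 + b ^ 2) := by ring
  have h3 : 0 < 1 + b ^ 2 := by positivity
  rw [h2]
  field_simp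
  ring

lemma weightedEnergy_u_le {t : ℝ} (ht : t ∈ Icc 0 T) : weightedEnergy (descend (U t)) ≤ E := by
  rw [L.weightedEnergy_u_eq hμ ht]
  obtain ⟨G, h1, -, h3⟩ := L.hasPrim_W t ht
  refine le_trans (le_of_eq ?_) h3
  have h4 : ∫ x, limitVel W t x ^ 2 * (descend (U t) x * (1 + Real.tan (descend (W t) x) ^ 2)) =
      ∫ x, G x ^ 2 * (descend (U t) x * (1 + Real.tan (descend (W t) x) ^ 2)) := by
    refine integral_congr_ae ?_
    filter_upwards [L.limitVel_ae_eq h1] with x hx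
    rw [hx]
  rw [h4, integral_circle]
  refine congrArg (fun f : ℝ → ℝ => ∫ x in (0 : ℝ)..(2 * Real.pi), f x) (funext fun x => ?_)
  have a1 := congrFun (L.lift_U t) x
  have a2 := congrFun (L.lift_W t) x
  simp only [lift] at a1 a2
  simp only [lift, a1, a2]

lemma integral_sq_limitVel_le {t : ℝ} (ht : t ∈ Icc 0 T) :
    ∫ x, limitVel W t x ^ 2 ≤ E / μ := by
  have h1 := L.weightedEnergy_u_le hμ ht
  rw [L.weightedEnergy_u_eq hμ ht] at h1
  have hν := (L.memLp_limitVel ht).integrable_sq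
  have hc : Continuous fun x => descend (U t) x * (1 + Real.tan (descend (W t) x) ^ 2) := by
    have c1 : Continuous (descend (U t)) := continuous_of_lift (L.hasPrim_u ht).continuous
    have c2 : Continuous (limitDeriv U W t) :=
      continuous_of_lift (L.hasPrim_limitDeriv ht).continuous
    have hp : ∀ x, descend (U t) x ≠ 0 := fun x =>
      (hμ.trans_le (L.descend_U_mem ht x).1).ne'
    have e : (fun x => descend (U t) x * (1 + Real.tan (descend (W t) x) ^ 2)) =
        fun x => descend (U t) x * (1 + (limitDeriv U W t x / descend (U t) x) ^ 2) := by
      ext x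
      rw [limitDeriv, mul_div_cancel_left₀ _ (hp x)]
    rw [e]
    exact c1.mul (continuous_const.add ((c2.div c1 hp).pow 2))
  rw [le_div_iff₀ hμ, ← integral_mul_const]
  refine (integral_mono (hν.mul_const μ) (integrable_mul_continuous hν hc) fun x => ?_).trans h1
  have h2 := (L.descend_U_mem ht x).1
  have h3 := hμ.trans_le h2
  have : μ ≤ descend (U t) x * (1 + Real.tan (descend (W t) x) ^ 2) := by
    nlinarith [mul_nonneg h3.le (sq_nonneg (Real.tan (descend (W t) x)))]
  simp only []
  gcongr

lemma abs_u_le {t : ℝ} (ht : t ∈ Icc 0 T) (x : S1) : |descend (U t) x| ≤ 2 * μ := by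
  have h := L.descend_U_mem ht x
  rw [abs_of_pos (hμ.trans_le h.1)]
  exact h.2

lemma abs_limitDeriv_le {t : ℝ} (ht : t ∈ Icc 0 T) (x : S1) : |limitDeriv U W t x| ≤ 2 * μ := by
  have h1 := L.abs_u_le hμ ht x
  have h2 : |Real.tan (descend (W t) x)| ≤ 1 := (sq_le_one_iff_abs_le_one _).mp (L.tan_sq_le ht x)
  rw [limitDeriv, abs_mul]
  calc _ ≤ 2 * μ * 1 := by gcongr
    _ = 2 * μ := mul_one _

lemma abs_limitDeriv₂_le {t : ℝ} (ht : t ∈ Icc 0 T) (x : S1) :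
    |limitDeriv₂ U W t x| ≤ 2 * μ * (1 + 2 * |limitVel W t x|) := by
  have h1 := L.abs_u_le hμ ht x
  have h2 := L.tan_sq_le ht x
  rw [limitDeriv₂, abs_mul]
  gcongr
  refine (abs_add_le _ _).trans ?_
  rw [abs_mul, abs_of_nonneg (sq_nonneg _), abs_of_nonneg (by positivity)]
  gcongr
  linarith

omit L hμ in
lemma volume_real_circle : (volume : Measure S1).real univ = 2 * Real.pi := by
  rw [Measure.real, AddCircle.measure_univ, ENNReal.toReal_ofReal Real.two_pi_pos.le]

omit L hμ in
lemma integral_sq_le_of_abs_le {f : S1 → ℝ} {C : ℝ} (hf : Continuous f)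
    (h : ∀ x, |f x| ≤ C) : ∫ x, f x ^ 2 ≤ C ^ 2 * (2 * Real.pi) := by
  have h1 := integral_mono (μ := volume) (integrable_of_continuous (hf.pow 2))
    (integrable_const (C ^ 2)) fun x => (sq_le_sq' (by linarith [abs_le.mp (h x)])
      (abs_le.mp (h x)).2 : f x ^ 2 ≤ C ^ 2)
  rw [integral_const, volume_real_circle, smul_eq_mul] at h1
  exact h1.trans_eq (mul_comm _ _)

lemma memLp_limitDeriv₂ {t : ℝ} (ht : t ∈ Icc 0 T) : MemLp (limitDeriv₂ U W t) 2 := by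
  exact memLp_of_abs_le (L.memLp_limitVel ht) (L.hasWeakDeriv_limitDeriv ht).integrable_right.1
    (Filter.Eventually.of_forall (L.abs_limitDeriv₂_le hμ ht))

lemma memH2 {t : ℝ} (ht : t ∈ Icc 0 T) : MemH2 (descend (U t)) := by
  have c1 : Continuous (descend (U t)) := continuous_of_lift (L.hasPrim_u ht).continuous
  have c2 : Continuous (limitDeriv U W t) :=
    continuous_of_lift (L.hasPrim_limitDeriv ht).continuous
  exact ⟨MemLp.of_bound c1.aestronglyMeasurable _ (Filter.Eventually.of_forall (L.abs_u_le hμ ht)),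
    _, _, L.hasWeakDeriv_u ht, MemLp.of_bound c2.aestronglyMeasurable _
      (Filter.Eventually.of_forall (L.abs_limitDeriv_le hμ ht)),
    L.hasWeakDeriv_limitDeriv ht, L.memLp_limitDeriv₂ hμ ht⟩

lemma integral_sq_limitDeriv₂_le {t : ℝ} (ht : t ∈ Icc 0 T) :
    ∫ x, limitDeriv₂ U W t x ^ 2 ≤ 8 * μ ^ 2 * (2 * Real.pi + 4 * (E / μ)) := by
  have hν := (L.memLp_limitVel ht).integrable_sq
  have hi : Integrable fun x : S1 => 8 * μ ^ 2 * (1 + 4 * limitVel W t x ^ 2) :=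
    (Integrable.fun_add (integrable_const 1) (hν.const_mul 4)).const_mul (8 * μ ^ 2)
  have hle : ∀ x, limitDeriv₂ U W t x ^ 2 ≤ 8 * μ ^ 2 * (1 + 4 * limitVel W t x ^ 2) := fun x => by
    have h2 := L.abs_limitDeriv₂_le hμ ht x
    have h3 : limitDeriv₂ U W t x ^ 2 ≤ (2 * μ * (1 + 2 * |limitVel W t x|)) ^ 2 := by
      rw [← sq_abs]; gcongr
    have h4 := mul_nonneg (sq_nonneg μ) (sq_nonneg (1 - 2 * |limitVel W t x|))
    have h5 := sq_abs (limitVel W t x)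
    calc _ ≤ _ := h3
      _ = 8 * μ ^ 2 * (1 + 4 * |limitVel W t x| ^ 2) -
          4 * (μ ^ 2 * (1 - 2 * |limitVel W t x|) ^ 2) := by ring
      _ ≤ _ := by rw [h5]; linarith
  refine (integral_mono (L.memLp_limitDeriv₂ hμ ht).integrable_sq hi hle).trans ?_
  rw [integral_const_mul]
  have h5 : ∫ x, (1 + 4 * limitVel W t x ^ 2) =
      2 * Real.pi + 4 * ∫ x, limitVel W t x ^ 2 := by
    rw [integral_add (integrable_const _) (hν.const_mul 4), integral_const, volume_real_circle,
      integral_const_mul, smul_eq_mul, mul_one]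
  rw [h5]
  have := L.integral_sq_limitVel_le hμ ht
  gcongr

omit hμ in
lemma measurable_u : Measurable (Function.uncurry fun t => descend (U t)) :=
  measurable_descend L.continuous_U.measurable

omit hμ in
lemma measurable_limitVel : Measurable (Function.uncurry (limitVel W)) :=
  measurable_descend (measurable_deriv_with_param L.continuous_W)

omit hμ in
lemma measurable_tan_w :
    Measurable (Function.uncurry fun t x => Real.tan (descend (W t) x)) :=
  measurable_tan.comp (measurable_descend L.continuous_W.measurable)

omit hμ in
lemma measurable_limitDeriv : Measurable (Function.uncurry (limitDeriv U W)) :=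
  L.measurable_u.mul L.measurable_tan_w

omit hμ in
lemma measurable_limitDeriv₂ : Measurable (Function.uncurry (limitDeriv₂ U W)) :=
  L.measurable_u.mul ((L.measurable_tan_w.pow_const 2).add
    ((measurable_const.add (L.measurable_tan_w.pow_const 2)).mul L.measurable_limitVel))

omit L hμ in
lemma ae_mem_Icc (T : ℝ) : ∀ᵐ t ∂(volume.restrict (Ioo 0 T)), t ∈ Icc 0 T :=
  (ae_restrict_mem measurableSet_Ioo).mono fun _ ht => Ioo_subset_Icc_self ht

omit L hμ in
lemma ae_spaceTime_mem (T : ℝ) : ∀ᵐ z ∂(spaceTime T), z.1 ∈ Icc 0 T :=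
  Measure.quasiMeasurePreserving_fst.ae (ae_mem_Icc T)

lemma integrable_sq_limitVel :
    Integrable (fun z : ℝ × S1 => limitVel W z.1 z.2 ^ 2) (spaceTime T) := by
  have hm : Measurable fun z : ℝ × S1 => limitVel W z.1 z.2 ^ 2 :=
    L.measurable_limitVel.pow_const 2
  rw [spaceTime, integrable_prod_iff hm.aestronglyMeasurable]
  constructor
  · filter_upwards [ae_mem_Icc T] with t ht using (L.memLp_limitVel ht).integrable_sq
  · have hm2 : Measurable fun z : ℝ × S1 => ‖limitVel W z.1 z.2 ^ 2‖ := hm.norm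
    refine Integrable.of_bound hm2.stronglyMeasurable.integral_prod_right.aestronglyMeasurable
      (E / μ) ?_
    filter_upwards [ae_mem_Icc T] with t ht
    rw [Real.norm_of_nonneg (integral_nonneg fun x => norm_nonneg _)]
    simp only [Real.norm_of_nonneg (sq_nonneg _)]
    exact L.integral_sq_limitVel_le hμ ht

lemma memL2H2 : MemL2H2 T fun t => descend (U t) := by
  have hT := ae_spaceTime_mem T
  refine ⟨MemLp.of_bound L.measurable_u.aestronglyMeasurable (2 * μ) ?_, limitDeriv U W,
    limitDeriv₂ U W, MemLp.of_bound L.measurable_limitDeriv.aestronglyMeasurable (2 * μ) ?_, ?_, ?_⟩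
  · filter_upwards [hT] with z hz using L.abs_u_le hμ hz z.2
  · filter_upwards [hT] with z hz using L.abs_limitDeriv_le hμ hz z.2
  · have hν : MemLp (Function.uncurry (limitVel W)) 2 (spaceTime T) :=
      (memLp_two_iff_integrable_sq L.measurable_limitVel.aestronglyMeasurable).mpr
        (L.integrable_sq_limitVel hμ)
    refine memLp_of_abs_le (C := 2 * μ) hν L.measurable_limitDeriv₂.aestronglyMeasurable ?_
    filter_upwards [hT] with z hz using L.abs_limitDeriv₂_le hμ hz z.2
  · filter_upwards [ae_mem_Icc T] with t ht
    exact ⟨L.hasWeakDeriv_u ht, L.hasWeakDeriv_limitDeriv ht⟩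

lemma isSolution : IsSolution T u₀ fun t => descend (U t) where
  continuousOn := (continuous_descend L.continuous_U L.periodic_U).continuousOn
  pos t ht x := hμ.trans_le (L.descend_U_mem ht x).1
  initial := by
    rw [L.initial]
    exact funext (lift_section₀ u₀)
  memL2H2 := L.memL2H2 hμ
  equation φ hφ t ht := by
    have h1 := L.equation φ hφ t ht
    have e1 : ∫ x, descend (U t) x * φ x = ∫ x in (0 : ℝ)..(2 * Real.pi), U t x * lift φ x := by
      rw [integral_circle]
      refine congrArg (fun f : ℝ → ℝ => ∫ x in (0 : ℝ)..(2 * Real.pi), f x) (funext fun x => ?_)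
      exact congrArg (· * _) (congrFun (L.lift_U t) x)
    have e2 : ∫ x, u₀ x * φ x = ∫ x in (0 : ℝ)..(2 * Real.pi), lift u₀ x * lift φ x := by
      rw [integral_circle]; rfl
    rw [e1, e2, h1]
    congr 1
    refine intervalIntegral.integral_congr fun s hs => ?_
    rw [uIcc_of_le ht.1] at hs
    have hs' : s ∈ Icc 0 T := ⟨hs.1, hs.2.trans ht.2⟩
    have e3 : ∫ x, Real.arctan (weakDeriv (descend (U s)) x / descend (U s) x) *
        circleDeriv φ x = ∫ x, descend (W s) x * circleDeriv φ x := by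
      refine integral_congr_ae ?_
      filter_upwards [(L.hasWeakDeriv_u hs').weakDeriv_ae_eq] with x hx
      have h2 := L.descend_W_mem hs' x
      rw [hx, limitDeriv, mul_div_cancel_left₀ _ (hμ.trans_le (L.descend_U_mem hs' x).1).ne',
        Real.arctan_tan h2.1 h2.2]
    simp only [e3]
    rw [integral_circle]
    refine congrArg (fun f : ℝ → ℝ => ∫ x in (0 : ℝ)..(2 * Real.pi), f x) (funext fun x => ?_)
    simp only [lift, circleDeriv_coe]
    exact congrArg (· * _) (congrFun (L.lift_W s) x).symm

lemma intervalIntegrable_dissipation (hT : 0 ≤ T) :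
    IntervalIntegrable (fun s => dissipation (descend (U s))) volume 0 T := by
  rw [intervalIntegrable_iff_integrableOn_Ioo_of_le hT]
  refine (L.integrable_sq_limitVel hμ).integral_prod_left.congr ?_
  filter_upwards [ae_mem_Icc T] with t ht using (L.dissipation_u_eq hμ ht).symm

lemma memLinftyH2 {u : ℝ → S1 → ℝ}
    (hm : AEStronglyMeasurable (Function.uncurry u) (spaceTime T))
    (hu : ∀ t ∈ Icc 0 T, u t = descend (U t)) : MemLinftyH2 T u := by
  refine ⟨hm, limitDeriv U W, limitDeriv₂ U W, √((2 * μ) ^ 2 * (2 * Real.pi) +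
    (2 * μ) ^ 2 * (2 * Real.pi) + 8 * μ ^ 2 * (2 * Real.pi + 4 * (E / μ))),
    L.measurable_limitDeriv.aestronglyMeasurable, L.measurable_limitDeriv₂.aestronglyMeasurable, ?_⟩
  filter_upwards [ae_mem_Icc T] with t ht
  have c1 : Continuous (descend (U t)) := continuous_of_lift (L.hasPrim_u ht).continuous
  have c2 : Continuous (limitDeriv U W t) :=
    continuous_of_lift (L.hasPrim_limitDeriv ht).continuous
  rw [hu t ht]
  refine ⟨L.hasWeakDeriv_u ht, L.hasWeakDeriv_limitDeriv ht,
    MemLp.of_bound c1.aestronglyMeasurable _ (Filter.Eventually.of_forall (L.abs_u_le hμ ht)),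
    MemLp.of_bound c2.aestronglyMeasurable _
      (Filter.Eventually.of_forall (L.abs_limitDeriv_le hμ ht)), L.memLp_limitDeriv₂ hμ ht, ?_⟩
  exact Real.sqrt_le_sqrt (add_le_add (add_le_add
    (integral_sq_le_of_abs_le c1 (L.abs_u_le hμ ht))
    (integral_sq_le_of_abs_le c2 (L.abs_limitDeriv_le hμ ht))) (L.integral_sq_limitDeriv₂_le hμ ht))

end LimitFlow

lemma dissipation_nonneg (f : S1 → ℝ) : 0 ≤ dissipation f :=
  integral_nonneg fun x => by positivity

lemma weightedEnergy_nonneg {f : S1 → ℝ} (h : ∀ x, 0 < f x) : 0 ≤ weightedEnergy f :=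
  integral_nonneg fun x => by have := h x; positivity

end ArctanDiffusion

end

open ArctanDiffusion in
theorem theorem5 :
    ∃ ε : ℝ, 0 < ε ∧ ∀ m : ℝ, 0 < m → ∃ c : ℝ, 0 < c ∧
      ∀ u₀ : S1 → ℝ, Continuous u₀ → MemH2 u₀ → (∀ x, m ≤ u₀ x) →
        eLpNorm (fun x => Real.arctan (weakDeriv u₀ x / u₀ x)) ⊤ volume ≤ ENNReal.ofReal ε →
        ∀ T : ℝ, 0 < T →
          (∃ u : ℝ → S1 → ℝ, IsSolution T u₀ u) ∧
          ∀ u : ℝ → S1 → ℝ, IsSolution T u₀ u →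
            IntervalIntegrable (fun s => dissipation (u s)) volume 0 T ∧
            (∀ t ∈ Icc 0 T, MemH2 (u t) ∧
              weightedEnergy (u t) ≤
                weightedEnergy u₀ *
                  Real.exp (c * ∫ s in (0 : ℝ)..t, (dissipation (u s) + 1))) ∧
            MemLinftyH2 T u := by
  -- for such small fluxes the weighted energy does not increase, so any `c > 0` is admissible
  refine ⟨Real.arctan (1 / 10000), Real.arctan_pos.mpr (by norm_num), fun m hm =>
    ⟨1, one_pos, fun u₀ hu₀ h2 hmu hsmall T hT => ?_⟩⟩
  have hpos : ∀ x, 0 < u₀ x := fun x => hm.trans_le (hmu x)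
  obtain ⟨μ, U, W, hμ, L⟩ := exists_limitFlow hu₀ h2 hpos hsmall hT
  refine ⟨⟨_, L.isSolution hμ⟩, fun u hu => ?_⟩
  have heq : ∀ t ∈ Icc 0 T, u t = descend (U t) := fun t ht => hu.eq hT (L.isSolution hμ) ht
  refine ⟨?_, fun t ht => ⟨?_, ?_⟩, L.memLinftyH2 hμ hu.memL2H2.1.1 heq⟩
  · refine (L.intervalIntegrable_dissipation hμ hT.le).congr fun t ht => ?_
    rw [uIoc_of_le hT.le] at ht
    simp only [heq t ⟨ht.1.le, ht.2⟩]
  · rw [heq t ht]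
    exact L.memH2 hμ ht
  · rw [heq t ht]
    refine (L.weightedEnergy_u_le hμ ht).trans
      (le_mul_of_one_le_right (weightedEnergy_nonneg hpos) (Real.one_le_exp ?_))
    rw [one_mul]
    exact intervalIntegral.integral_nonneg ht.1 fun s _ =>
      add_nonneg (dissipation_nonneg _) zero_le_one
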